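/- Let $\hbar,m,\beta>0$. Let $V:\mathbb R\to(-\infty,+\infty]$ be measurable and bounded from below, and let the one-particle Hamiltonian $H^0=-\frac{\hbar^2}{2m}\frac{d^2}{dx^2}+V(x)$ (defined through its quadratic form; the value $+\infty$ of $V$ is allowed, so that boxes are included) have a complete orthonormal system of eigenvectors $\varphi_0,\varphi_1,\dots$ with eigenvalues $\varepsilon_0\le\varepsilon_1\le\varepsilon_2\le\cdots$. Suppose that the trap is superharmonic, i.e. $n/\varepsilon_n\to0$ as $n\to\infty$. Let $u:\mathbb R\to\mathbb R$ be integrable, bounded from below and independent of $N$, and let $$H_N=\sum_{i=1}^N\Big[-\frac{\hbar^2}{2m}\frac{\partial^2}{\partial x_i^2}+V(x_i)\Big]+\sum_{1\le i<j\le N}u(x_i-x_j)$$ act (as the operator of its quadratic form) in the symmetric subspace of $L^2(\mathbb R^N)$. For $N\ge1$, $H_N$ has a complete orthonormal system of eigenvectors and $\operatorname{Tr}e^{-\beta H_N}<\infty$, with the trace taken over the symmetric subspace. Let $\langle A\rangle_{\beta H_N}=\operatorname{Tr}(Ae^{-\beta H_N})/\operatorname{Tr}e^{-\beta H_N}$,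 let $\langle n_j\rangle_{\beta H_N}$ be the mean number of particles in $\varphi_j$, where $n_j=\sum_{i=1}^N(|\varphi_j\rangle\langle\varphi_j|)_i$ and the subscript $i$ indicates the variable acted on, and let $\lambda_0(N)\ge\lambda_1(N)\ge\cdots$ be the eigenvalues, counted with multiplicity, of the one-particle reduced density matrix of this thermal state, normalized to have trace $N$. Then there is complete generalized Bose–Einstein condensation at every temperature: there exist sequences of non-negative integers $J(N)$ with $J(N)/N\to0$ and $N/\varepsilon_{J(N)}\to0$, and for every such choice of $J(N)$ $$\lim_{N\to\infty}\frac1N\sum_{j=0}^{J(N)}\lambda_j(N)=\lim_{N\to\infty}\frac1N\sum_{j=0}^{J(N)}\langle n_j\rangle_{\beta H_N}=1 .$$ -/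

import Mathlib

open MeasureTheory Filter Topology Asymptotics
open scoped ContDiff

/-- The complex Hilbert space `L²(X)` with respect to the volume of `X`. -/
abbrev L2 (X : Type*) [MeasureSpace X] : Type _ := Lp ℂ 2 (volume : Measure X)

section Schrodinger

variable {X : Type*} [NormedAddCommGroup X] [NormedSpace ℝ X] [MeasureSpace X]

/-- `g ∈ L²` is the weak derivative of `f ∈ L²` in the direction `a`. -/
def IsWeakDeriv (a : X) (f g : L2 X) : Prop :=
  ∀ η : X → ℝ, ContDiff ℝ ∞ η → HasCompactSupport η →
    ∫ x, ((fderiv ℝ η x a : ℝ) : ℂ) * f x = -∫ x, ((η x : ℝ) : ℂ) * g x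

open Classical in
/-- The weak derivative of `f` in the direction `a`, if it exists in `L²` (and `0` otherwise). -/
noncomputable def weakDeriv (a : X) (f : L2 X) : L2 X :=
  if h : ∃ g, IsWeakDeriv a f g then h.choose else 0

/-- Form domain of `-κ ∑ᵢ ∂²/∂bᵢ² + W`, where `W` is bounded from below and may take the value `+∞`:
the `f ∈ L²` with all `∂f/∂bᵢ ∈ L²` and `∫ W⁺ |f|² < ∞`. -/
def formDomain {ι : Type*} (b : ι → X) (W : X → EReal) : Set (L2 X) :=
  {f | (∀ i, ∃ g, IsWeakDeriv (b i) f g) ∧ ∫⁻ x, (W x).toENNReal * ‖f x‖ₑ ^ 2 < ⊤}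

/-- The sesquilinear form of `-κ ∑ᵢ ∂²/∂bᵢ² + W` (meaningful for `f`, `g` in the form domain;
these vanish almost everywhere on `{W = +∞}`, so that the value of `toReal` there is irrelevant). -/
noncomputable def schrodingerForm {ι : Type*} [Fintype ι] (κ : ℝ) (b : ι → X) (W : X → EReal)
    (f g : L2 X) : ℂ :=
  (κ : ℂ) * ∑ i, inner ℂ (weakDeriv (b i) f) (weakDeriv (b i) g)
    + ∫ x, ((W x).toReal : ℂ) * (starRingEnd ℂ (f x) * g x)

end Schrodinger

/-- `e` is a complete orthonormal system of eigenvectors, with eigenvalues `E` (repeated according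
to multiplicity), of the self-adjoint operator which the sesquilinear form `q` with domain `D`
defines in the closure of `D`. -/
structure IsEigenbasis {F : Type*} [NormedAddCommGroup F] [InnerProductSpace ℂ F]
    (D : Set F) (q : F → F → ℂ) (E : ℕ → ℝ) (e : ℕ → F) : Prop where
  orthonormal : Orthonormal ℂ e
  mem : ∀ k, e k ∈ D
  eigen : ∀ k, ∀ v ∈ D, q v (e k) = (E k : ℂ) * inner ℂ v (e k)
  complete : ∀ v ∈ D, v ∈ (Submodule.span ℂ (Set.range e)).topologicalClosure

/-- `ε`, `φ` are the eigenvalues and eigenvectors of the one-particle Hamiltonian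
`H⁰ = -(ħ²/2m) d²/dx² + V` in `L²(ℝ)`. -/
def IsOneParticleEigenbasis (hbar m : ℝ) (V : ℝ → EReal) (ε : ℕ → ℝ) (φ : ℕ → L2 ℝ) : Prop :=
  IsEigenbasis (formDomain (fun _ : Unit => (1 : ℝ)) V)
    (schrodingerForm (hbar ^ 2 / (2 * m)) (fun _ : Unit => (1 : ℝ)) V) ε φ

/-- The total potential `∑ᵢ V(xᵢ) + ∑_{i<j} u(xᵢ - xⱼ)` of `N` particles. -/
noncomputable def totalPotential (N : ℕ) (V : ℝ → EReal) (u : ℝ → ℝ) (x : Fin N → ℝ) : EReal :=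
  ∑ i, V (x i) + ∑ i, ∑ j ∈ Finset.Ioi i, ((u (x i - x j) : ℝ) : EReal)

/-- The functions in `L²(ℝᴺ)` that are symmetric under permutations of the `N` variables. -/
def symmetricFunctions (N : ℕ) : Set (L2 (Fin N → ℝ)) :=
  {ψ | ∀ τ : Equiv.Perm (Fin N), (fun x : Fin N → ℝ => ψ (x ∘ τ)) =ᵐ[volume] fun x => ψ x}

/-- The coordinate directions of `ℝᴺ`. -/
def coordDir (N : ℕ) (i : Fin N) : Fin N → ℝ := Pi.single i 1

/-- `E`, `Ψ` are the eigenvalues and eigenvectors of the Hamiltonian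
`H_N = ∑ᵢ (-(ħ²/2m) ∂²/∂xᵢ² + V(xᵢ)) + ∑_{i<j} u(xᵢ - xⱼ)` of `N` bosons, that is, in the
symmetric subspace of `L²(ℝᴺ)`. -/
def IsBosonEigenbasis (hbar m : ℝ) (V : ℝ → EReal) (u : ℝ → ℝ) (N : ℕ)
    (E : ℕ → ℝ) (Ψ : ℕ → L2 (Fin N → ℝ)) : Prop :=
  IsEigenbasis (formDomain (coordDir N) (totalPotential N V u) ∩ symmetricFunctions N)
    (schrodingerForm (hbar ^ 2 / (2 * m)) (coordDir N) (totalPotential N V u)) E Ψ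

/-- `(ψ, ∑ᵢ Aᵢ ψ)` for the one-particle operator `A = |g⟩⟨f|`, where `Aᵢ` is `A` acting on the
`i`-th variable: `(Aᵢ ψ)(x) = g(xᵢ) ∫ conj f(t) ψ(x₁, …, t, …, x_N) dt`. -/
noncomputable def rankOneMean {N : ℕ} (ψ : L2 (Fin N → ℝ)) (g f : L2 ℝ) : ℂ :=
  ∑ i, ∫ x : Fin N → ℝ, starRingEnd ℂ (ψ x) *
    (g (x i) * ∫ t : ℝ, starRingEnd ℂ (f t) * ψ (Function.update x i t))

/-- The thermal average `Tr (A e^{-βH}) / Tr e^{-βH}`, computed in an eigenbasis of `H` with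
eigenvalues `E`, of an observable `A` with diagonal matrix elements `a`. -/
noncomputable def gibbsMean (β : ℝ) (E : ℕ → ℝ) (a : ℕ → ℂ) : ℂ :=
  (∑' k, (Real.exp (-β * E k) : ℂ) * a k) / ((∑' k, Real.exp (-β * E k) : ℝ) : ℂ)

/-- `⟨n[f]⟩`, the thermal average of the number of particles in the one-particle state `f`;
here `n[f] = ∑ᵢ (|f⟩⟨f|)ᵢ`. -/
noncomputable def meanOccupation (β : ℝ) {N : ℕ} (E : ℕ → ℝ) (Ψ : ℕ → L2 (Fin N → ℝ))
    (f : L2 ℝ) : ℝ :=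
  (gibbsMean β E fun k => rankOneMean (Ψ k) f f).re

/-- `S` is the one-particle reduced density matrix (of trace `N`) of the thermal equilibrium state:
`tr (S A) = ⟨∑ᵢ Aᵢ⟩` for `A = |g⟩⟨f|`, whose left-hand side is `(f, S g)`. -/
def IsReducedDensityMatrix (β : ℝ) {N : ℕ} (E : ℕ → ℝ) (Ψ : ℕ → L2 (Fin N → ℝ))
    (S : L2 ℝ →L[ℂ] L2 ℝ) : Prop :=
  ∀ f g : L2 ℝ, inner ℂ f (S g) = gibbsMean β E fun k => rankOneMean (Ψ k) g f

/-- `lam 0 ≥ lam 1 ≥ …` are the eigenvalues of the positive compact operator `S`, in decreasing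
order and repeated according to multiplicity (if `S` has finite rank, the sequence continues with
zeros; if infinitely many eigenvalues are positive, it lists the positive ones). -/
def IsDecreasingEigenvalues {F : Type*} [NormedAddCommGroup F] [InnerProductSpace ℂ F]
    (S : F →L[ℂ] F) (lam : ℕ → ℝ) : Prop :=
  Antitone lam ∧ (∀ j, 0 ≤ lam j) ∧ ∃ χ : ℕ → F, Orthonormal ℂ χ ∧
    (∀ j, S (χ j) = (lam j : ℂ) • χ j) ∧ ∀ f, (∀ j, inner ℂ (χ j) f = 0) → S f = 0

/-! The Hamiltonian of the bosons is compared with that of independent particles. If `V ≥ -B` and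
`u ≥ -b`, the form of `H_N`, shifted by `N B + N² b`, is at least the form of `N` independent
particles with the one-particle energies `εⱼ + B > 0`, and the latter is diagonal in the products
`φ_{k₁} ⊗ ⋯ ⊗ φ_{k_N}`. Since `N` particles have `O(N²)` pairs, nothing is lost beyond the order
`N²`. On the other side, `φ₀` is bounded, because it has a weak derivative in `L²`; hence the
condensate `φ₀ ⊗ ⋯ ⊗ φ₀` has an energy of at most the order `N²` (`exists_condensate`), where the
integrability of `u` is used.

Existence: superharmonicity gives `∑ⱼ exp (-β εⱼ) < ∞`. So the form domain of the bosons, as a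
Hilbert space, is compactly embedded in `L²`, and an eigenbasis exists (`exists_isEigenbasis`). By
the Peierls inequality (`sum_exp_neg_le`), which is Jensen's inequality in the two eigenbases, the
partition function is at most that of the independent particles, and at least `exp (-O(N²))`, the
contribution of the condensate. Comparing the partition functions at `β / 2` and at `β` shows that
the mean energy is `O(N²)` (`IsTrap.exists_energy_bound`).

Condensation: each particle above the level `J` costs at least `ε_J + B`, so that the mean number
of these particles is at most `O(N²) / (ε_J + B)` (`IsTrap.le_sum_meanOccupation`), which is `o(N)`
if `N / ε_J → 0`. The sum of the `J + 1` largest eigenvalues of the reduced density matrix lies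
between the occupation of the lowest `J + 1` levels, by Ky Fan's principle
(`IsDecreasingEigenvalues.sum_le`), and `N`. A sequence `J(N)` between the two scales is the first
`j` with `j εⱼ ≥ N²` (`exists_levels`).

The forms are treated through closed subspaces of finite `L²` sums of copies of `L²`: a function
in the form domain is replaced by the vector of the function, its product with the square root of
the shifted potential, and its weak derivatives (`formSubmodule`). -/

/-! ### Orthonormal systems and compact operators -/

section Hilbert

variable {F : Type*} [NormedAddCommGroup F] [InnerProductSpace ℂ F]

theorem inner_eq_zero_of_mem_closure_span {ι : Type*} {v : ι → F} {x y : F}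
    (hx : x ∈ (Submodule.span ℂ (Set.range v)).topologicalClosure)
    (hy : ∀ i, inner ℂ y (v i) = 0) : inner ℂ y x = 0 := by
  have hle : (Submodule.span ℂ (Set.range v)).topologicalClosure ≤
      LinearMap.ker (innerSL ℂ y).toLinearMap := by
    refine Submodule.topologicalClosure_minimal _ ?_ (innerSL ℂ y).isClosed_ker
    rw [Submodule.span_le]
    rintro _ ⟨i, rfl⟩
    simpa using hy i
  simpa using hle hx

/-- Parseval's identity for a vector in the closed span of an orthonormal family. -/
theorem Orthonormal.hasSum_sq_norm_inner [CompleteSpace F] {ι : Type*} {v : ι → F}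
    (hv : Orthonormal ℂ v) {x : F}
    (hx : x ∈ (Submodule.span ℂ (Set.range v)).topologicalClosure) :
    HasSum (fun i => ‖inner ℂ (v i) x‖ ^ 2) (‖x‖ ^ 2) := by
  obtain ⟨w, b, hw, hb⟩ := hv.toSubtypeRange.exists_hilbertBasis_extension
  have h1 : HasSum (fun i : w => ‖inner ℂ (b i) x‖ ^ 2) (‖x‖ ^ 2) := by
    have h := Complex.hasSum_re (b.hasSum_inner_mul_inner x x)
    rw [inner_self_eq_norm_sq_to_K] at h
    convert! h using 1
    · funext i
      rw [← inner_conj_symm x (b i), ← Complex.normSq_eq_conj_mul_self, Complex.ofReal_re,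
        Complex.normSq_eq_norm_sq]
    · norm_cast
  have hinj : Function.Injective (fun i => (⟨v i, hw ⟨i, rfl⟩⟩ : w)) := fun i j hij =>
    hv.linearIndependent.injective (congrArg Subtype.val hij)
  rw [← hinj.hasSum_iff (f := fun i : w => ‖inner ℂ (b i) x‖ ^ 2)] at h1
  · simpa [Function.comp_def, hb] using h1
  · intro y hy
    have h0 : inner ℂ (b y) x = 0 := by
      refine inner_eq_zero_of_mem_closure_span hx fun i => ?_
      have hne : y ≠ ⟨v i, hw ⟨i, rfl⟩⟩ := fun h => hy ⟨i, h.symm⟩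
      simpa [hb] using b.orthonormal.2 hne
    simp [h0]

/-- Bessel's inequality for an orthogonal family with `‖w i‖² = c i`, where `c i = 0` is allowed. -/
theorem sum_weighted_bessel {ι : Type*} [DecidableEq ι] {w : ι → F} {c : ι → ℝ}
    (hw : ∀ i j, inner ℂ (w i) (w j) = if i = j then (c i : ℂ) else 0) {x : F} {a : ι → ℂ}
    (ha : ∀ i, inner ℂ (w i) x = c i * a i) (s : Finset ι) :
    ∑ i ∈ s, c i * ‖a i‖ ^ 2 ≤ ‖x‖ ^ 2 := by
  set y : F := ∑ i ∈ s, a i • w i with hy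
  have h1 : inner ℂ y x = ((∑ i ∈ s, c i * ‖a i‖ ^ 2 : ℝ) : ℂ) := by
    rw [hy, sum_inner, Complex.ofReal_sum]
    refine Finset.sum_congr rfl fun i _ => ?_
    rw [inner_smul_left, ha, Complex.ofReal_mul, ← Complex.normSq_eq_norm_sq,
      Complex.normSq_eq_conj_mul_self]
    ring
  have h2 : inner ℂ y y = ((∑ i ∈ s, c i * ‖a i‖ ^ 2 : ℝ) : ℂ) := by
    rw [hy, sum_inner, Complex.ofReal_sum]
    refine Finset.sum_congr rfl fun i hi => ?_
    rw [inner_smul_left, inner_sum, Finset.sum_eq_single i]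
    · rw [inner_smul_right, hw, if_pos rfl, Complex.ofReal_mul, ← Complex.normSq_eq_norm_sq,
        Complex.normSq_eq_conj_mul_self]
      ring
    · intro j _ hj
      rw [inner_smul_right, hw, if_neg hj.symm, mul_zero]
    · exact fun h => absurd hi h
  have h3 : ‖x - y‖ ^ 2 = ‖x‖ ^ 2 - 2 * RCLike.re (inner ℂ x y) + ‖y‖ ^ 2 := norm_sub_sq x y
  have h4 : ‖y‖ ^ 2 = ∑ i ∈ s, c i * ‖a i‖ ^ 2 := by
    have := inner_self_eq_norm_sq_to_K (𝕜 := ℂ) y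
    rw [h2] at this
    exact (Complex.ofReal_injective (by simpa using this)).symm
  have h5 : RCLike.re (inner ℂ x y) = ∑ i ∈ s, c i * ‖a i‖ ^ 2 := by
    rw [inner_re_symm, h1]
    exact Complex.ofReal_re _
  nlinarith [sq_nonneg ‖x - y‖]

/-- A bounded operator whose values have uniformly small tails with respect to an orthonormal family
spanning its range is compact: it is a norm limit of its finite-rank truncations. -/
theorem isCompactOperator_of_tail [CompleteSpace F] {H : Type*} [NormedAddCommGroup H]
    [InnerProductSpace ℂ H] (T : H →L[ℂ] F) {ι : Type*} {v : ι → F} (hv : Orthonormal ℂ v)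
    (hT : ∀ h, T h ∈ (Submodule.span ℂ (Set.range v)).topologicalClosure)
    (htail : ∀ δ > 0, ∃ s : Finset ι, ∀ h, ∀ t : Finset ι, Disjoint s t →
      ∑ i ∈ t, ‖inner ℂ (v i) (T h)‖ ^ 2 ≤ δ * ‖h‖ ^ 2) :
    IsCompactOperator T := by
  classical
  suffices hcl : T ∈ closure {f : H →L[ℂ] F | IsCompactOperator f} from
    isClosed_setOfPred_isCompactOperator.closure_subset hcl
  rw [Metric.mem_closure_iff]
  intro r hr
  obtain ⟨s, hs⟩ := htail ((r / 2) ^ 2) (by positivity)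
  let P : F →L[ℂ] F := ∑ i ∈ s, (innerSL ℂ (v i)).smulRight (v i)
  have hPapp : ∀ x, P x = ∑ i ∈ s, inner ℂ (v i) x • v i := fun x => by
    simp [P]
  refine ⟨P.comp T, ?_, ?_⟩
  · have hP : IsCompactOperator P := by
      have : ∀ s : Finset ι, IsCompactOperator
          (∑ i ∈ s, (innerSL ℂ (v i)).smulRight (v i) : F →L[ℂ] F) := by
        intro s
        induction s using Finset.induction_on with
        | empty => simpa using isCompactOperator_zero
        | insert i s hi ih =>
          rw [Finset.sum_insert hi]
          refine IsCompactOperator.add ?_ ih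
          have h1 : IsCompactOperator (innerSL ℂ (v i)) :=
            isCompactOperator_of_locallyCompactSpace_dom _
          exact h1.clm_comp (ContinuousLinearMap.toSpanSingleton ℂ (v i))
      exact this s
    exact hP.comp_clm T
  · rw [dist_eq_norm]
    refine lt_of_le_of_lt (b := r / 2) ?_ (by linarith)
    refine ContinuousLinearMap.opNorm_le_bound _ (by positivity) fun h => ?_
    have hx : T h - P (T h) ∈ (Submodule.span ℂ (Set.range v)).topologicalClosure := by
      refine Submodule.sub_mem _ (hT h) (Submodule.le_topologicalClosure _ ?_)
      rw [hPapp]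
      exact Submodule.sum_mem _ fun i _ =>
        Submodule.smul_mem _ _ (Submodule.subset_span ⟨i, rfl⟩)
    have hcoef : ∀ i, inner ℂ (v i) (T h - P (T h)) = if i ∈ s then 0 else inner ℂ (v i) (T h) := by
      intro i
      rw [inner_sub_right, hPapp, inner_sum]
      simp_rw [inner_smul_right, orthonormal_iff_ite.mp hv]
      split_ifs with his <;> simp [his]
    have hsum := hv.hasSum_sq_norm_inner hx
    have hle : ‖T h - P (T h)‖ ^ 2 ≤ (r / 2) ^ 2 * ‖h‖ ^ 2 := by
      refine hasSum_le_of_sum_le hsum fun t => ?_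
      calc ∑ i ∈ t, ‖inner ℂ (v i) (T h - P (T h))‖ ^ 2
          = ∑ i ∈ t \ s, ‖inner ℂ (v i) (T h)‖ ^ 2 := by
            rw [← Finset.sum_sdiff (Finset.inter_subset_left : t ∩ s ⊆ t),
              Finset.sdiff_inter_self_left]
            rw [Finset.sum_eq_zero (s := t ∩ s), add_zero]
            · refine Finset.sum_congr rfl fun i hi => ?_
              rw [hcoef, if_neg (Finset.mem_sdiff.mp hi).2]
            · intro i hi
              rw [hcoef, if_pos (Finset.mem_inter.mp hi).2]
              simp
        _ ≤ _ := hs h _ Finset.disjoint_sdiff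
    have hle' : ‖T h - P (T h)‖ ^ 2 ≤ (r / 2 * ‖h‖) ^ 2 := by rwa [mul_pow]
    exact (pow_le_pow_iff_left₀ (norm_nonneg _) (by positivity) two_ne_zero).mp hle'

open scoped ComplexOrder in
/-- The norm of a positive compact operator is an eigenvalue. -/
theorem exists_eigenvector_norm [CompleteSpace F] [Nontrivial F] {T : F →L[ℂ] F}
    (hT : IsCompactOperator T) (hpos : T.IsPositive) :
    ∃ x : F, ‖x‖ = 1 ∧ T x = (‖T‖ : ℂ) • x := by
  by_cases h0 : T = 0
  · obtain ⟨x, hx⟩ := exists_norm_eq F (zero_le_one)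
    exact ⟨x, hx, by simp [h0]⟩
  obtain ⟨z, hz, hzn⟩ := spectrum.exists_nnnorm_eq_spectralRadius T
  have hrad := ContinuousLinearMap.spectralRadius_eq_nnnorm (𝕜 := ℂ) (T := T) hpos.isSelfAdjoint
  rw [hrad] at hzn
  have hzn' : ‖z‖ = ‖T‖ := by
    have := ENNReal.coe_injective hzn
    exact congrArg NNReal.toReal this
  have hz0 : z ≠ 0 := by
    rw [← norm_ne_zero_iff, hzn']
    exact norm_ne_zero_iff.mpr h0
  obtain ⟨y, hy⟩ := ((hT.hasEigenvalue_iff_mem_spectrum hz0).mpr hz).exists_hasEigenvector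
  have hy0 : y ≠ 0 := hy.2
  have hyT : T y = z • y := hy.apply_eq_smul
  have hpy := hpos.inner_nonneg_right y
  rw [hyT, inner_smul_right, inner_self_eq_norm_sq_to_K] at hpy
  have hzpos : 0 ≤ z := by
    have hn : (0 : ℂ) < (‖y‖ : ℂ) ^ 2 := by
      have : 0 < ‖y‖ := norm_pos_iff.mpr hy0
      exact_mod_cast pow_pos this 2
    exact le_of_mul_le_mul_right (by simpa using hpy) hn
  have hzT : z = (‖T‖ : ℂ) := by
    rw [← hzn', Complex.norm_of_nonneg' hzpos]
  refine ⟨((‖y‖⁻¹ : ℝ) : ℂ) • y, ?_, ?_⟩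
  · rw [norm_smul, Complex.norm_real, norm_inv, norm_norm, inv_mul_cancel₀ (norm_ne_zero_iff.mpr hy0)]
  · rw [map_smul, hyT, hzT, smul_comm]

/-! ### Eigenbases from compact operators -/

/-- In the orthogonal complement of finitely many eigenvectors, a positive compact operator has a
unit eigenvector whose eigenvalue is the norm of the restriction to that complement. -/
theorem exists_next_eigenvector [CompleteSpace F] (hinf : ¬ FiniteDimensional ℂ F)
    {T : F →L[ℂ] F} (hT : IsCompactOperator T) (hpos : T.IsPositive) (s : Finset F)
    (hs : ∀ y ∈ s, ∃ μ : ℝ, T y = (μ : ℂ) • y) :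
    ∃ (x : F) (l : ℝ), ‖x‖ = 1 ∧ (∀ y ∈ s, inner ℂ y x = 0) ∧ 0 ≤ l ∧ T x = (l : ℂ) • x ∧
      ∀ w, (∀ y ∈ s, inner ℂ y w = 0) → ‖T w‖ ≤ l * ‖w‖ := by
  set K : Submodule ℂ F := (Submodule.span ℂ (s : Set F))ᗮ with hK
  have hmem : ∀ w, w ∈ K ↔ ∀ y ∈ s, inner ℂ y w = 0 := by
    intro w
    rw [hK, Submodule.mem_orthogonal]
    refine ⟨fun h y hy => h y (Submodule.subset_span hy), fun h u hu => ?_⟩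
    induction hu using Submodule.span_induction with
    | mem x hx => exact h x hx
    | zero => simp
    | add x y _ _ hx hy => rw [inner_add_left, hx, hy, add_zero]
    | smul a x _ hx => rw [inner_smul_left, hx, mul_zero]
  have hinv : ∀ w ∈ K, T w ∈ K := by
    intro w hw
    rw [hmem] at hw ⊢
    intro y hy
    obtain ⟨μ, hμ⟩ := hs y hy
    have := hpos.inner_left_eq_inner_right y w
    rw [← this, hμ, inner_smul_left, hw y hy, mul_zero]
  have : Nontrivial K := by
    rw [Submodule.nontrivial_iff_ne_bot]
    intro hbot
    apply hinf
    have : FiniteDimensional ℂ (Submodule.span ℂ (s : Set F)) :=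
      FiniteDimensional.span_of_finite ℂ s.finite_toSet
    rw [hK, Submodule.orthogonal_eq_bot_iff] at hbot
    rw [hbot] at this
    exact Module.Finite.equiv (Submodule.topEquiv (R := ℂ) (M := F))
  have : CompleteSpace K := (Submodule.isClosed_orthogonal _).completeSpace_coe
  let S : K →L[ℂ] K := T.restrict hinv
  have hSapp : ∀ w : K, (S w : F) = T w := fun _ => rfl
  have hSc : IsCompactOperator S := hT.restrict' hinv
  have hSp : S.IsPositive := by
    refine ⟨fun v w => ?_, fun v => ?_⟩
    · exact hpos.inner_left_eq_inner_right (v : F) w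
    · exact hpos.re_inner_nonneg_left (v : F)
  obtain ⟨x, hx, hxS⟩ := exists_eigenvector_norm hSc hSp
  refine ⟨x, ‖S‖, hx, (hmem _).mp x.2, S.opNorm_nonneg, ?_, fun w hw => ?_⟩
  · rw [← hSapp, hxS]
    rfl
  · exact S.le_opNorm (⟨w, (hmem w).mpr hw⟩ : K)

/-- A positive compact operator on an infinite-dimensional Hilbert space has a decreasing sequence
of eigenvalues; the eigenvectors are chosen one after the other, each with the largest eigenvalue in
the orthogonal complement of the previous ones. -/
theorem exists_isDecreasingEigenvalues [CompleteSpace F] (hinf : ¬ FiniteDimensional ℂ F)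
    {T : F →L[ℂ] F} (hT : IsCompactOperator T) (hpos : T.IsPositive) :
    ∃ lam : ℕ → ℝ, IsDecreasingEigenvalues T lam := by
  classical
  have hex : ∀ s : Finset F, ∃ (x : F) (l : ℝ), (∀ y ∈ s, ∃ μ : ℝ, T y = (μ : ℂ) • y) →
      (‖x‖ = 1 ∧ (∀ y ∈ s, inner ℂ y x = 0) ∧ 0 ≤ l ∧ T x = (l : ℂ) • x ∧
      ∀ w, (∀ y ∈ s, inner ℂ y w = 0) → ‖T w‖ ≤ l * ‖w‖) := by
    intro s
    by_cases hs : ∀ y ∈ s, ∃ μ : ℝ, T y = (μ : ℂ) • y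
    · obtain ⟨x, l, h⟩ := exists_next_eigenvector hinf hT hpos s hs
      exact ⟨x, l, fun _ => h⟩
    · exact ⟨0, 0, fun h => absurd h hs⟩
  choose g l hg using hex
  let L : ℕ → Finset F := fun n => Nat.rec ∅ (fun _ s => insert (g s) s) n
  have hL0 : L 0 = ∅ := rfl
  have hLs : ∀ n, L (n + 1) = insert (g (L n)) (L n) := fun _ => rfl
  have hev : ∀ n, ∀ y ∈ L n, ∃ μ : ℝ, T y = (μ : ℂ) • y := by
    intro n
    induction n with
    | zero => simp [hL0]
    | succ n ih =>
      intro y hy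
      rw [hLs, Finset.mem_insert] at hy
      rcases hy with rfl | hy
      · exact ⟨_, (hg _ ih).2.2.2.1⟩
      · exact ih y hy
  have hmono : ∀ m n, m ≤ n → L m ⊆ L n := by
    intro m n hmn
    induction hmn with
    | refl => exact subset_rfl
    | step _ ih => exact ih.trans (by rw [Nat.succ_eq_add_one, hLs]; exact Finset.subset_insert _ _)
  have hin : ∀ m n, m < n → g (L m) ∈ L n := fun m n hmn =>
    hmono (m + 1) n hmn (by rw [hLs]; exact Finset.mem_insert_self _ _)
  have hform : ∀ n, ∀ y ∈ L n, ∃ m < n, y = g (L m) := by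
    intro n
    induction n with
    | zero => simp [hL0]
    | succ n ih =>
      intro y hy
      rw [hLs, Finset.mem_insert] at hy
      rcases hy with rfl | hy
      · exact ⟨n, Nat.lt_succ_self n, rfl⟩
      · obtain ⟨m, hm, rfl⟩ := ih y hy
        exact ⟨m, hm.trans (Nat.lt_succ_self n), rfl⟩
  set χ : ℕ → F := fun n => g (L n) with hχ
  set lam : ℕ → ℝ := fun n => l (L n) with hlam
  have hnorm : ∀ n, ‖χ n‖ = 1 := fun n => (hg _ (hev n)).1
  have heig : ∀ n, T (χ n) = (lam n : ℂ) • χ n := fun n => (hg _ (hev n)).2.2.2.1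
  have hnn : ∀ n, 0 ≤ lam n := fun n => (hg _ (hev n)).2.2.1
  have horth : ∀ m n, m < n → inner ℂ (χ m) (χ n) = 0 := fun m n hmn =>
    (hg _ (hev n)).2.1 _ (hin m n hmn)
  have hmax : ∀ n w, (∀ m < n, inner ℂ (χ m) w = 0) → ‖T w‖ ≤ lam n * ‖w‖ := by
    intro n w hw
    refine (hg _ (hev n)).2.2.2.2 w fun y hy => ?_
    obtain ⟨m, hm, rfl⟩ := hform n y hy
    exact hw m hm
  clear_value χ lam
  have hanti : Antitone lam := by
    refine antitone_nat_of_succ_le fun n => ?_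
    have h := hmax n (χ (n + 1)) fun m hm => horth m (n + 1) (hm.trans (Nat.lt_succ_self n))
    rwa [heig, norm_smul, hnorm, mul_one, mul_one, Complex.norm_of_nonneg (hnn _)] at h
  have hχo : Orthonormal ℂ χ := by
    refine ⟨hnorm, fun m n hmn => ?_⟩
    rcases lt_or_gt_of_ne hmn with h | h
    · exact horth m n h
    · exact inner_eq_zero_symm.mp (horth n m h)
  -- The eigenvalues tend to zero: otherwise the vectors `T (χ n)` would be uniformly separated.
  have hzero : ∀ δ > 0, ∃ n, lam n < δ := by
    intro δ hδ
    by_contra! hcon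
    obtain ⟨K, hK, hKsub⟩ := hT.image_closedBall_subset_compact 1
    obtain ⟨y, -, φ, hφ, hlim⟩ := hK.tendsto_subseq (x := fun n => T (χ n))
      (fun n => hKsub ⟨χ n, by simp [hnorm], rfl⟩)
    have hc := hlim.cauchySeq
    rw [Metric.cauchySeq_iff] at hc
    obtain ⟨N, hN⟩ := hc δ hδ
    have h1 := hN N le_rfl (N + 1) (Nat.le_succ N)
    have hne : φ N ≠ φ (N + 1) := (hφ (Nat.lt_succ_self N)).ne
    have h2 : inner ℂ (T (χ (φ N))) (T (χ (φ (N + 1)))) = 0 := by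
      rw [heig, heig, inner_smul_left, inner_smul_right, hχo.2 hne]
      simp
    have h3 : δ ≤ ‖T (χ (φ N))‖ := by
      rw [heig, norm_smul, hnorm, mul_one, Complex.norm_of_nonneg (hnn _)]
      exact hcon _
    have h4 := norm_sub_sq (𝕜 := ℂ) (T (χ (φ N))) (T (χ (φ (N + 1))))
    rw [h2] at h4
    simp only [Function.comp, dist_eq_norm] at h1
    have h5 : (RCLike.re (0 : ℂ)) = 0 := by simp
    rw [h5] at h4
    nlinarith [norm_nonneg (T (χ (φ N)) - T (χ (φ (N + 1)))), sq_nonneg ‖T (χ (φ (N + 1)))‖]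
  refine ⟨lam, hanti, hnn, χ, hχo, heig, fun f hf => ?_⟩
  rw [← norm_eq_zero]
  refine le_antisymm ?_ (norm_nonneg _)
  refine le_of_forall_pos_le_add fun δ hδ => ?_
  obtain ⟨n, hn⟩ := hzero (δ / (‖f‖ + 1)) (by positivity)
  have h := hmax n f fun m _ => hf m
  have : lam n * ‖f‖ ≤ δ / (‖f‖ + 1) * (‖f‖ + 1) :=
    mul_le_mul hn.le (by linarith) (norm_nonneg _) (by positivity)
  rw [div_mul_cancel₀ _ (by positivity)] at this
  linarith

/-- A compact injective embedding of a form domain, as a Hilbert space for the form norm, makes the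
form diagonal: its eigenvectors are those of the compact operator `J† J`. -/
theorem exists_isEigenbasis [CompleteSpace F] {H : Type*} [NormedAddCommGroup H]
    [InnerProductSpace ℂ H] [CompleteSpace H] (hinf : ¬ FiniteDimensional ℂ H)
    (J : H →L[ℂ] F) (hJ : IsCompactOperator J) (hinj : Function.Injective J)
    {D : Set F} (hD : D = Set.range J) {q : F → F → ℂ} {c : ℝ}
    (hq : ∀ v w, q (J v) (J w) + c * inner ℂ (J v) (J w) = inner ℂ v w) :
    ∃ (E : ℕ → ℝ) (e : ℕ → F), IsEigenbasis D q E e := by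
  let T : H →L[ℂ] H := (ContinuousLinearMap.adjoint J).comp J
  have hTi : ∀ v w, inner ℂ v (T w) = inner ℂ (J v) (J w) := fun v w =>
    ContinuousLinearMap.adjoint_inner_right J v (J w)
  have hTc : IsCompactOperator T := hJ.clm_comp (ContinuousLinearMap.adjoint J)
  have hTp : T.IsPositive := ContinuousLinearMap.isPositive_adjoint_comp_self J
  have hT0 : ∀ v, T v = 0 → v = 0 := by
    intro v hv
    apply hinj
    rw [map_zero, ← inner_self_eq_zero (𝕜 := ℂ), ← hTi, hv, inner_zero_right]
  obtain ⟨lam, -, hnn, χ, hχ, heig, hcomp⟩ := exists_isDecreasingEigenvalues hinf hTc hTp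
  have hlam : ∀ k, 0 < lam k := by
    intro k
    refine lt_of_le_of_ne (hnn k) fun h0 => hχ.ne_zero k (hT0 _ ?_)
    rw [heig, ← h0, Complex.ofReal_zero, zero_smul]
  have hJχ : ∀ v k, inner ℂ (J v) (J (χ k)) = (lam k : ℂ) * inner ℂ v (χ k) := by
    intro v k
    rw [← hTi, heig, inner_smul_right]
  have hne : ∀ k, (((√(lam k))⁻¹ : ℝ) : ℂ) ≠ 0 := fun k => by
    have := Real.sqrt_pos.mpr (hlam k)
    exact_mod_cast (inv_pos.mpr this).ne'
  refine ⟨fun k => (lam k)⁻¹ - c, fun k => (((√(lam k))⁻¹ : ℝ) : ℂ) • J (χ k), ?_, ?_, ?_, ?_⟩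
  · rw [orthonormal_iff_ite]
    intro i j
    rw [inner_smul_left, inner_smul_right, hJχ, orthonormal_iff_ite.mp hχ]
    split_ifs with hij
    · subst hij
      rw [mul_one, Complex.conj_ofReal, ← Complex.ofReal_mul, ← Complex.ofReal_mul]
      have h := Real.mul_self_sqrt (hnn i)
      have h0 := (Real.sqrt_pos.mpr (hlam i)).ne'
      norm_cast
      field_simp
      rw [sq]
      exact h.symm
    · simp
  · intro k
    rw [hD]
    exact ⟨(((√(lam k))⁻¹ : ℝ) : ℂ) • χ k, by rw [map_smul]⟩
  · intro k v hv
    rw [hD] at hv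
    obtain ⟨v, rfl⟩ := hv
    have h := hq v ((((√(lam k))⁻¹ : ℝ) : ℂ) • χ k)
    rw [map_smul, inner_smul_right, inner_smul_right, hJχ] at h
    rw [inner_smul_right, hJχ]
    have h0 : (lam k : ℂ) ≠ 0 := by exact_mod_cast (hlam k).ne'
    push_cast at h ⊢
    rw [eq_sub_of_add_eq h]
    field_simp
  · intro v hv
    rw [hD] at hv
    obtain ⟨v, rfl⟩ := hv
    have htop : (Submodule.span ℂ (Set.range χ)).topologicalClosure = ⊤ := by
      rw [Submodule.topologicalClosure_eq_top_iff, Submodule.eq_bot_iff]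
      intro f hf
      refine hT0 f (hcomp f fun j => ?_)
      exact (Submodule.mem_orthogonal _ _).mp hf _ (Submodule.subset_span ⟨j, rfl⟩)
    have hv : v ∈ (Submodule.span ℂ (Set.range χ)).topologicalClosure := by
      rw [htop]; trivial
    have hle : (Submodule.span ℂ (Set.range χ)).topologicalClosure ≤
        ((Submodule.span ℂ (Set.range fun k =>
          (((√(lam k))⁻¹ : ℝ) : ℂ) • J (χ k))).topologicalClosure).comap J.toLinearMap := by
      refine Submodule.topologicalClosure_minimal _ ?_ ?_
      · rw [Submodule.span_le]
        rintro _ ⟨k, rfl⟩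
        refine Submodule.le_topologicalClosure _ ?_
        have hmem := Submodule.smul_mem (Submodule.span ℂ (Set.range fun k =>
          (((√(lam k))⁻¹ : ℝ) : ℂ) • J (χ k))) ((((√(lam k))⁻¹ : ℝ) : ℂ)⁻¹)
          (Submodule.subset_span ⟨k, rfl⟩)
        rw [smul_smul, inv_mul_cancel₀ (hne k), one_smul] at hmem
        exact hmem
      · exact (Submodule.isClosed_topologicalClosure _).preimage J.continuous
    exact hle hv

/-- Ky Fan's inequality: the diagonal matrix elements of a positive compact operator in `n`
orthonormal vectors add up to at most the sum of the `n` largest eigenvalues. -/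
theorem IsDecreasingEigenvalues.sum_le [CompleteSpace F] {S : F →L[ℂ] F} {lam : ℕ → ℝ}
    (hS : IsDecreasingEigenvalues S lam) {v : ℕ → F} (hv : Orthonormal ℂ v) (n : ℕ) :
    ∑ j ∈ Finset.range n, (inner ℂ (v j) (S (v j))).re ≤ ∑ j ∈ Finset.range n, lam j := by
  obtain ⟨hanti, hnn, χ, hχ, heig, hker⟩ := hS
  have hdiag : ∀ f : F, HasSum (fun k => lam k * ‖inner ℂ (χ k) f‖ ^ 2)
      (inner ℂ f (S f)).re := by
    intro f
    obtain ⟨w, b, hw, hb⟩ := hχ.toSubtypeRange.exists_hilbertBasis_extension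
    have h1 := Complex.hasSum_re (((b.hasSum_repr f).mapL S).mapL (innerSL ℂ f))
    have hinj : Function.Injective (fun i => (⟨χ i, hw ⟨i, rfl⟩⟩ : w)) := fun i j hij =>
      hχ.linearIndependent.injective (congrArg Subtype.val hij)
    rw [← hinj.hasSum_iff] at h1
    · convert! h1 using 1
      funext k
      have hbk : b ⟨χ k, hw ⟨k, rfl⟩⟩ = χ k := by rw [hb]
      simp only [Function.comp, HilbertBasis.repr_apply_apply, map_smul, hbk, heig, smul_eq_mul,
        innerSL_apply_apply]
      rw [← inner_conj_symm f (χ k), mul_left_comm, mul_comm (inner ℂ (χ k) f),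
        ← Complex.normSq_eq_conj_mul_self, ← Complex.ofReal_mul, Complex.ofReal_re,
        Complex.normSq_eq_norm_sq]
    · intro y hy
      have h0 : S (b y) = 0 := by
        refine hker _ fun i => ?_
        have hne : ⟨χ i, hw ⟨i, rfl⟩⟩ ≠ y := fun h => hy ⟨i, h⟩
        simpa [hb] using b.orthonormal.2 hne
      simp [h0]
  have hw : ∀ k, ∑ j ∈ Finset.range n, ‖inner ℂ (χ k) (v j)‖ ^ 2 ≤ 1 := by
    intro k
    have h := hv.sum_inner_products_le (χ k) (s := Finset.range n)
    simp_rw [norm_inner_symm (χ k)]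
    simpa [hχ.1 k] using h
  have hw2 : ∀ s : Finset ℕ, ∑ k ∈ s, ∑ j ∈ Finset.range n, ‖inner ℂ (χ k) (v j)‖ ^ 2 ≤ n := by
    intro s
    rw [Finset.sum_comm]
    calc _ ≤ ∑ j ∈ Finset.range n, (1 : ℝ) := by
          refine Finset.sum_le_sum fun j _ => ?_
          simpa [hv.1 j] using hχ.sum_inner_products_le (v j) (s := s)
      _ = n := by simp
  have hsum : HasSum (fun k => ∑ j ∈ Finset.range n, lam k * ‖inner ℂ (χ k) (v j)‖ ^ 2)
      (∑ j ∈ Finset.range n, (inner ℂ (v j) (S (v j))).re) :=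
    hasSum_sum fun j _ => hdiag (v j)
  refine le_of_tendsto hsum.tendsto_sum_nat ?_
  filter_upwards [eventually_ge_atTop n] with M hM
  set w : ℕ → ℝ := fun k => ∑ j ∈ Finset.range n, ‖inner ℂ (χ k) (v j)‖ ^ 2 with hwdef
  have hw0 : ∀ k, 0 ≤ w k := fun k => Finset.sum_nonneg fun _ _ => by positivity
  have hsplit := Finset.sum_range_add_sum_Ico (fun k => lam k * w k) hM
  have hsplit' := Finset.sum_range_add_sum_Ico w hM
  have h1 : ∑ k ∈ Finset.Ico n M, lam k * w k ≤ lam n * ∑ k ∈ Finset.Ico n M, w k := by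
    rw [Finset.mul_sum]
    refine Finset.sum_le_sum fun k hk => ?_
    exact mul_le_mul_of_nonneg_right (hanti (Finset.mem_Ico.mp hk).1) (hw0 k)
  have h2 : ∑ k ∈ Finset.range n, lam k * w k + lam n * (n - ∑ k ∈ Finset.range n, w k) ≤
      ∑ k ∈ Finset.range n, lam k := by
    have : (n : ℝ) - ∑ k ∈ Finset.range n, w k = ∑ k ∈ Finset.range n, (1 - w k) := by simp
    rw [this, Finset.mul_sum, ← Finset.sum_add_distrib]
    refine Finset.sum_le_sum fun k hk => ?_
    nlinarith [hw k, hanti (Finset.mem_range.mp hk).le]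
  have h3 : ∑ k ∈ Finset.Ico n M, w k ≤ n - ∑ k ∈ Finset.range n, w k := by
    have := hw2 (Finset.range M)
    linarith
  have h4 := mul_le_mul_of_nonneg_left h3 (hnn n)
  simp_rw [← Finset.mul_sum]
  linarith

end Hilbert

/-! ### Square-integrable functions and tensor products -/

section L2

variable {X Y : Type*} [MeasureSpace X] [MeasureSpace Y]

theorem memLp_two_iff_lintegral {f : X → ℂ} (hf : AEStronglyMeasurable f) :
    MemLp f 2 ↔ ∫⁻ x, ‖f x‖ₑ ^ 2 < ⊤ := by
  have h := eLpNorm_lt_top_iff_lintegral_rpow_enorm_lt_top (f := f) (μ := volume) (p := 2)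
    two_ne_zero ENNReal.ofNat_ne_top
  have h2 : ((2 : ENNReal).toReal) = ((2 : ℕ) : ℝ) := by simp
  simp_rw [h2, ENNReal.rpow_natCast] at h
  exact ⟨fun hm => h.mp hm.2, fun hm => ⟨hf, h.mpr hm⟩⟩

theorem L2_inner (f g : L2 X) : inner ℂ f g = ∫ x, starRingEnd ℂ (f x) * g x := by
  rw [L2.inner_def]
  simp_rw [RCLike.inner_apply, mul_comm]

theorem MeasureTheory.MemLp.integrable_conj_mul {f g : X → ℂ} (hf : MemLp f 2) (hg : MemLp g 2) :
    Integrable fun x => starRingEnd ℂ (f x) * g x :=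
  MemLp.integrable_mul (p := 2) (q := 2) hf.star hg

theorem L2_norm_sq (f : L2 X) : ‖f‖ ^ 2 = ∫ x, ‖f x‖ ^ 2 := by
  have h := inner_self_eq_norm_sq_to_K (𝕜 := ℂ) f
  rw [L2_inner] at h
  have h2 : ∫ x, starRingEnd ℂ (f x) * f x = ((∫ x, ‖f x‖ ^ 2 : ℝ) : ℂ) := by
    rw [← integral_complex_ofReal]
    refine integral_congr_ae (ae_of_all _ fun x => ?_)
    simp only
    rw [← Complex.normSq_eq_conj_mul_self, Complex.normSq_eq_norm_sq]
  rw [h2] at h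
  exact (Complex.ofReal_injective (by simpa using h)).symm

theorem lintegral_mul_sq_le {f g : X → ENNReal} (hf : AEMeasurable f) (hg : AEMeasurable g) :
    (∫⁻ x, f x * g x) ^ 2 ≤ (∫⁻ x, f x ^ 2) * ∫⁻ x, g x ^ 2 := by
  have h := ENNReal.lintegral_mul_le_Lp_mul_Lq volume Real.HolderConjugate.two_two hf hg
  have h2 : (2 : ℝ) = ((2 : ℕ) : ℝ) := by simp
  simp only [Pi.mul_apply, h2, ENNReal.rpow_natCast] at h
  refine (pow_le_pow_left' h 2).trans_eq ?_
  rw [mul_pow, ← ENNReal.rpow_natCast, ← ENNReal.rpow_natCast, ← ENNReal.rpow_mul,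
    ← ENNReal.rpow_mul]
  norm_num

theorem memLp_mul_prod [SFinite (volume : Measure X)] [SFinite (volume : Measure Y)]
    {f : X → ℂ} {g : Y → ℂ} (hf : MemLp f 2) (hg : MemLp g 2) :
    MemLp (fun p : X × Y => f p.1 * g p.2) 2 := by
  have hm : AEStronglyMeasurable (fun p : X × Y => f p.1 * g p.2) :=
    hf.1.comp_fst.mul hg.1.comp_snd
  rw [memLp_two_iff_integrable_sq_norm hm]
  simp_rw [norm_mul, mul_pow]
  exact Integrable.mul_prod ((memLp_two_iff_integrable_sq_norm hf.1).mp hf)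
    ((memLp_two_iff_integrable_sq_norm hg.1).mp hg)

/-- Integrating out one of the two variables of a square-integrable function against a
square-integrable function gives a square-integrable function. -/
theorem memLp_partial_inner [SFinite (volume : Measure X)] [SFinite (volume : Measure Y)]
    {f : X → ℂ} {ψ : X × Y → ℂ} (hf : MemLp f 2) (hψ : MemLp ψ 2) :
    MemLp (fun y => ∫ x, starRingEnd ℂ (f x) * ψ (x, y)) 2 := by
  have hm : AEStronglyMeasurable (fun p : X × Y => starRingEnd ℂ (f p.1) * ψ p) :=
    hf.star.1.comp_fst.mul hψ.1
  have hm2 : AEStronglyMeasurable (fun y => ∫ x, starRingEnd ℂ (f x) * ψ (x, y)) :=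
    AEStronglyMeasurable.integral_prod_right' (f := fun p : Y × X =>
      starRingEnd ℂ (f p.2) * ψ (p.2, p.1)) hm.prod_swap
  rw [memLp_two_iff_lintegral hm2]
  have hslice : ∀ᵐ y : Y, AEMeasurable (fun x => ‖ψ (x, y)‖ₑ) := by
    have := hψ.1.prod_swap.prodMk_left
    filter_upwards [this] with y hy using hy.enorm
  have hψ2 := (memLp_two_iff_lintegral hψ.1).mp hψ
  have hf2 := (memLp_two_iff_lintegral hf.1).mp hf
  rw [Measure.volume_eq_prod, lintegral_prod_symm _ (hψ.1.enorm.pow_const 2)] at hψ2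
  calc ∫⁻ y, ‖∫ x, starRingEnd ℂ (f x) * ψ (x, y)‖ₑ ^ 2
      ≤ ∫⁻ y, (∫⁻ x, ‖f x‖ₑ ^ 2) * ∫⁻ x, ‖ψ (x, y)‖ₑ ^ 2 := by
        refine lintegral_mono_ae ?_
        filter_upwards [hslice] with y hy
        refine (pow_le_pow_left' (enorm_integral_le_lintegral_enorm _) 2).trans ?_
        simp_rw [enorm_mul, RCLike.enorm_conj]
        exact lintegral_mul_sq_le hf.1.enorm hy
    _ = (∫⁻ x, ‖f x‖ₑ ^ 2) * ∫⁻ y, ∫⁻ x, ‖ψ (x, y)‖ₑ ^ 2 :=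
        lintegral_const_mul' _ _ hf2.ne
    _ < ⊤ := ENNReal.mul_lt_top hf2 hψ2

theorem integral_partial_inner [SFinite (volume : Measure X)] [SFinite (volume : Measure Y)]
    {f : X → ℂ} {g : Y → ℂ} {ψ : X × Y → ℂ} (hf : MemLp f 2) (hg : MemLp g 2) (hψ : MemLp ψ 2) :
    ∫ p : X × Y, starRingEnd ℂ (f p.1 * g p.2) * ψ p =
      ∫ y, starRingEnd ℂ (g y) * ∫ x, starRingEnd ℂ (f x) * ψ (x, y) := by
  have h := (memLp_mul_prod hf hg).integrable_conj_mul hψ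
  rw [Measure.volume_eq_prod, integral_prod_symm _ h]
  refine integral_congr_ae (ae_of_all _ fun y => ?_)
  simp only
  rw [← integral_const_mul]
  refine integral_congr_ae (ae_of_all _ fun x => ?_)
  simp only [map_mul]
  ring

end L2

section Insert

variable {n : ℕ}

theorem measurePreserving_insertNth (i : Fin (n + 1)) :
    MeasurePreserving (fun p : ℝ × (Fin n → ℝ) => (i.insertNth p.1 p.2 : Fin (n + 1) → ℝ)) := by
  have h := (volume_preserving_piFinSuccAbove (fun _ : Fin (n + 1) => ℝ) i).symm
  rw [MeasurableEquiv.piFinSuccAbove_symm_apply] at h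
  exact h

theorem measurableEmbedding_insertNth (i : Fin (n + 1)) :
    MeasurableEmbedding
      (fun p : ℝ × (Fin n → ℝ) => (i.insertNth p.1 p.2 : Fin (n + 1) → ℝ)) := by
  have h := (MeasurableEquiv.piFinSuccAbove (fun _ : Fin (n + 1) => ℝ) i).symm.measurableEmbedding
  rw [MeasurableEquiv.piFinSuccAbove_symm_apply] at h
  exact h

theorem measurePreserving_split (i : Fin (n + 1)) :
    MeasurePreserving (fun x : Fin (n + 1) → ℝ => (x i, i.removeNth x)) :=
  volume_preserving_piFinSuccAbove (fun _ : Fin (n + 1) => ℝ) i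

theorem quasiMeasurePreserving_eval (i : Fin (n + 1)) :
    Measure.QuasiMeasurePreserving (fun x : Fin (n + 1) → ℝ => x i) :=
  Measure.quasiMeasurePreserving_fst.comp (measurePreserving_split i).quasiMeasurePreserving

theorem quasiMeasurePreserving_removeNth (i : Fin (n + 1)) :
    Measure.QuasiMeasurePreserving (fun x : Fin (n + 1) → ℝ => i.removeNth x) :=
  Measure.quasiMeasurePreserving_snd.comp (measurePreserving_split i).quasiMeasurePreserving

theorem ae_insertNth {P : (Fin (n + 1) → ℝ) → Prop} (i : Fin (n + 1)) (h : ∀ᵐ x, P x) :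
    ∀ᵐ p : ℝ × (Fin n → ℝ), P (i.insertNth p.1 p.2) :=
  (measurePreserving_insertNth i).quasiMeasurePreserving.ae h

theorem integral_insertNth (i : Fin (n + 1)) (F : (Fin (n + 1) → ℝ) → ℂ) :
    ∫ x, F x = ∫ p : ℝ × (Fin n → ℝ), F (i.insertNth p.1 p.2) :=
  ((measurePreserving_insertNth i).integral_comp (measurableEmbedding_insertNth i) F).symm

theorem lintegral_insertNth (i : Fin (n + 1)) (F : (Fin (n + 1) → ℝ) → ENNReal) :
    ∫⁻ x, F x = ∫⁻ p : ℝ × (Fin n → ℝ), F (i.insertNth p.1 p.2) :=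
  ((measurePreserving_insertNth i).lintegral_comp_emb (measurableEmbedding_insertNth i) F).symm

theorem memLp_tens (i : Fin (n + 1)) (f : L2 ℝ) (g : L2 (Fin n → ℝ)) :
    MemLp (fun x : Fin (n + 1) → ℝ => f (x i) * g (i.removeNth x)) 2 :=
  (memLp_mul_prod (Lp.memLp f) (Lp.memLp g)).comp_measurePreserving (measurePreserving_split i)

theorem integral_conj_tens_mul_tens (i : Fin (n + 1)) (f f' : L2 ℝ) (g g' : L2 (Fin n → ℝ)) :
    ∫ x : Fin (n + 1) → ℝ, starRingEnd ℂ (f (x i) * g (i.removeNth x)) *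
      (f' (x i) * g' (i.removeNth x)) = inner ℂ f f' * inner ℂ g g' := by
  rw [integral_insertNth i, L2_inner, L2_inner, Measure.volume_eq_prod, ← integral_prod_mul]
  refine integral_congr_ae (ae_of_all _ fun p => ?_)
  simp only [Fin.insertNth_apply_same, Fin.removeNth_insertNth, map_mul]
  ring

/-- The product `f ⊗ g` of a function of the `i`-th variable and a function of the other variables,
as a bilinear map. -/
noncomputable def tensₗ (i : Fin (n + 1)) :
    L2 ℝ →ₗ[ℂ] L2 (Fin n → ℝ) →ₗ[ℂ] L2 (Fin (n + 1) → ℝ) :=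
  LinearMap.mk₂ ℂ (fun f g => (memLp_tens i f g).toLp)
    (fun f₁ f₂ g => by
      rw [← MemLp.toLp_add]
      refine MemLp.toLp_congr _ _ ?_
      filter_upwards [(quasiMeasurePreserving_eval i).ae (Lp.coeFn_add f₁ f₂)] with x hx
      simp only [Pi.add_apply] at hx ⊢
      rw [hx, add_mul])
    (fun c f g => by
      rw [← MemLp.toLp_const_smul]
      refine MemLp.toLp_congr _ _ ?_
      filter_upwards [(quasiMeasurePreserving_eval i).ae (Lp.coeFn_smul c f)] with x hx
      simp only [Pi.smul_apply, smul_eq_mul] at hx ⊢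
      rw [hx, mul_assoc])
    (fun f g₁ g₂ => by
      rw [← MemLp.toLp_add]
      refine MemLp.toLp_congr _ _ ?_
      filter_upwards [(quasiMeasurePreserving_removeNth i).ae (Lp.coeFn_add g₁ g₂)] with x hx
      simp only [Pi.add_apply] at hx ⊢
      rw [hx, mul_add])
    (fun c f g => by
      rw [← MemLp.toLp_const_smul]
      refine MemLp.toLp_congr _ _ ?_
      filter_upwards [(quasiMeasurePreserving_removeNth i).ae (Lp.coeFn_smul c g)] with x hx
      simp only [Pi.smul_apply, smul_eq_mul] at hx ⊢
      rw [hx, mul_left_comm])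

theorem coeFn_tensₗ (i : Fin (n + 1)) (f : L2 ℝ) (g : L2 (Fin n → ℝ)) :
    tensₗ i f g =ᵐ[volume] fun x => f (x i) * g (i.removeNth x) :=
  (memLp_tens i f g).coeFn_toLp

theorem inner_tensₗ (i : Fin (n + 1)) (f f' : L2 ℝ) (g g' : L2 (Fin n → ℝ)) :
    inner ℂ (tensₗ i f g) (tensₗ i f' g') = inner ℂ f f' * inner ℂ g g' := by
  rw [L2_inner, ← integral_conj_tens_mul_tens i]
  refine integral_congr_ae ?_
  filter_upwards [coeFn_tensₗ i f g, coeFn_tensₗ i f' g'] with x h1 h2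
  rw [h1, h2]

theorem norm_tensₗ (i : Fin (n + 1)) (f : L2 ℝ) (g : L2 (Fin n → ℝ)) :
    ‖tensₗ i f g‖ = ‖f‖ * ‖g‖ := by
  have h := inner_tensₗ i f f g g
  simp_rw [inner_self_eq_norm_sq_to_K] at h
  have h2 : ‖tensₗ i f g‖ ^ 2 = (‖f‖ * ‖g‖) ^ 2 := by
    rw [mul_pow]
    exact Complex.ofReal_injective (by simpa using h)
  exact (pow_left_inj₀ (norm_nonneg _) (by positivity) two_ne_zero).mp h2

/-- The product `f ⊗ g` of a function of the `i`-th variable and a function of the other variables,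
as a continuous bilinear map. -/
noncomputable def tens (i : Fin (n + 1)) :
    L2 ℝ →L[ℂ] L2 (Fin n → ℝ) →L[ℂ] L2 (Fin (n + 1) → ℝ) :=
  (tensₗ i).mkContinuous₂ 1 fun f g => by rw [norm_tensₗ, one_mul]

theorem coeFn_tens (i : Fin (n + 1)) (f : L2 ℝ) (g : L2 (Fin n → ℝ)) :
    tens i f g =ᵐ[volume] fun x => f (x i) * g (i.removeNth x) :=
  coeFn_tensₗ i f g

theorem inner_tens (i : Fin (n + 1)) (f f' : L2 ℝ) (g g' : L2 (Fin n → ℝ)) :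
    inner ℂ (tens i f g) (tens i f' g') = inner ℂ f f' * inner ℂ g g' :=
  inner_tensₗ i f f' g g'

theorem norm_tens (i : Fin (n + 1)) (f : L2 ℝ) (g : L2 (Fin n → ℝ)) :
    ‖tens i f g‖ = ‖f‖ * ‖g‖ := norm_tensₗ i f g

/-- Partial inner product with a function of the `i`-th variable, the adjoint of `f ⊗ ·`. -/
noncomputable def contrL (i : Fin (n + 1)) (f : L2 ℝ) :
    L2 (Fin (n + 1) → ℝ) →L[ℂ] L2 (Fin n → ℝ) :=
  ContinuousLinearMap.adjoint (tens i f)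

/-- Partial inner product with a function of all variables but the `i`-th, the adjoint of
`· ⊗ g`. -/
noncomputable def contrR (i : Fin (n + 1)) (g : L2 (Fin n → ℝ)) :
    L2 (Fin (n + 1) → ℝ) →L[ℂ] L2 ℝ :=
  ContinuousLinearMap.adjoint ((tens i).flip g)

theorem inner_contrL (i : Fin (n + 1)) (f : L2 ℝ) (g : L2 (Fin n → ℝ)) (ψ : L2 (Fin (n + 1) → ℝ)) :
    inner ℂ g (contrL i f ψ) = inner ℂ (tens i f g) ψ :=
  ContinuousLinearMap.adjoint_inner_right _ _ _

theorem inner_contrR (i : Fin (n + 1)) (f : L2 ℝ) (g : L2 (Fin n → ℝ)) (ψ : L2 (Fin (n + 1) → ℝ)) :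
    inner ℂ f (contrR i g ψ) = inner ℂ (tens i f g) ψ :=
  ContinuousLinearMap.adjoint_inner_right _ _ _

theorem memLp_insertNth (i : Fin (n + 1)) (ψ : L2 (Fin (n + 1) → ℝ)) :
    MemLp (fun p : ℝ × (Fin n → ℝ) => ψ (i.insertNth p.1 p.2)) 2 :=
  (Lp.memLp ψ).comp_measurePreserving (measurePreserving_insertNth i)

theorem inner_tens_eq_integral (i : Fin (n + 1)) (f : L2 ℝ) (g : L2 (Fin n → ℝ))
    (ψ : L2 (Fin (n + 1) → ℝ)) : inner ℂ (tens i f g) ψ =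
      ∫ p : ℝ × (Fin n → ℝ), starRingEnd ℂ (f p.1 * g p.2) * ψ (i.insertNth p.1 p.2) := by
  rw [L2_inner, integral_insertNth i]
  refine integral_congr_ae ?_
  filter_upwards [ae_insertNth i (coeFn_tens i f g)] with p hp
  rw [hp, Fin.insertNth_apply_same, Fin.removeNth_insertNth]

theorem coeFn_contrL (i : Fin (n + 1)) (f : L2 ℝ) (ψ : L2 (Fin (n + 1) → ℝ)) :
    contrL i f ψ =ᵐ[volume] fun y => ∫ t, starRingEnd ℂ (f t) * ψ (i.insertNth t y) := by
  have hm := memLp_partial_inner (Lp.memLp f) (memLp_insertNth i ψ)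
  have h : contrL i f ψ = hm.toLp := by
    refine ext_inner_left ℂ fun g => ?_
    rw [inner_contrL, inner_tens_eq_integral,
      integral_partial_inner (Lp.memLp f) (Lp.memLp g) (memLp_insertNth i ψ), L2_inner]
    refine integral_congr_ae ?_
    filter_upwards [hm.coeFn_toLp] with y hy
    rw [hy]
  rw [h]
  exact hm.coeFn_toLp

theorem coeFn_contrR (i : Fin (n + 1)) (g : L2 (Fin n → ℝ)) (ψ : L2 (Fin (n + 1) → ℝ)) :
    contrR i g ψ =ᵐ[volume] fun t => ∫ y, starRingEnd ℂ (g y) * ψ (i.insertNth t y) := by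
  have hswap : MemLp (fun p : (Fin n → ℝ) × ℝ => ψ (i.insertNth p.2 p.1)) 2 :=
    (memLp_insertNth i ψ).comp_measurePreserving (g := fun p : ℝ × (Fin n → ℝ) =>
      ψ (i.insertNth p.1 p.2)) (f := Prod.swap) Measure.measurePreserving_swap
  have hm := memLp_partial_inner (Lp.memLp g) hswap
  have h : contrR i g ψ = hm.toLp := by
    refine ext_inner_left ℂ fun f => ?_
    rw [inner_contrR, inner_tens_eq_integral, L2_inner]
    have h1 := integral_partial_inner (Lp.memLp g) (Lp.memLp f) hswap
    have h2 := integral_prod_swap (μ := (volume : Measure ℝ))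
      (ν := (volume : Measure (Fin n → ℝ))) (fun p : ℝ × (Fin n → ℝ) =>
      starRingEnd ℂ (f p.1 * g p.2) * ψ (i.insertNth p.1 p.2))
    rw [Measure.volume_eq_prod, ← h2]
    simp only [Prod.fst_swap, Prod.snd_swap]
    simp_rw [mul_comm (f _) (g _)]
    rw [← Measure.volume_eq_prod, h1]
    refine integral_congr_ae ?_
    filter_upwards [hm.coeFn_toLp] with y hy
    rw [hy]
  rw [h]
  exact hm.coeFn_toLp

theorem contrL_tens (i : Fin (n + 1)) (f f' : L2 ℝ) (g : L2 (Fin n → ℝ)) :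
    contrL i f (tens i f' g) = (inner ℂ f f' : ℂ) • g := by
  refine ext_inner_left ℂ fun h => ?_
  rw [inner_contrL, inner_tens, inner_smul_right]

/-- The operator `(|g⟩⟨f|)ᵢ` factors through the partial inner product with `f`. -/
theorem rankOneMean_eq (ψ : L2 (Fin (n + 1) → ℝ)) (g f : L2 ℝ) :
    rankOneMean ψ g f = ∑ i, inner ℂ (contrL i g ψ) (contrL i f ψ) := by
  refine Finset.sum_congr rfl fun i _ => ?_
  rw [contrL, ContinuousLinearMap.adjoint_inner_left, L2_inner]
  refine integral_congr_ae ?_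
  filter_upwards [coeFn_tens i g (contrL i f ψ),
    (quasiMeasurePreserving_removeNth i).ae (coeFn_contrL i f ψ)] with x h1 h2
  rw [h1, h2]
  simp_rw [Fin.insertNth_removeNth]

/-- Bessel's inequality in the `i`-th variable. -/
theorem sum_norm_contrL_sq_le (i : Fin (n + 1)) {ι : Type*} {f : ι → L2 ℝ} (hf : Orthonormal ℂ f)
    (s : Finset ι) (ψ : L2 (Fin (n + 1) → ℝ)) :
    ∑ j ∈ s, ‖contrL i (f j) ψ‖ ^ 2 ≤ ‖ψ‖ ^ 2 := by
  classical
  set y := ∑ j ∈ s, tens i (f j) (contrL i (f j) ψ) with hy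
  have h1 : inner ℂ y ψ = ((∑ j ∈ s, ‖contrL i (f j) ψ‖ ^ 2 : ℝ) : ℂ) := by
    rw [hy, sum_inner, Complex.ofReal_sum]
    refine Finset.sum_congr rfl fun j _ => ?_
    rw [← inner_contrL, inner_self_eq_norm_sq_to_K]
    norm_cast
  have h2 : ‖y‖ ^ 2 = ∑ j ∈ s, ‖contrL i (f j) ψ‖ ^ 2 := by
    have h := inner_self_eq_norm_sq_to_K (𝕜 := ℂ) y
    have h3 : inner ℂ y y = ((∑ j ∈ s, ‖contrL i (f j) ψ‖ ^ 2 : ℝ) : ℂ) := by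
      rw [hy, sum_inner, Complex.ofReal_sum]
      refine Finset.sum_congr rfl fun j hj => ?_
      rw [inner_sum, Finset.sum_eq_single_of_mem j hj]
      · rw [inner_tens, inner_self_eq_norm_sq_to_K, inner_self_eq_norm_sq_to_K, hf.1]
        simp
      · intro k _ hk
        rw [inner_tens, hf.2 hk.symm, zero_mul]
    rw [h3] at h
    exact (Complex.ofReal_injective (by simpa using h)).symm
  have h4 : ‖ψ - y‖ ^ 2 = ‖ψ‖ ^ 2 - 2 * RCLike.re (inner ℂ ψ y) + ‖y‖ ^ 2 := norm_sub_sq ψ y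
  have h5 : RCLike.re (inner ℂ ψ y) = ∑ j ∈ s, ‖contrL i (f j) ψ‖ ^ 2 := by
    rw [inner_re_symm, h1]
    exact Complex.ofReal_re _
  nlinarith [sq_nonneg ‖ψ - y‖]

theorem norm_contrL_le (i : Fin (n + 1)) (f : L2 ℝ) (ψ : L2 (Fin (n + 1) → ℝ)) :
    ‖contrL i f ψ‖ ≤ ‖f‖ * ‖ψ‖ := by
  refine (ContinuousLinearMap.le_opNorm _ _).trans ?_
  rw [contrL, LinearIsometryEquiv.norm_map]
  refine mul_le_mul_of_nonneg_right ?_ (norm_nonneg _)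
  exact ContinuousLinearMap.opNorm_le_bound _ (norm_nonneg _) fun g => (norm_tens i f g).le

end Insert

section Tensor

theorem volume_fin_zero : (volume : Measure (Fin 0 → ℝ)) = Measure.dirac default := by
  rw [volume_pi, Measure.pi_of_empty _ default]

theorem memLp_one_fin_zero : MemLp (fun _ : Fin 0 → ℝ => (1 : ℂ)) 2 := by
  rw [volume_fin_zero]
  exact memLp_const 1

/-- The product function `f₁(x₁) ⋯ f_N(x_N)`. -/
noncomputable def tensorN : (N : ℕ) → (Fin N → L2 ℝ) → L2 (Fin N → ℝ)
  | 0, _ => memLp_one_fin_zero.toLp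
  | n + 1, f => tens 0 (f 0) (tensorN n fun k => f k.succ)

theorem coeFn_tensorN : ∀ (N : ℕ) (f : Fin N → L2 ℝ),
    tensorN N f =ᵐ[volume] fun x => ∏ i, f i (x i)
  | 0, f => by
    filter_upwards [memLp_one_fin_zero.coeFn_toLp] with x hx
    rw [Finset.univ_eq_empty, Finset.prod_empty, tensorN, hx]
  | n + 1, f => by
    filter_upwards [coeFn_tens 0 (f 0) (tensorN n fun k => f k.succ),
      (quasiMeasurePreserving_removeNth 0).ae (coeFn_tensorN n fun k => f k.succ)] with x h1 h2
    rw [tensorN, h1, h2, Fin.prod_univ_succ]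
    rfl

theorem tensorN_eq_tens {n : ℕ} (i : Fin (n + 1)) (f : Fin (n + 1) → L2 ℝ) :
    tensorN (n + 1) f = tens i (f i) (tensorN n fun k => f (i.succAbove k)) := by
  refine Lp.ext ?_
  filter_upwards [coeFn_tensorN (n + 1) f, coeFn_tens i (f i) (tensorN n fun k => f (i.succAbove k)),
      (quasiMeasurePreserving_removeNth i).ae (coeFn_tensorN n fun k => f (i.succAbove k))]
      with x h1 h2 h3
  rw [h1, h2, h3, Fin.prod_univ_succAbove _ i]
  rfl

theorem inner_tensorN : ∀ (N : ℕ) (f g : Fin N → L2 ℝ),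
    inner ℂ (tensorN N f) (tensorN N g) = ∏ i, inner ℂ (f i) (g i)
  | 0, f, g => by
    rw [L2_inner, integral_congr_ae (g := fun _ => (1 : ℂ))]
    · rw [volume_fin_zero]
      simp
    · filter_upwards [coeFn_tensorN 0 f, coeFn_tensorN 0 g] with x h1 h2
      rw [h1, h2]
      simp
  | n + 1, f, g => by
    rw [tensorN, tensorN, inner_tens, inner_tensorN n, Fin.prod_univ_succ]

theorem norm_tensorN_eq_one {N : ℕ} {f : Fin N → L2 ℝ} (hf : ∀ i, ‖f i‖ = 1) :
    ‖tensorN N f‖ = 1 := by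
  have h := inner_tensorN N f f
  simp_rw [inner_self_eq_norm_sq_to_K, hf] at h
  have h2 : ‖tensorN N f‖ ^ 2 = 1 := Complex.ofReal_injective (by simpa using h)
  exact (pow_eq_one_iff_of_nonneg (norm_nonneg _) two_ne_zero).mp h2

/-- Functions of `N` variables are determined by their inner products with product functions. -/
theorem eq_zero_of_inner_tensorN : ∀ (N : ℕ) (ψ : L2 (Fin N → ℝ)),
    (∀ f, inner ℂ (tensorN N f) ψ = 0) → ψ = 0
  | 0, ψ, h => by
    have h0 := h 0
    rw [L2_inner] at h0
    have h1 : ∫ x, starRingEnd ℂ (tensorN 0 0 x) * ψ x = ψ default := by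
      have hae : (fun x => starRingEnd ℂ (tensorN 0 0 x) * ψ x) =ᵐ[volume] fun x => ψ x := by
        filter_upwards [coeFn_tensorN 0 0] with x hx
        rw [hx]
        simp
      rw [integral_congr_ae hae]
      have hone : (volume : Measure (Fin 0 → ℝ)).real Set.univ = 1 := by
        rw [volume_fin_zero]
        simp
      rw [integral_unique, hone, one_smul]
      exact congrArg _ (Subsingleton.elim _ _)
    rw [h1] at h0
    refine Lp.ext ?_
    filter_upwards [Lp.coeFn_zero ℂ 2 (volume : Measure (Fin 0 → ℝ))] with x hx
    rw [hx, Subsingleton.elim x default, h0]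
    rfl
  | n + 1, ψ, h => by
    have hc : ∀ f : L2 ℝ, contrL 0 f ψ = 0 := by
      intro f
      refine eq_zero_of_inner_tensorN n _ fun g => ?_
      rw [inner_contrL]
      simpa [tensorN] using h (Fin.cons f g)
    -- Almost every slice of `ψ` is orthogonal to a countable dense set of functions.
    have : Fact ((2 : ENNReal) ≠ ⊤) := ⟨ENNReal.ofNat_ne_top⟩
    obtain ⟨s, hs, hd⟩ := TopologicalSpace.exists_countable_dense (L2 ℝ)
    have h1 : ∀ᵐ y : Fin n → ℝ, ∀ f ∈ s,
        ∫ t, starRingEnd ℂ (f t) * ψ ((0 : Fin (n + 1)).insertNth t y) = 0 := by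
      rw [ae_ball_iff hs]
      intro f _
      filter_upwards [coeFn_contrL 0 f ψ, Lp.coeFn_zero ℂ 2 (volume : Measure (Fin n → ℝ))]
        with y h2 h3
      rw [← h2, hc, h3]
      rfl
    have hmem := memLp_insertNth 0 ψ
    have h2 : ∀ᵐ y : Fin n → ℝ,
        MemLp (fun t => ψ ((0 : Fin (n + 1)).insertNth t y)) 2 := by
      have hsw := hmem.1.prod_swap.prodMk_left
      have hfin := (memLp_two_iff_lintegral hmem.1).mp hmem
      rw [Measure.volume_eq_prod, lintegral_prod_symm _ (hmem.1.enorm.pow_const 2)] at hfin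
      have hfin' := ae_lt_top' (AEMeasurable.lintegral_prod_right'
        (f := fun p : (Fin n → ℝ) × ℝ => ‖ψ ((0 : Fin (n + 1)).insertNth p.2 p.1)‖ₑ ^ 2)
        (hmem.1.prod_swap.enorm.pow_const 2)) hfin.ne
      filter_upwards [hsw, hfin'] with y hy1 hy2
      exact (memLp_two_iff_lintegral hy1).mpr hy2
    have h3 : ∀ᵐ y : Fin n → ℝ, ∀ᵐ t, ψ ((0 : Fin (n + 1)).insertNth t y) = 0 := by
      filter_upwards [h1, h2] with y hy1 hy2
      have hz : hy2.toLp = 0 := by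
        refine hd.eq_zero_of_inner_right ℂ fun f hf => ?_
        rw [L2_inner, ← hy1 f hf]
        refine integral_congr_ae ?_
        filter_upwards [hy2.coeFn_toLp] with t ht
        rw [ht]
      filter_upwards [hy2.coeFn_toLp, Lp.coeFn_zero ℂ 2 (volume : Measure ℝ)] with t ht1 ht2
      rw [← ht1, hz, ht2]
      rfl
    have hnorm : ‖ψ‖ ^ 2 = 0 := by
      have h4 : ∫⁻ x, ‖ψ x‖ₑ ^ 2 = 0 := by
        rw [lintegral_insertNth 0, Measure.volume_eq_prod,
          lintegral_prod_symm _ (hmem.1.enorm.pow_const 2), lintegral_eq_zero_of_ae_eq_zero]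
        filter_upwards [h3] with y hy
        refine lintegral_eq_zero_of_ae_eq_zero ?_
        filter_upwards [hy] with t ht
        rw [ht]
        simp
      rw [L2_norm_sq]
      refine integral_eq_zero_of_ae ?_
      rw [lintegral_eq_zero_iff' ((Lp.aestronglyMeasurable ψ).enorm.pow_const 2)] at h4
      filter_upwards [h4] with x hx
      simpa using hx
    simpa using hnorm

/-- The product functions of the vectors of an orthonormal system. -/
noncomputable def tensorBasis (φ : ℕ → L2 ℝ) {N : ℕ} (k : Fin N → ℕ) : L2 (Fin N → ℝ) :=
  tensorN N fun i => φ (k i)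

theorem orthonormal_tensorBasis {φ : ℕ → L2 ℝ} (hφ : Orthonormal ℂ φ) (N : ℕ) :
    Orthonormal ℂ (tensorBasis φ (N := N)) := by
  rw [orthonormal_iff_ite]
  intro k l
  rw [tensorBasis, tensorBasis, inner_tensorN]
  simp_rw [orthonormal_iff_ite.mp hφ]
  split_ifs with h
  · simp [h]
  · obtain ⟨i, hi⟩ := Function.ne_iff.mp h
    exact Finset.prod_eq_zero (Finset.mem_univ i) (by simp [hi])

/-- If, in each variable, `ψ` depends only on the span of the `φ k`, then `ψ` lies in the span of
their product functions. -/
theorem mem_closure_span_tensorBasis {n : ℕ} {φ : ℕ → L2 ℝ} {ψ : L2 (Fin (n + 1) → ℝ)}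
    (hψ : ∀ i (f : L2 ℝ), (∀ k, inner ℂ f (φ k) = 0) → contrL i f ψ = 0) :
    ψ ∈ (Submodule.span ℂ (Set.range (tensorBasis φ (N := n + 1)))).topologicalClosure := by
  classical
  set Q := (Submodule.span ℂ (Set.range (tensorBasis φ (N := n + 1)))).topologicalClosure with hQ
  have : CompleteSpace Q := (Submodule.isClosed_topologicalClosure _).completeSpace_coe
  obtain ⟨y, hy, z, hz, rfl⟩ := Q.exists_add_mem_mem_orthogonal ψ
  have hbasis : ∀ k, tensorBasis φ k ∈ Q := fun k =>
    Submodule.le_topologicalClosure _ (Submodule.subset_span ⟨k, rfl⟩)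
  have hyc : ∀ i (f : L2 ℝ), (∀ k, inner ℂ f (φ k) = 0) → contrL i f y = 0 := by
    intro i f hf
    have hle : Q ≤ LinearMap.ker (contrL i f).toLinearMap := by
      refine Submodule.topologicalClosure_minimal _ ?_ (contrL i f).isClosed_ker
      rw [Submodule.span_le]
      rintro _ ⟨k, rfl⟩
      have : contrL i f (tensorBasis φ k) = 0 := by
        rw [tensorBasis, tensorN_eq_tens i, contrL_tens, hf, zero_smul]
      simpa using this
    simpa using hle hy
  have hzc : ∀ i (f : L2 ℝ), (∀ k, inner ℂ f (φ k) = 0) → contrL i f z = 0 := by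
    intro i f hf
    have := hψ i f hf
    rwa [map_add, hyc i f hf, zero_add] at this
  -- Replace the factors `φ k` of a product function by arbitrary functions one at a time.
  have key : ∀ s : Finset (Fin (n + 1)), ∀ h : Fin (n + 1) → L2 ℝ,
      (∀ i ∉ s, ∃ k, h i = φ k) → inner ℂ (tensorN (n + 1) h) z = 0 := by
    intro s
    induction s using Finset.induction_on with
    | empty =>
      intro h hh
      choose k hk using fun i => hh i (Finset.notMem_empty i)
      have hb : tensorN (n + 1) h = tensorBasis φ k := by
        rw [tensorBasis]
        congr 1
        exact funext hk
      rw [hb]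
      exact (Submodule.mem_orthogonal _ _).mp hz _ (hbasis k)
    | insert i s hi ih =>
      intro h hh
      rw [tensorN_eq_tens i, ← inner_contrR]
      set v := contrR i (tensorN n fun k => h (i.succAbove k)) z with hv
      suffices v = 0 by rw [this, inner_zero_right]
      have hvφ : ∀ k, inner ℂ (φ k) v = 0 := by
        intro k
        have h1 := ih (Function.update h i (φ k)) (by
          intro j hj
          by_cases hji : j = i
          · subst hji
            exact ⟨k, by simp⟩
          · rw [Function.update_of_ne hji]
            exact hh j (by simp [hj, hji]))
        rw [tensorN_eq_tens i, ← inner_contrR] at h1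
        simpa using h1
      have hvv : inner ℂ v v = 0 := by
        nth_rw 2 [hv]
        rw [inner_contrR, ← inner_contrL, hzc i v fun k => inner_eq_zero_symm.mp (hvφ k),
          inner_zero_right]
      exact inner_self_eq_zero.mp hvv
  have hz0 : z = 0 := eq_zero_of_inner_tensorN _ _ fun h =>
    key Finset.univ h fun i hi => absurd (Finset.mem_univ i) hi
  rw [hz0, add_zero]
  exact hy

end Tensor

/-! ### Weak derivatives and form domains -/

theorem continuous_fderiv_apply_of_contDiff {X : Type*} [NormedAddCommGroup X] [NormedSpace ℝ X]
    {η : X → ℝ} (hη : ContDiff ℝ ∞ η) (a : X) : Continuous fun x => fderiv ℝ η x a :=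
  (hη.continuous_fderiv (by simp)).clm_apply continuous_const

section Potential

variable {X : Type*} [MeasureSpace X]

/-- The multiplication operator whose square is `W + B`, for a potential `W ≥ -B`; its value at
points where `W = +∞` is irrelevant. -/
noncomputable def potRoot {X : Type*} (B : ℝ) (W : X → EReal) (x : X) : ℝ :=
  √((W x).toReal + B)

theorem potRoot_nonneg {X : Type*} (B : ℝ) (W : X → EReal) (x : X) : 0 ≤ potRoot B W x :=
  Real.sqrt_nonneg _

theorem toReal_add_nonneg {X : Type*} {B : ℝ} (hB : 0 ≤ B) {W : X → EReal}
    (hW : ∀ x, ((-B : ℝ) : EReal) ≤ W x) (x : X) : 0 ≤ (W x).toReal + B := by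
  by_cases h : W x = ⊤
  · simpa [h] using hB
  · have := EReal.toReal_le_toReal (hW x) (EReal.coe_ne_bot _) h
    rw [EReal.toReal_coe] at this
    linarith

theorem potRoot_sq {X : Type*} {B : ℝ} (hB : 0 ≤ B) {W : X → EReal}
    (hW : ∀ x, ((-B : ℝ) : EReal) ≤ W x) (x : X) : potRoot B W x ^ 2 = (W x).toReal + B :=
  Real.sq_sqrt (toReal_add_nonneg hB hW x)

theorem aemeasurable_potRoot (B : ℝ) {W : X → EReal} (hW : AEMeasurable W) :
    AEMeasurable (potRoot B W) :=
  (hW.ereal_toReal.add_const B).sqrt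

theorem lintegral_potential_lt_top_iff {B : ℝ} (hB : 0 ≤ B) {W : X → EReal} (hWm : AEMeasurable W)
    (hW : ∀ x, ((-B : ℝ) : EReal) ≤ W x) (f : L2 X) :
    ∫⁻ x, (W x).toENNReal * ‖f x‖ₑ ^ 2 < ⊤ ↔
      (∀ᵐ x, W x = ⊤ → f x = 0) ∧ MemLp (fun x => (potRoot B W x : ℂ) * f x) 2 := by
  have hfm := Lp.aestronglyMeasurable f
  have hpm : AEStronglyMeasurable (fun x => (potRoot B W x : ℂ) * f x) :=
    ((Complex.measurable_ofReal.comp_aemeasurable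
      (aemeasurable_potRoot B hWm)).aestronglyMeasurable).mul hfm
  have hf2 := (memLp_two_iff_lintegral hfm).mp (Lp.memLp f)
  have hWf : AEMeasurable fun x => (W x).toENNReal * ‖f x‖ₑ ^ 2 :=
    (measurable_ereal_toENNReal.comp_aemeasurable hWm).mul (hfm.enorm.pow_const 2)
  have hsq : ∀ x, ‖(potRoot B W x : ℂ) * f x‖ₑ ^ 2 =
      ENNReal.ofReal ((W x).toReal + B) * ‖f x‖ₑ ^ 2 := by
    intro x
    rw [enorm_mul, mul_pow, ← potRoot_sq hB hW, ENNReal.ofReal_pow (potRoot_nonneg _ _ _)]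
    congr 2
    rw [← ofReal_norm, Complex.norm_of_nonneg (potRoot_nonneg _ _ _)]
  have hne : ∀ x, W x ≠ ⊥ := fun x h => by
    have := hW x
    rw [h, le_bot_iff] at this
    exact EReal.coe_ne_bot _ this
  rw [memLp_two_iff_lintegral hpm]
  simp_rw [hsq]
  constructor
  · intro h
    refine ⟨?_, ?_⟩
    · filter_upwards [ae_lt_top' hWf h.ne] with x hx hxt
      by_contra h0
      rw [hxt, EReal.toENNReal_top, ENNReal.top_mul] at hx
      · exact lt_irrefl _ hx
      · simpa using h0
    · calc ∫⁻ x, ENNReal.ofReal ((W x).toReal + B) * ‖f x‖ₑ ^ 2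
          ≤ ∫⁻ x, ((W x).toENNReal * ‖f x‖ₑ ^ 2 + ENNReal.ofReal B * ‖f x‖ₑ ^ 2) := by
            refine lintegral_mono fun x => ?_
            rw [← add_mul]
            gcongr
            refine ENNReal.ofReal_add_le.trans ?_
            gcongr
            by_cases hx : W x = ⊤
            · simp [hx]
            · rw [EReal.toENNReal_of_ne_top hx]
        _ = (∫⁻ x, (W x).toENNReal * ‖f x‖ₑ ^ 2) + ENNReal.ofReal B * ∫⁻ x, ‖f x‖ₑ ^ 2 := by
            rw [lintegral_add_left' hWf, lintegral_const_mul' _ _ ENNReal.ofReal_ne_top]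
        _ < ⊤ := ENNReal.add_lt_top.mpr ⟨h, ENNReal.mul_lt_top ENNReal.ofReal_lt_top hf2⟩
  · rintro ⟨h1, h2⟩
    refine lt_of_le_of_lt (lintegral_mono_ae ?_) h2
    filter_upwards [h1] with x hx
    by_cases hxt : W x = ⊤
    · simp [hx hxt]
    · rw [EReal.toENNReal_of_ne_top hxt]
      gcongr
      linarith

theorem integral_potential {B : ℝ} (hB : 0 ≤ B) {W : X → EReal}
    (hW : ∀ x, ((-B : ℝ) : EReal) ≤ W x) {f g a a' : L2 X}
    (ha : a =ᵐ[volume] fun x => (potRoot B W x : ℂ) * f x)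
    (ha' : a' =ᵐ[volume] fun x => (potRoot B W x : ℂ) * g x) :
    (∫ x, ((W x).toReal : ℂ) * (starRingEnd ℂ (f x) * g x)) + B * inner ℂ f g = inner ℂ a a' := by
  have h1 := (Lp.memLp a).integrable_conj_mul (Lp.memLp a')
  have h2 := ((Lp.memLp f).integrable_conj_mul (Lp.memLp g)).const_mul (B : ℂ)
  have h3 : (fun x => ((W x).toReal : ℂ) * (starRingEnd ℂ (f x) * g x)) =ᵐ[volume]
      fun x => starRingEnd ℂ (a x) * a' x - B * (starRingEnd ℂ (f x) * g x) := by
    filter_upwards [ha, ha'] with x hx hx'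
    have h4 : ((W x).toReal : ℂ) = (potRoot B W x : ℂ) ^ 2 - B := by
      rw [← Complex.ofReal_pow, potRoot_sq hB hW]
      push_cast
      ring
    rw [hx, hx', map_mul, Complex.conj_ofReal, h4]
    ring
  rw [integral_congr_ae h3, integral_sub h1 h2, L2_inner, L2_inner, integral_const_mul]
  ring

theorem L2_locallyIntegrable [TopologicalSpace X] [IsLocallyFiniteMeasure (volume : Measure X)]
    (f : L2 X) : LocallyIntegrable f :=
  (Lp.memLp f).locallyIntegrable one_le_two

theorem exists_seq_tendsto_ae_of_tendsto {f : ℕ → L2 X} {g : L2 X}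
    (h : Tendsto f atTop (𝓝 g)) :
    ∃ ns : ℕ → ℕ, StrictMono ns ∧ ∀ᵐ x, Tendsto (fun k => f (ns k) x) atTop (𝓝 (g x)) :=
  (tendstoInMeasure_of_tendsto_Lp h).exists_seq_tendsto_ae

end Potential

section Forms

variable {X : Type*} [NormedAddCommGroup X] [NormedSpace ℝ X] [FiniteDimensional ℝ X]
  [MeasureSpace X] [BorelSpace X] [IsLocallyFiniteMeasure (volume : Measure X)]

/-- A real continuous function of compact support, as an element of `L²`. -/
noncomputable def testL2 {η : X → ℝ} (hc : Continuous η) (hs : HasCompactSupport η) : L2 X :=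
  MemLp.toLp (fun x => (η x : ℂ))
    ((Complex.continuous_ofReal.comp hc).memLp_of_hasCompactSupport
      (hs.comp_left (g := ((↑) : ℝ → ℂ)) Complex.ofReal_zero))

theorem coeFn_testL2 {η : X → ℝ} (hc : Continuous η) (hs : HasCompactSupport η) :
    testL2 hc hs =ᵐ[volume] fun x => (η x : ℂ) :=
  MemLp.coeFn_toLp _

theorem inner_testL2 {η : X → ℝ} (hc : Continuous η) (hs : HasCompactSupport η) (f : L2 X) :
    inner ℂ (testL2 hc hs) f = ∫ x, (η x : ℂ) * f x := by
  rw [L2_inner]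
  refine integral_congr_ae ?_
  filter_upwards [coeFn_testL2 hc hs] with x hx
  rw [hx, Complex.conj_ofReal]

/-- The weak derivative as a condition on inner products. -/
theorem isWeakDeriv_iff {a : X} {f g : L2 X} :
    IsWeakDeriv a f g ↔ ∀ (η : X → ℝ) (hη : ContDiff ℝ ∞ η) (hs : HasCompactSupport η),
      inner ℂ (testL2 (continuous_fderiv_apply_of_contDiff hη a) (hs.fderiv_apply ℝ a)) f =
        -inner ℂ (testL2 hη.continuous hs) g := by
  simp_rw [inner_testL2]
  rfl

theorem isWeakDeriv_zero (a : X) : IsWeakDeriv a (0 : L2 X) 0 := by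
  rw [isWeakDeriv_iff]
  intro η hη hs
  simp

theorem IsWeakDeriv.add {a : X} {f g f' g' : L2 X} (h : IsWeakDeriv a f g)
    (h' : IsWeakDeriv a f' g') : IsWeakDeriv a (f + f') (g + g') := by
  rw [isWeakDeriv_iff] at *
  intro η hη hs
  rw [inner_add_right, inner_add_right, h η hη hs, h' η hη hs]
  ring

theorem IsWeakDeriv.smul {a : X} {f g : L2 X} (c : ℂ) (h : IsWeakDeriv a f g) :
    IsWeakDeriv a (c • f) (c • g) := by
  rw [isWeakDeriv_iff] at *
  intro η hη hs
  rw [inner_smul_right, inner_smul_right, h η hη hs]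
  ring

theorem isClosed_isWeakDeriv {Z : Type*} [TopologicalSpace Z] (a : X) {f g : Z → L2 X}
    (hf : Continuous f) (hg : Continuous g) : IsClosed {z | IsWeakDeriv a (f z) (g z)} := by
  simp_rw [isWeakDeriv_iff, Set.ofPred_forall]
  refine isClosed_iInter fun η => isClosed_iInter fun hη => isClosed_iInter fun hs => ?_
  exact isClosed_eq (continuous_const.inner hf) (continuous_const.inner hg).neg

theorem IsWeakDeriv.unique {a : X} {f g g' : L2 X}
    (h : IsWeakDeriv a f g) (h' : IsWeakDeriv a f g') : g = g' := by
  refine Lp.ext (ae_eq_of_integral_contDiff_smul_eq (L2_locallyIntegrable g)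
    (L2_locallyIntegrable g') fun η hη hs => ?_)
  have := (h η hη hs).symm.trans (h' η hη hs)
  simpa [Complex.real_smul] using neg_injective this

theorem IsWeakDeriv.weakDeriv_eq {a : X} {f g : L2 X}
    (h : IsWeakDeriv a f g) : weakDeriv a f = g := by
  have hex : ∃ g, IsWeakDeriv a f g := ⟨g, h⟩
  rw [weakDeriv, dif_pos hex]
  exact hex.choose_spec.unique h

/-- The Hilbert space containing the form domains, with the components described at
`formSubmodule`. -/
abbrev FormVec (ι X : Type*) [MeasureSpace X] : Type _ :=
  PiLp 2 fun _ : Option (Option ι) => L2 X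

variable {ι : Type*}

/-- The form domain of `-κ ∑ᵢ ∂²/∂bᵢ² + W` as a Hilbert space: the vectors
`(f, (W + B)^{1/2} f, √κ ∂f/∂bᵢ)`, whose first component is indexed by `none`, the second by
`some none`. -/
def formSubmodule (κ : ℝ) (b : ι → X) (B : ℝ) (W : X → EReal) :
    Submodule ℂ (FormVec ι X) where
  carrier := {h | (∀ i, IsWeakDeriv (b i) ((√κ : ℂ) • h none) (h (some (some i)))) ∧
    (∀ᵐ x, W x = ⊤ → h none x = 0) ∧
    h (some none) =ᵐ[volume] fun x => (potRoot B W x : ℂ) * h none x}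
  zero_mem' := by
    refine ⟨fun i => ?_, ?_, ?_⟩
    · simpa using isWeakDeriv_zero (b i)
    · filter_upwards [Lp.coeFn_zero ℂ 2 (volume : Measure X)] with x hx _
      exact hx
    · filter_upwards [Lp.coeFn_zero ℂ 2 (volume : Measure X)] with x hx
      simp only [PiLp.zero_apply]
      rw [hx]
      simp
  add_mem' := by
    rintro h h' ⟨h1, h2, h3⟩ ⟨h1', h2', h3'⟩
    refine ⟨fun i => ?_, ?_, ?_⟩
    · simpa using (h1 i).add (h1' i)
    · filter_upwards [h2, h2', Lp.coeFn_add (h none) (h' none)] with x hx hx' ha hW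
      simp only [PiLp.add_apply]
      rw [ha, Pi.add_apply, hx hW, hx' hW, add_zero]
    · filter_upwards [h3, h3', Lp.coeFn_add (h none) (h' none),
        Lp.coeFn_add (h (some none)) (h' (some none))] with x hx hx' ha ha'
      simp only [PiLp.add_apply]
      rw [ha, ha', Pi.add_apply, Pi.add_apply, hx, hx', mul_add]
  smul_mem' := by
    rintro c h ⟨h1, h2, h3⟩
    refine ⟨fun i => ?_, ?_, ?_⟩
    · have := (h1 i).smul c
      rw [smul_comm] at this
      simpa using this
    · filter_upwards [h2, Lp.coeFn_smul c (h none)] with x hx ha hW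
      simp only [PiLp.smul_apply]
      rw [ha, Pi.smul_apply, hx hW, smul_zero]
    · filter_upwards [h3, Lp.coeFn_smul c (h none), Lp.coeFn_smul c (h (some none))]
        with x hx ha ha'
      simp only [PiLp.smul_apply]
      rw [ha, ha', Pi.smul_apply, Pi.smul_apply, hx, smul_eq_mul, smul_eq_mul, mul_left_comm]

theorem isClosed_formSubmodule [Fintype ι] (κ : ℝ) (b : ι → X) (B : ℝ) (W : X → EReal) :
    IsClosed (formSubmodule κ b B W : Set (FormVec ι X)) := by
  have hcont : ∀ o, Continuous fun h : FormVec ι X => h o :=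
    fun o => PiLp.continuous_apply 2 _ o
  refine IsClosed.inter (s₁ := {h : FormVec ι X | ∀ i, IsWeakDeriv (b i) ((√κ : ℂ) • h none) (h (some (some i)))})
    (s₂ := {h : FormVec ι X | (∀ᵐ x, W x = ⊤ → h none x = 0) ∧
      h (some none) =ᵐ[volume] fun x => (potRoot B W x : ℂ) * h none x}) ?_ ?_
  · rw [Set.ofPred_forall]
    exact isClosed_iInter fun i =>
      isClosed_isWeakDeriv _ ((hcont none).const_smul (√κ : ℂ)) (hcont _)
  · refine IsSeqClosed.isClosed fun u h hu hlim => ?_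
    obtain ⟨ns, hns, h1⟩ := exists_seq_tendsto_ae_of_tendsto (((hcont none).tendsto h).comp hlim)
    obtain ⟨ms, hms, h2⟩ := exists_seq_tendsto_ae_of_tendsto
      (((hcont (some none)).tendsto h).comp (hlim.comp hns.tendsto_atTop))
    constructor
    · filter_upwards [h1, ae_all_iff.mpr fun k => (hu k).1] with x hx hk hW
      refine tendsto_nhds_unique hx (tendsto_const_nhds.congr fun k => ?_)
      exact (hk (ns k) hW).symm
    · filter_upwards [h1, h2, ae_all_iff.mpr fun k => (hu k).2] with x hx hx2 hk
      refine tendsto_nhds_unique hx2 ?_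
      refine ((hx.comp hms.tendsto_atTop).const_mul (potRoot B W x : ℂ)).congr fun k => ?_
      exact (hk (ns (ms k))).symm

theorem mem_formDomain_iff {κ : ℝ} (hκ : 0 < κ) (b : ι → X) {B : ℝ} (hB : 0 ≤ B) {W : X → EReal}
    (hWm : AEMeasurable W) (hW : ∀ x, ((-B : ℝ) : EReal) ≤ W x) (f : L2 X) :
    f ∈ formDomain b W ↔ ∃ h ∈ formSubmodule κ b B W, h none = f := by
  have hκ' : (√κ : ℂ) ≠ 0 := by exact_mod_cast (Real.sqrt_pos.mpr hκ).ne'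
  constructor
  · rintro ⟨h1, h2⟩
    rw [lintegral_potential_lt_top_iff hB hWm hW] at h2
    choose g hg using h1
    refine ⟨WithLp.toLp 2 fun o => match o with
      | none => f
      | some none => h2.2.toLp
      | some (some i) => (√κ : ℂ) • g i, ⟨fun i => ?_, h2.1, ?_⟩, rfl⟩
    · exact (hg i).smul _
    · exact h2.2.coeFn_toLp
  · rintro ⟨h, ⟨h1, h2, h3⟩, rfl⟩
    refine ⟨fun i => ⟨(√κ : ℂ)⁻¹ • h (some (some i)), ?_⟩, ?_⟩
    · have := (h1 i).smul (√κ : ℂ)⁻¹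
      rwa [smul_smul, inv_mul_cancel₀ hκ', one_smul] at this
    · rw [lintegral_potential_lt_top_iff hB hWm hW]
      exact ⟨h2, (memLp_congr_ae h3).mp (Lp.memLp _)⟩

theorem smul_weakDeriv_of_mem_formSubmodule {κ : ℝ} (hκ : 0 < κ) {b : ι → X} {B : ℝ}
    {W : X → EReal} {h : FormVec ι X}
    (hh : h ∈ formSubmodule κ b B W) (i : ι) :
    h (some (some i)) = (√κ : ℂ) • weakDeriv (b i) (h none) := by
  have hκ' : (√κ : ℂ) ≠ 0 := by exact_mod_cast (Real.sqrt_pos.mpr hκ).ne'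
  have := (hh.1 i).smul (√κ : ℂ)⁻¹
  rw [smul_smul, inv_mul_cancel₀ hκ', one_smul] at this
  rw [this.weakDeriv_eq, smul_smul, mul_inv_cancel₀ hκ', one_smul]

/-- The inner product of the Hilbert space `formSubmodule κ b B W` is the Schrödinger form shifted
by `B + 1`. -/
theorem schrodingerForm_add [Fintype ι] {κ : ℝ} (hκ : 0 < κ) {b : ι → X} {B : ℝ} (hB : 0 ≤ B)
    {W : X → EReal} (hW : ∀ x, ((-B : ℝ) : EReal) ≤ W x)
    {h h' : FormVec ι X} (hh : h ∈ formSubmodule κ b B W)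
    (hh' : h' ∈ formSubmodule κ b B W) :
    schrodingerForm κ b W (h none) (h' none) + ((B + 1 : ℝ) : ℂ) * inner ℂ (h none) (h' none) =
      inner ℂ h h' := by
  rw [PiLp.inner_apply, Fintype.sum_option, Fintype.sum_option, ← integral_potential hB hW hh.2.2
    hh'.2.2, schrodingerForm, Finset.mul_sum]
  simp_rw [smul_weakDeriv_of_mem_formSubmodule hκ hh, smul_weakDeriv_of_mem_formSubmodule hκ hh',
    inner_smul_left, inner_smul_right, Complex.conj_ofReal]
  have : ∀ z : ℂ, (√κ : ℂ) * ((√κ : ℂ) * z) = κ * z := fun z => by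
    rw [← mul_assoc, ← Complex.ofReal_mul, Real.mul_self_sqrt hκ.le]
  simp_rw [this]
  push_cast
  ring

end Forms

/-! ### Boundedness of functions with a weak derivative -/

section Sobolev

/-- For a function with a square-integrable weak derivative, local averages are bounded uniformly:
the difference of an average `ρ` and a fixed one is the derivative of a test function. -/
theorem IsWeakDeriv.exists_bound_average {f f' : L2 ℝ} (h : IsWeakDeriv (1 : ℝ) f f') :
    ∃ M : ℝ, ∀ (x : ℝ) (ρ : ℝ → ℝ), ContDiff ℝ ∞ ρ → (∀ s, 0 ≤ ρ s) → ∫ s, ρ s = 1 →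
      (∀ s, 1 < |s - x| → ρ s = 0) → ‖∫ s, (ρ s : ℂ) * f s‖ ≤ M := by
  let σ : ContDiffBump (0 : ℝ) := ⟨1 / 2, 1, by norm_num, by norm_num⟩
  set σ₀ : ℝ → ℝ := σ.normed volume with hσ₀
  have hσc : ContDiff ℝ ∞ σ₀ := σ.contDiff_normed
  have hσs : HasCompactSupport σ₀ := σ.hasCompactSupport_normed
  have hσ0 : ∀ s, 0 ≤ σ₀ s := fun s => σ.nonneg_normed s
  have hσ1 : ∫ s, σ₀ s = 1 := σ.integral_normed
  have hσz : ∀ s, 1 < |s| → σ₀ s = 0 := by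
    intro s hs
    have : s ∉ Function.support σ₀ := by
      rw [hσ₀, σ.support_normed_eq, Metric.mem_ball, dist_zero_right, Real.norm_eq_abs]
      exact not_lt.mpr hs.le
    simpa using this
  refine ⟨‖testL2 hσc.continuous hσs‖ * ‖f‖ + 4 * ‖f'‖, fun x ρ hρ hρ0 hρ1 hρz => ?_⟩
  have hshift : ContDiff ℝ ∞ fun s => σ₀ (s - x) := hσc.comp (contDiff_id.sub contDiff_const)
  have hshift1 : ∫ s, σ₀ (s - x) = 1 := by rw [integral_sub_right_eq_self σ₀ x, hσ1]
  have hzero_cs : ∀ g : ℝ → ℝ, (∀ s, 2 < |s - x| → g s = 0) → HasCompactSupport g := by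
    intro g hg
    refine HasCompactSupport.intro (isCompact_closedBall x 2) fun s hs => hg s ?_
    rwa [Metric.mem_closedBall, Real.dist_eq, not_le] at hs
  have hρs : HasCompactSupport ρ := hzero_cs ρ fun s hs => hρz s (by linarith)
  have hss : HasCompactSupport fun s => σ₀ (s - x) := hzero_cs _ fun s hs => hσz _ (by linarith)
  have hρi := hρ.continuous.integrable_of_hasCompactSupport hρs (μ := volume)
  have hsi := hshift.continuous.integrable_of_hasCompactSupport hss (μ := volume)
  set θ : ℝ → ℝ := fun s => ρ s - σ₀ (s - x) with hθ
  have hθc : ContDiff ℝ ∞ θ := hρ.sub hshift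
  have hθi : Integrable θ := hρi.sub hsi
  have hθz : ∀ s, 1 < |s - x| → θ s = 0 := fun s hs => by
    simp only [hθ, hρz s hs, hσz _ hs, sub_zero]
  have hθ0 : ∫ s, θ s = 0 := by
    rw [hθ, integral_sub hρi hsi, hρ1, hshift1, sub_self]
  -- `θ` has mean zero, so that its primitive has compact support
  set η : ℝ → ℝ := fun s => ∫ t in (x - 2)..s, θ t with hη
  have hηd : ∀ s, HasDerivAt η (θ s) s := fun s =>
    hθc.continuous.integral_hasStrictDerivAt (x - 2) s |>.hasDerivAt
  have hηc : ContDiff ℝ ∞ η := by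
    rw [contDiff_infty_iff_deriv]
    refine ⟨fun s => (hηd s).differentiableAt, ?_⟩
    have : deriv η = θ := funext fun s => (hηd s).deriv
    rwa [this]
  have hηz : ∀ s, 2 < |s - x| → η s = 0 := by
    intro s hs
    rcases lt_or_ge s x with hsx | hsx
    · rw [abs_of_neg (by linarith)] at hs
      refine intervalIntegral.integral_zero_ae (ae_of_all _ fun t ht => hθz t ?_)
      rw [Set.uIoc_of_ge (by linarith)] at ht
      rw [abs_of_neg (by linarith [ht.2])]
      linarith [ht.2]
    · rw [abs_of_nonneg (by linarith)] at hs
      have : Function.support θ ⊆ Set.Ioc (x - 2) s := by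
        intro t ht
        have ht' : |t - x| ≤ 1 := by
          by_contra hcon
          exact ht (hθz t (not_le.mp hcon))
        rw [abs_le] at ht'
        exact ⟨by linarith [ht'.1], by linarith [ht'.2]⟩
      rw [hη]
      simp only
      rw [intervalIntegral.integral_eq_integral_of_support_subset this, hθ0]
  have hηb : ∀ s, |η s| ≤ 2 := by
    intro s
    calc |η s| = ‖∫ t in (x - 2)..s, θ t‖ := rfl
      _ ≤ ∫ t in Set.uIoc (x - 2) s, ‖θ t‖ :=
          intervalIntegral.norm_integral_le_integral_norm_uIoc
      _ ≤ ∫ t, ‖θ t‖ :=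
          setIntegral_le_integral hθi.norm (ae_of_all _ fun t => norm_nonneg _)
      _ ≤ ∫ t, (ρ t + σ₀ (t - x)) := by
          refine integral_mono hθi.norm (hρi.add hsi) fun t => ?_
          refine (norm_sub_le _ _).trans_eq ?_
          rw [Real.norm_of_nonneg (hρ0 t), Real.norm_of_nonneg (hσ0 _)]
      _ = 2 := by
          rw [integral_add hρi hsi, hρ1, hshift1]
          norm_num
  have hηs : HasCompactSupport η := hzero_cs η hηz
  have hηn : ‖testL2 hηc.continuous hηs‖ ≤ 4 := by
    have h1 : ‖testL2 hηc.continuous hηs‖ ^ 2 ≤ 16 := by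
      rw [L2_norm_sq]
      calc ∫ s, ‖testL2 hηc.continuous hηs s‖ ^ 2
          ≤ ∫ s, (Metric.closedBall x 2).indicator (fun _ => (4 : ℝ)) s := by
            refine integral_mono_ae ?_ ?_ ?_
            · exact (memLp_two_iff_integrable_sq_norm (Lp.aestronglyMeasurable _)).mp (Lp.memLp _)
            · exact (integrable_indicator_iff Metric.isClosed_closedBall.measurableSet).mpr
                (integrableOn_const measure_closedBall_lt_top.ne)
            · filter_upwards [coeFn_testL2 hηc.continuous hηs] with s hs
              rw [hs, Complex.norm_real, Real.norm_eq_abs]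
              by_cases hm : s ∈ Metric.closedBall x 2
              · rw [Set.indicator_of_mem hm]
                nlinarith [hηb s, abs_nonneg (η s)]
              · rw [Set.indicator_of_notMem hm, hηz s (by
                  rwa [Metric.mem_closedBall, Real.dist_eq, not_le] at hm)]
                simp
        _ = 16 := by
            rw [integral_indicator Metric.isClosed_closedBall.measurableSet, setIntegral_const,
              Real.closedBall_eq_Icc, measureReal_def, Real.volume_Icc]
            rw [ENNReal.toReal_ofReal (by linarith), smul_eq_mul]
            ring
    nlinarith [norm_nonneg (testL2 hηc.continuous hηs)]
  have hmain : ∫ s, (ρ s : ℂ) * f s =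
      (∫ s, ((σ₀ (s - x) : ℝ) : ℂ) * f s) - ∫ s, (η s : ℂ) * f' s := by
    have h1 := h η hηc hηs
    have h2 : ∀ s, fderiv ℝ η s 1 = ρ s - σ₀ (s - x) := fun s => by
      rw [fderiv_apply_one_eq_deriv, (hηd s).deriv]
    simp_rw [h2] at h1
    have hint : ∀ g : ℝ → ℝ, Continuous g → HasCompactSupport g →
        Integrable fun s => (g s : ℂ) * f s := fun g hg hgs => by
      have := (L2_locallyIntegrable f).integrable_smul_left_of_hasCompactSupport hg hgs
      simpa [Complex.real_smul] using this
    have h3 : ∫ s, ((ρ s - σ₀ (s - x) : ℝ) : ℂ) * f s =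
        (∫ s, (ρ s : ℂ) * f s) - ∫ s, ((σ₀ (s - x) : ℝ) : ℂ) * f s := by
      rw [← integral_sub (hint ρ hρ.continuous hρs) (hint _ hshift.continuous hss)]
      refine integral_congr_ae (ae_of_all _ fun s => ?_)
      simp only
      push_cast
      ring
    rw [h3] at h1
    linear_combination h1
  have hsn : ‖testL2 hshift.continuous hss‖ = ‖testL2 hσc.continuous hσs‖ := by
    have h1 : ‖testL2 hshift.continuous hss‖ ^ 2 = ‖testL2 hσc.continuous hσs‖ ^ 2 := by
      rw [L2_norm_sq, L2_norm_sq,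
        ← integral_sub_right_eq_self (fun s => ‖testL2 hσc.continuous hσs s‖ ^ 2) x]
      refine integral_congr_ae ?_
      filter_upwards [coeFn_testL2 hshift.continuous hss,
        (measurePreserving_sub_right volume x).quasiMeasurePreserving.ae
          (coeFn_testL2 hσc.continuous hσs)] with s h1 h2
      rw [h1, h2]
    exact (pow_left_inj₀ (norm_nonneg _) (norm_nonneg _) two_ne_zero).mp h1
  rw [hmain, ← inner_testL2 hshift.continuous hss, ← inner_testL2 hηc.continuous hηs]
  refine (norm_sub_le _ _).trans (add_le_add ?_ ?_)
  · exact (norm_inner_le_norm _ _).trans_eq (by rw [hsn])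
  · exact (norm_inner_le_norm _ _).trans (mul_le_mul_of_nonneg_right hηn (norm_nonneg _))

/-- The one-dimensional Sobolev inequality `H¹(ℝ) ⊆ L^∞(ℝ)`. -/
theorem IsWeakDeriv.exists_ae_bound {f f' : L2 ℝ} (h : IsWeakDeriv (1 : ℝ) f f') :
    ∃ M : ℝ, ∀ᵐ x, ‖f x‖ ≤ M := by
  obtain ⟨M, hM⟩ := h.exists_bound_average
  let ρ : ℕ → ContDiffBump (0 : ℝ) := fun n =>
    ⟨1 / 2 * (1 / ((n : ℝ) + 1)), 1 / ((n : ℝ) + 1), by positivity, by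
      have : (0 : ℝ) < 1 / ((n : ℝ) + 1) := by positivity
      linarith⟩
  have hlim : Tendsto (fun n => (ρ n).rOut) atTop (𝓝 0) := tendsto_one_div_add_atTop_nhds_zero_nat
  have hae := ContDiffBump.ae_convolution_tendsto_right_of_locallyIntegrable (K := 2) hlim
    (Eventually.of_forall fun n => by
      change 1 / ((n : ℝ) + 1) ≤ 2 * (1 / 2 * (1 / ((n : ℝ) + 1)))
      linarith) (L2_locallyIntegrable f)
  refine ⟨M, ?_⟩
  filter_upwards [hae] with x hx
  refine le_of_tendsto hx.norm (Eventually.of_forall fun n => ?_)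
  rw [convolution_eq_swap]
  have h1 := hM x (fun s => (ρ n).normed volume (x - s))
    ((ρ n).contDiff_normed.comp (contDiff_const.sub contDiff_id))
    (fun s => (ρ n).nonneg_normed _)
    (by rw [integral_sub_left_eq_self ((ρ n).normed volume) volume x, (ρ n).integral_normed])
    (fun s hs => by
      have : x - s ∉ Function.support ((ρ n).normed volume) := by
        rw [(ρ n).support_normed_eq, Metric.mem_ball, dist_zero_right, Real.norm_eq_abs, abs_sub_comm]
        have : (ρ n).rOut ≤ 1 := by
          change 1 / ((n : ℝ) + 1) ≤ 1
          rw [div_le_one (by positivity)]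
          linarith [Nat.cast_nonneg (α := ℝ) n]
        linarith
      simpa using this)
  simpa [Complex.real_smul] using h1

end Sobolev

/-! ### Weak derivatives and tensor products -/

section Slices

variable {n : ℕ}

theorem insertNth_eq_add_smul (i : Fin (n + 1)) (t : ℝ) (y : Fin n → ℝ) :
    (i.insertNth t y : Fin (n + 1) → ℝ) = i.insertNth 0 y + t • coordDir (n + 1) i := by
  ext k
  refine Fin.succAboveCases i ?_ (fun k => ?_) k
  · simp [coordDir]
  · simp [coordDir, Fin.succAbove_ne]

theorem contDiff_insertNth (i : Fin (n + 1)) (y : Fin n → ℝ) :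
    ContDiff ℝ ∞ fun t : ℝ => (i.insertNth t y : Fin (n + 1) → ℝ) := by
  rw [funext fun t => insertNth_eq_add_smul i t y]
  exact contDiff_const.add (contDiff_id.smul contDiff_const)

theorem fderiv_slice {η : (Fin (n + 1) → ℝ) → ℝ} (hη : ContDiff ℝ ∞ η) (i : Fin (n + 1))
    (y : Fin n → ℝ) (t : ℝ) :
    fderiv ℝ (fun t => η (i.insertNth t y)) t 1 =
      fderiv ℝ η (i.insertNth t y) (coordDir (n + 1) i) := by
  rw [fderiv_apply_one_eq_deriv]
  have h1 : HasDerivAt (fun t : ℝ => (i.insertNth t y : Fin (n + 1) → ℝ)) (coordDir (n + 1) i) t := by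
    rw [funext fun t => insertNth_eq_add_smul i t y]
    simpa using ((hasDerivAt_id t).smul_const (coordDir (n + 1) i)).const_add (i.insertNth 0 y)
  exact ((hη.differentiable (by simp)).differentiableAt.hasFDerivAt.comp_hasDerivAt t h1).deriv

theorem hasCompactSupport_slice {η : (Fin (n + 1) → ℝ) → ℝ} (hη : HasCompactSupport η)
    (i : Fin (n + 1)) (y : Fin n → ℝ) : HasCompactSupport fun t => η (i.insertNth t y) := by
  refine hη.comp_isClosedEmbedding (g := fun t : ℝ => (i.insertNth t y : Fin (n + 1) → ℝ)) ?_
  exact Function.LeftInverse.isClosedEmbedding (f := fun x : Fin (n + 1) → ℝ => x i)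
    (fun t => by simp) (continuous_apply i) (contDiff_insertNth i y).continuous

/-- Fubini's theorem for the pairing of a function of `n + 1` variables with a product. -/
theorem integral_mul_tens (i : Fin (n + 1)) {η : (Fin (n + 1) → ℝ) → ℝ} (hc : Continuous η)
    (hs : HasCompactSupport η) (f : L2 ℝ) (g : L2 (Fin n → ℝ)) :
    ∫ x, (η x : ℂ) * tens i f g x = ∫ y, g y * ∫ t, (η (i.insertNth t y) : ℂ) * f t := by
  have hint : Integrable fun p : ℝ × (Fin n → ℝ) =>
      (η (i.insertNth p.1 p.2) : ℂ) * (f p.1 * g p.2) := by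
    have h1 : MemLp (fun x => (η x : ℂ)) 2 :=
      (Complex.continuous_ofReal.comp hc).memLp_of_hasCompactSupport
        (hs.comp_left (g := ((↑) : ℝ → ℂ)) Complex.ofReal_zero)
    exact MemLp.integrable_mul (p := 2) (q := 2)
      (h1.comp_measurePreserving (measurePreserving_insertNth i))
      (memLp_mul_prod (Lp.memLp f) (Lp.memLp g))
  rw [integral_insertNth i]
  have h2 : ∫ p : ℝ × (Fin n → ℝ), (η (i.insertNth p.1 p.2) : ℂ) * tens i f g (i.insertNth p.1 p.2)
      = ∫ p : ℝ × (Fin n → ℝ), (η (i.insertNth p.1 p.2) : ℂ) * (f p.1 * g p.2) := by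
    refine integral_congr_ae ?_
    filter_upwards [ae_insertNth i (coeFn_tens i f g)] with p hp
    rw [hp, Fin.insertNth_apply_same, Fin.removeNth_insertNth]
  rw [h2, Measure.volume_eq_prod, integral_prod_symm _ hint]
  refine integral_congr_ae (ae_of_all _ fun y => ?_)
  simp only
  rw [← integral_const_mul]
  refine integral_congr_ae (ae_of_all _ fun t => ?_)
  simp only
  ring

theorem IsWeakDeriv.tens {f f' : L2 ℝ} (h : IsWeakDeriv (1 : ℝ) f f') (i : Fin (n + 1))
    (g : L2 (Fin n → ℝ)) : IsWeakDeriv (coordDir (n + 1) i) (tens i f g) (tens i f' g) := by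
  intro η hη hs
  rw [integral_mul_tens i (continuous_fderiv_apply_of_contDiff hη _) (hs.fderiv_apply ℝ _),
    integral_mul_tens i hη.continuous hs, ← integral_neg]
  refine integral_congr_ae (ae_of_all _ fun y => ?_)
  have h1 := h (fun t => η (i.insertNth t y)) (hη.comp (contDiff_insertNth i y))
    (hasCompactSupport_slice hs i y)
  simp only
  simp_rw [← fderiv_slice hη i y]
  rw [h1, mul_neg]

section ProductTest

variable {η : ℝ → ℝ} {ρ : (Fin n → ℝ) → ℝ}

theorem contDiff_removeNth (i : Fin (n + 1)) :
    ContDiff ℝ ∞ fun x : Fin (n + 1) → ℝ => (i.removeNth x : Fin n → ℝ) :=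
  contDiff_pi.mpr fun k => contDiff_apply ℝ ℝ (i.succAbove k)

theorem contDiff_product (hη : ContDiff ℝ ∞ η) (hρ : ContDiff ℝ ∞ ρ) (i : Fin (n + 1)) :
    ContDiff ℝ ∞ fun x : Fin (n + 1) → ℝ => η (x i) * ρ (i.removeNth x) :=
  (hη.comp (contDiff_apply ℝ ℝ i)).mul (hρ.comp (contDiff_removeNth i))

theorem hasCompactSupport_product (hη : HasCompactSupport η) (hρ : HasCompactSupport ρ)
    (i : Fin (n + 1)) :
    HasCompactSupport fun x : Fin (n + 1) → ℝ => η (x i) * ρ (i.removeNth x) := by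
  have hK : IsCompact ((fun p : ℝ × (Fin n → ℝ) => (i.insertNth p.1 p.2 : Fin (n + 1) → ℝ)) ''
      (tsupport η ×ˢ tsupport ρ)) :=
    (hη.isCompact.prod hρ.isCompact).image (Continuous.finInsertNth (A := fun _ => ℝ) i continuous_fst continuous_snd)
  refine HasCompactSupport.intro hK fun x hx => ?_
  by_contra h0
  refine hx ⟨(x i, i.removeNth x), ⟨?_, ?_⟩, ?_⟩
  · exact subset_tsupport _ (left_ne_zero_of_mul h0)
  · exact subset_tsupport _ (right_ne_zero_of_mul h0)
  · simp

theorem fderiv_product (hη : ContDiff ℝ ∞ η) (hρ : ContDiff ℝ ∞ ρ) (i : Fin (n + 1))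
    (x : Fin (n + 1) → ℝ) :
    fderiv ℝ (fun x : Fin (n + 1) → ℝ => η (x i) * ρ (i.removeNth x)) x (coordDir (n + 1) i) =
      fderiv ℝ η (x i) 1 * ρ (i.removeNth x) := by
  have h := fderiv_slice (contDiff_product hη hρ i) i (i.removeNth x) (x i)
  simp only [Fin.insertNth_apply_same, Fin.removeNth_insertNth, Fin.insertNth_self_removeNth] at h
  rw [← h, fderiv_apply_one_eq_deriv, fderiv_apply_one_eq_deriv]
  exact ((hη.differentiable (by simp) (x i)).hasDerivAt.mul_const _).deriv

end ProductTest

/-- Partial inner products commute with weak derivatives in the remaining variable. -/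
theorem IsWeakDeriv.contrR {i : Fin (n + 1)} {ψ dψ : L2 (Fin (n + 1) → ℝ)}
    (h : IsWeakDeriv (coordDir (n + 1) i) ψ dψ) (g : L2 (Fin n → ℝ)) :
    IsWeakDeriv (1 : ℝ) (contrR i g ψ) (contrR i g dψ) := by
  rw [isWeakDeriv_iff]
  intro η hη hs
  set e := testL2 hη.continuous hs with he
  set e' := testL2 (continuous_fderiv_apply_of_contDiff hη (1 : ℝ)) (hs.fderiv_apply ℝ (1 : ℝ))
    with he'
  rw [inner_contrR, inner_contrR, ← inner_contrL, ← inner_contrL, ← add_eq_zero_iff_eq_neg,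
    ← inner_add_right]
  -- By the fundamental lemma of the calculus of variations the partial inner products with the
  -- test function vanish identically, so that `g` need not be smooth.
  suffices hk : contrL i e' ψ + contrL i e dψ = 0 by rw [hk, inner_zero_right]
  refine Lp.ext ?_
  have hz : ∀ᵐ y, (contrL i e' ψ + contrL i e dψ) y = 0 := by
    refine ae_eq_zero_of_integral_contDiff_smul_eq_zero (L2_locallyIntegrable _) fun ρ hρ hρs => ?_
    have h1 : ∫ y, ρ y • (contrL i e' ψ + contrL i e dψ) y =
        inner ℂ (testL2 hρ.continuous hρs) (contrL i e' ψ + contrL i e dψ) := by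
      rw [inner_testL2]
      simp_rw [Complex.real_smul]
    have h2 := isWeakDeriv_iff.mp h _ (contDiff_product hη hρ i) (hasCompactSupport_product hs hρs i)
    have h3 : testL2 (contDiff_product hη hρ i).continuous (hasCompactSupport_product hs hρs i) =
        _root_.tens i e (testL2 hρ.continuous hρs) := by
      refine Lp.ext ?_
      filter_upwards [coeFn_testL2 (contDiff_product hη hρ i).continuous
        (hasCompactSupport_product hs hρs i), coeFn_tens i e (testL2 hρ.continuous hρs),
        (quasiMeasurePreserving_eval i).ae (coeFn_testL2 hη.continuous hs),
        (quasiMeasurePreserving_removeNth i).ae (coeFn_testL2 hρ.continuous hρs)] with x h1 h2 h3 h4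
      rw [h1, h2, h3, h4]
      push_cast
      rfl
    have h4 : testL2 (continuous_fderiv_apply_of_contDiff (contDiff_product hη hρ i)
        (coordDir (n + 1) i)) ((hasCompactSupport_product hs hρs i).fderiv_apply ℝ _) =
        _root_.tens i e' (testL2 hρ.continuous hρs) := by
      refine Lp.ext ?_
      filter_upwards [coeFn_testL2 (continuous_fderiv_apply_of_contDiff (contDiff_product hη hρ i)
        (coordDir (n + 1) i)) ((hasCompactSupport_product hs hρs i).fderiv_apply ℝ _),
        coeFn_tens i e' (testL2 hρ.continuous hρs),
        (quasiMeasurePreserving_eval i).ae (coeFn_testL2 (continuous_fderiv_apply_of_contDiff hη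
          (1 : ℝ)) (hs.fderiv_apply ℝ (1 : ℝ))),
        (quasiMeasurePreserving_removeNth i).ae (coeFn_testL2 hρ.continuous hρs)] with x h1 h2 h3 h4
      rw [h1, h2, h3, h4, fderiv_product hη hρ]
      push_cast
      rfl
    rw [h1, inner_add_right, inner_contrL, inner_contrL, ← h3, ← h4, h2, neg_add_cancel]
  filter_upwards [hz, Lp.coeFn_zero ℂ 2 (volume : Measure (Fin n → ℝ))] with y h1 h2
  rw [h1, h2]
  rfl

/-- Partial inner products map the form domain of the `i`-th one-particle Hamiltonian into that of
the one-particle Hamiltonian. -/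
theorem contrR_mem_formSubmodule {i : Fin (n + 1)} {κ B : ℝ} {V : ℝ → EReal}
    {ψ dψ a : L2 (Fin (n + 1) → ℝ)}
    (hd : IsWeakDeriv (coordDir (n + 1) i) ((√κ : ℂ) • ψ) dψ) (hV : ∀ᵐ x, V (x i) = ⊤ → ψ x = 0)
    (ha : a =ᵐ[volume] fun x => (potRoot B V (x i) : ℂ) * ψ x) (g : L2 (Fin n → ℝ)) :
    (WithLp.toLp 2 fun o : Option (Option Unit) => match o with
      | none => contrR i g ψ
      | some none => contrR i g a
      | some (some _) => contrR i g dψ : FormVec Unit ℝ) ∈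
      formSubmodule κ (fun _ : Unit => (1 : ℝ)) B V := by
  refine ⟨fun _ => ?_, ?_, ?_⟩
  · have := hd.contrR g
    rwa [map_smul] at this
  · have h1 := Measure.ae_ae_of_ae_prod (ae_insertNth i hV)
    filter_upwards [coeFn_contrR i g ψ, h1] with t h2 h3 hVt
    rw [h2]
    refine integral_eq_zero_of_ae ?_
    filter_upwards [h3] with y hy
    rw [hy (by simpa using hVt)]
    simp
  · have h1 := Measure.ae_ae_of_ae_prod (ae_insertNth i ha)
    filter_upwards [coeFn_contrR i g ψ, coeFn_contrR i g a, h1] with t h2 h3 h4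
    rw [h2, h3, ← integral_const_mul]
    refine integral_congr_ae ?_
    filter_upwards [h4] with y hy
    rw [hy, Fin.insertNth_apply_same]
    ring

end Slices

/-! ### The many-particle potential -/

section Potential

theorem ereal_coe_sum {ι : Type*} (s : Finset ι) (f : ι → ℝ) :
    ((∑ i ∈ s, f i : ℝ) : EReal) = ∑ i ∈ s, (f i : EReal) := by
  classical
  induction s using Finset.induction_on with
  | empty => simp
  | insert i s hi ih => rw [Finset.sum_insert hi, Finset.sum_insert hi, EReal.coe_add, ih]

theorem ereal_sum_ne_bot {ι : Type*} (s : Finset ι) {f : ι → EReal} (hf : ∀ i ∈ s, f i ≠ ⊥) :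
    ∑ i ∈ s, f i ≠ ⊥ := by
  classical
  induction s using Finset.induction_on with
  | empty => simp
  | insert i s hi ih =>
    rw [Finset.sum_insert hi]
    exact EReal.add_ne_bot_iff.mpr ⟨hf i (Finset.mem_insert_self i s),
      ih fun j hj => hf j (Finset.mem_insert_of_mem hj)⟩

/-- The interaction energy `∑_{i<j} u(xᵢ - xⱼ)`. -/
noncomputable def pairEnergy (N : ℕ) (u : ℝ → ℝ) (x : Fin N → ℝ) : ℝ :=
  ∑ i, ∑ j ∈ Finset.Ioi i, u (x i - x j)

theorem totalPotential_eq (N : ℕ) (V : ℝ → EReal) (u : ℝ → ℝ) (x : Fin N → ℝ) :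
    totalPotential N V u x = ∑ i, V (x i) + (pairEnergy N u x : EReal) := by
  rw [totalPotential, pairEnergy, ereal_coe_sum]
  simp_rw [ereal_coe_sum]

variable {B b : ℝ} {V : ℝ → EReal} {u : ℝ → ℝ}

theorem ne_bot_of_bound (hV : ∀ x, ((-B : ℝ) : EReal) ≤ V x) (x : ℝ) : V x ≠ ⊥ := fun h => by
  have := hV x
  rw [h, le_bot_iff] at this
  exact EReal.coe_ne_bot _ this

theorem totalPotential_of_ne_top (hV : ∀ x, ((-B : ℝ) : EReal) ≤ V x) {N : ℕ} {x : Fin N → ℝ}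
    (hx : ∀ i, V (x i) ≠ ⊤) :
    totalPotential N V u x = ((∑ i, (V (x i)).toReal + pairEnergy N u x : ℝ) : EReal) := by
  rw [totalPotential_eq, EReal.coe_add, ereal_coe_sum]
  simp_rw [EReal.coe_toReal (hx _) (ne_bot_of_bound hV _)]

theorem totalPotential_eq_top_iff (hV : ∀ x, ((-B : ℝ) : EReal) ≤ V x) {N : ℕ} {x : Fin N → ℝ} :
    totalPotential N V u x = ⊤ ↔ ∃ i, V (x i) = ⊤ := by
  constructor
  · intro h
    by_contra! hx
    rw [totalPotential_of_ne_top hV hx] at h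
    exact EReal.coe_ne_top _ h
  · rintro ⟨i, hi⟩
    rw [totalPotential_eq, ← Finset.add_sum_erase _ _ (Finset.mem_univ i), hi,
      EReal.top_add_of_ne_bot (ereal_sum_ne_bot _ fun j _ => ne_bot_of_bound hV _),
      EReal.top_add_coe]

theorem sum_sum_Ioi_le {N : ℕ} {c : Fin N → Fin N → ℝ} {C : ℝ} (hC : 0 ≤ C)
    (hc : ∀ i j, i ≠ j → c i j ≤ C) : ∑ i, ∑ j ∈ Finset.Ioi i, c i j ≤ (N : ℝ) ^ 2 * C := by
  calc ∑ i, ∑ j ∈ Finset.Ioi i, c i j ≤ ∑ i : Fin N, ∑ j ∈ Finset.Ioi i, C :=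
        Finset.sum_le_sum fun i _ => Finset.sum_le_sum fun j hj =>
          hc i j (Finset.mem_Ioi.mp hj).ne
    _ ≤ ∑ i : Fin N, ∑ j : Fin N, C :=
        Finset.sum_le_sum fun i _ => Finset.sum_le_sum_of_subset_of_nonneg
          (Finset.subset_univ _) fun _ _ _ => hC
    _ = (N : ℝ) ^ 2 * C := by
        simp
        ring

theorem neg_le_pairEnergy (hb : 0 ≤ b) (hu : ∀ x, -b ≤ u x) (N : ℕ) (x : Fin N → ℝ) :
    -((N : ℝ) ^ 2 * b) ≤ pairEnergy N u x := by
  have := sum_sum_Ioi_le (c := fun i j => -u (x i - x j)) hb fun i j _ => by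
    have := hu (x i - x j)
    linarith
  simp only [Finset.sum_neg_distrib] at this
  rw [pairEnergy]
  linarith

/-- The lower bound `-(N B + N² b)` of the total potential, for `V ≥ -B` and `u ≥ -b`. -/
theorem neg_le_totalPotential (hV : ∀ x, ((-B : ℝ) : EReal) ≤ V x)
    (hb : 0 ≤ b) (hu : ∀ x, -b ≤ u x) (N : ℕ) (x : Fin N → ℝ) :
    ((-(N * B + (N : ℝ) ^ 2 * b) : ℝ) : EReal) ≤ totalPotential N V u x := by
  by_cases hx : ∃ i, V (x i) = ⊤
  · rw [(totalPotential_eq_top_iff hV).mpr hx]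
    exact le_top
  · push Not at hx
    rw [totalPotential_of_ne_top hV hx, EReal.coe_le_coe_iff]
    have h1 := neg_le_pairEnergy hb hu N x
    have h2 : ∑ i : Fin N, (-B) ≤ ∑ i, (V (x i)).toReal := by
      refine Finset.sum_le_sum fun i _ => ?_
      have := EReal.toReal_le_toReal (hV (x i)) (EReal.coe_ne_bot _) (hx i)
      rwa [EReal.toReal_coe] at this
    simp only [Finset.sum_neg_distrib, Finset.sum_const, Finset.card_univ, Fintype.card_fin,
      nsmul_eq_mul] at h2
    linarith

theorem quasiMeasurePreserving_sub_coord {n : ℕ} (i : Fin (n + 1)) (k : Fin n) :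
    Measure.QuasiMeasurePreserving fun x : Fin (n + 1) → ℝ => x i - x (i.succAbove k) := by
  have hprod : Measure.QuasiMeasurePreserving (fun p : ℝ × (Fin n → ℝ) => p.1 - p.2 k) := by
    have hm : Measurable (fun p : ℝ × (Fin n → ℝ) => p.1 - p.2 k) := by fun_prop
    refine ⟨hm, Measure.AbsolutelyContinuous.mk fun s hs h0 => ?_⟩
    rw [Measure.map_apply hm hs, Measure.volume_eq_prod, Measure.prod_apply_symm (hm hs)]
    refine lintegral_eq_zero_of_ae_eq_zero (ae_of_all _ fun y => ?_)
    have : (fun t : ℝ => (t, y)) ⁻¹' ((fun p : ℝ × (Fin n → ℝ) => p.1 - p.2 k) ⁻¹' s) =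
        (fun t => t - y k) ⁻¹' s := rfl
    simp only [this, Pi.zero_apply]
    exact (measurePreserving_sub_right volume (y k)).quasiMeasurePreserving.preimage_null h0
  exact hprod.comp (measurePreserving_split i).quasiMeasurePreserving

theorem aemeasurable_pair (hu : AEMeasurable u) {N : ℕ} {i j : Fin N} (hij : i ≠ j) :
    AEMeasurable fun x : Fin N → ℝ => u (x i - x j) := by
  cases N with
  | zero => exact i.elim0
  | succ n =>
    obtain ⟨k, rfl⟩ := Fin.exists_succAbove_eq hij.symm
    exact hu.comp_quasiMeasurePreserving (quasiMeasurePreserving_sub_coord i k)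

theorem aemeasurable_pairEnergy (hu : AEMeasurable u) (N : ℕ) : AEMeasurable (pairEnergy N u) :=
  Finset.aemeasurable_fun_sum _ fun _ _ => Finset.aemeasurable_fun_sum _ fun _ hj =>
    aemeasurable_pair hu (Finset.mem_Ioi.mp hj).ne

theorem aemeasurable_totalPotential (hV : Measurable V) (hu : AEMeasurable u) (N : ℕ) :
    AEMeasurable (totalPotential N V u) := by
  have h1 : AEMeasurable fun x : Fin N → ℝ => ∑ i, V (x i) :=
    (Finset.measurable_fun_sum _ fun i _ => hV.comp (measurable_pi_apply i)).aemeasurable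
  have h2 := measurable_coe_real_ereal.comp_aemeasurable (aemeasurable_pairEnergy hu N)
  rw [funext fun x => totalPotential_eq N V u x]
  exact h1.add h2

/-- Where `V` is finite, the square of `potRoot` of the total potential is the sum of its
one-particle contributions and a nonnegative remainder. -/
theorem potRoot_totalPotential_sq (hB : 0 ≤ B) (hV : ∀ x, ((-B : ℝ) : EReal) ≤ V x)
    (hb : 0 ≤ b) (hu : ∀ x, -b ≤ u x) {N : ℕ} {x : Fin N → ℝ} (hx : ∀ i, V (x i) ≠ ⊤) :
    potRoot (N * B + (N : ℝ) ^ 2 * b) (totalPotential N V u) x ^ 2 =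
      ∑ i, potRoot B V (x i) ^ 2 + (pairEnergy N u x + (N : ℝ) ^ 2 * b) := by
  rw [potRoot_sq (by positivity) (neg_le_totalPotential hV hb hu N),
    totalPotential_of_ne_top hV hx, EReal.toReal_coe]
  simp_rw [potRoot_sq hB hV, Finset.sum_add_distrib]
  simp
  ring

end Potential

/-! ### The form of independent particles in the product basis -/

section Bessel

variable {n : ℕ} {κ B b : ℝ} {V : ℝ → EReal} {u : ℝ → ℝ}

theorem L2_norm_sq_eq_lintegral {X : Type*} [MeasureSpace X] (f : L2 X) :
    ENNReal.ofReal (‖f‖ ^ 2) = ∫⁻ x, ‖f x‖ₑ ^ 2 := by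
  rw [L2_norm_sq, ofReal_integral_eq_lintegral_ofReal]
  · simp_rw [ENNReal.ofReal_pow (norm_nonneg _), ofReal_norm]
  · exact (memLp_two_iff_integrable_sq_norm (Lp.aestronglyMeasurable _)).mp (Lp.memLp _)
  · exact ae_of_all _ fun x => by positivity

/-- `x` lists the vectors `√κ ∂ᵢψ` (at `inl i`) and `(V(xᵢ) + B)^{1/2} ψ` (at `inr i`), so that
`‖x‖²` is the energy of independent particles in the state `ψ`, shifted by `B` per particle. -/
def IsFreeVec (κ B : ℝ) (V : ℝ → EReal) (ψ : L2 (Fin (n + 1) → ℝ))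
    (x : PiLp 2 fun _ : Fin (n + 1) ⊕ Fin (n + 1) => L2 (Fin (n + 1) → ℝ)) : Prop :=
  ∀ i, IsWeakDeriv (coordDir (n + 1) i) ((√κ : ℂ) • ψ) (x (Sum.inl i)) ∧
    (∀ᵐ y : Fin (n + 1) → ℝ, V (y i) = ⊤ → ψ y = 0) ∧
    x (Sum.inr i) =ᵐ[volume] fun y => (potRoot B V (y i) : ℂ) * ψ y

/-- The energy of independent particles is at most that of the interacting particles, after the
shift by the lower bounds of the potentials. -/
theorem exists_isFreeVec (hVm : Measurable V) (hB : 0 ≤ B) (hV : ∀ x, ((-B : ℝ) : EReal) ≤ V x)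
    (hb : 0 ≤ b) (hu : ∀ x, -b ≤ u x) {h : FormVec (Fin (n + 1)) (Fin (n + 1) → ℝ)}
    (hh : h ∈ formSubmodule κ (coordDir (n + 1)) ((n + 1 : ℕ) * B + ((n + 1 : ℕ) : ℝ) ^ 2 * b)
      (totalPotential (n + 1) V u)) :
    ∃ x, IsFreeVec κ B V (h none) x ∧ ‖x‖ ^ 2 ≤ ‖h‖ ^ 2 := by
  obtain ⟨h1, h2, h3⟩ := hh
  have hfin : ∀ᵐ y : Fin (n + 1) → ℝ, h none y ≠ 0 → ∀ i, V (y i) ≠ ⊤ := by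
    filter_upwards [h2] with y hy h0 i hi
    exact h0 (hy ((totalPotential_eq_top_iff hV).mpr ⟨i, hi⟩))
  have hrem : ∀ y : Fin (n + 1) → ℝ, 0 ≤ pairEnergy (n + 1) u y + ((n + 1 : ℕ) : ℝ) ^ 2 * b :=
    fun y => by linarith [neg_le_pairEnergy hb hu (n + 1) y]
  have hpw : ∀ᵐ y : Fin (n + 1) → ℝ,
      ∑ i, ‖(potRoot B V (y i) : ℂ) * h none y‖ ^ 2 ≤ ‖h (some none) y‖ ^ 2 := by
    filter_upwards [hfin, h3] with y hy hy3
    rw [hy3]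
    by_cases h0 : h none y = 0
    · simp [h0]
    · simp_rw [norm_mul, mul_pow, ← Finset.sum_mul, Complex.norm_real, Real.norm_eq_abs, sq_abs]
      refine mul_le_mul_of_nonneg_right ?_ (by positivity)
      rw [potRoot_totalPotential_sq hB hV hb hu (hy h0)]
      linarith [hrem y]
  have hmeas : ∀ i, AEStronglyMeasurable
      fun y : Fin (n + 1) → ℝ => (potRoot B V (y i) : ℂ) * h none y := fun i => by
    have hp : Measurable (potRoot B V) := (hVm.ereal_toReal.add_const B).sqrt
    exact ((Complex.measurable_ofReal.comp
      (hp.comp (measurable_pi_apply i))).aestronglyMeasurable).mul (Lp.aestronglyMeasurable _)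
  have hmem : ∀ i, MemLp (fun y : Fin (n + 1) → ℝ => (potRoot B V (y i) : ℂ) * h none y) 2 := by
    intro i
    refine MemLp.of_le (Lp.memLp (h (some none))) (hmeas i) ?_
    filter_upwards [hpw] with y hy
    refine (pow_le_pow_iff_left₀ (norm_nonneg _) (norm_nonneg _) two_ne_zero).mp (le_trans ?_ hy)
    exact Finset.single_le_sum (f := fun i => ‖(potRoot B V (y i) : ℂ) * h none y‖ ^ 2)
      (fun _ _ => by positivity) (Finset.mem_univ i)
  refine ⟨WithLp.toLp 2 fun s => match s with
    | Sum.inl i => h (some (some i))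
    | Sum.inr i => (hmem i).toLp, fun i => ⟨h1 i, ?_, (hmem i).coeFn_toLp⟩, ?_⟩
  · filter_upwards [hfin] with y hy hi
    by_contra h0
    exact hy h0 i hi
  · rw [PiLp.norm_sq_eq_of_L2, PiLp.norm_sq_eq_of_L2, Fintype.sum_sum_type, Fintype.sum_option,
      Fintype.sum_option]
    have hsum : ∑ i, ‖(hmem i).toLp‖ ^ 2 ≤ ‖h (some none)‖ ^ 2 := by
      simp_rw [L2_norm_sq]
      have hint : ∀ f : L2 (Fin (n + 1) → ℝ), Integrable fun x => ‖f x‖ ^ 2 := fun f =>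
        (memLp_two_iff_integrable_sq_norm (Lp.aestronglyMeasurable _)).mp (Lp.memLp _)
      rw [← integral_finsetSum _ fun i _ => hint _]
      refine integral_mono_ae (integrable_finsetSum _ fun i _ => hint _) (hint _) ?_
      filter_upwards [hpw, ae_all_iff.mpr fun i => (hmem i).coeFn_toLp] with y hy1 hy2
      simp_rw [hy2]
      exact hy1
    have : 0 ≤ ‖h none‖ ^ 2 := by positivity
    simp only
    linarith

/-- The vector of a product of one-particle states, given vectors `p j` in the one-particle form
domain. -/
noncomputable def freeVec (p : ℕ → FormVec Unit ℝ) (k : Fin (n + 1) → ℕ) :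
    PiLp 2 fun _ : Fin (n + 1) ⊕ Fin (n + 1) => L2 (Fin (n + 1) → ℝ) :=
  WithLp.toLp 2 fun s => match s with
    | Sum.inl i => tens i (p (k i) (some (some ())))
        (tensorN n fun l => p (k (i.succAbove l)) none)
    | Sum.inr i => tens i (p (k i) (some none)) (tensorN n fun l => p (k (i.succAbove l)) none)

variable {p : ℕ → FormVec Unit ℝ}

theorem isFreeVec_freeVec (hp : ∀ j, p j ∈ formSubmodule κ (fun _ : Unit => (1 : ℝ)) B V)
    (k : Fin (n + 1) → ℕ) :
    IsFreeVec κ B V (tensorBasis (fun j => p j none) k) (freeVec p k) := by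
  intro i
  obtain ⟨h1, h2, h3⟩ := hp (k i)
  have hten : tensorBasis (fun j => p j none) k =
      tens i (p (k i) none) (tensorN n fun l => p (k (i.succAbove l)) none) :=
    tensorN_eq_tens i _
  refine ⟨?_, ?_, ?_⟩
  · have := (h1 ()).tens i (tensorN n fun l => p (k (i.succAbove l)) none)
    rw [map_smul, smul_apply, ← hten] at this
    exact this
  · rw [hten]
    filter_upwards [(quasiMeasurePreserving_eval i).ae h2, coeFn_tens i (p (k i) none)
      (tensorN n fun l => p (k (i.succAbove l)) none)] with y hy hy2 hV
    rw [hy2, hy hV, zero_mul]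
  · rw [hten]
    filter_upwards [(quasiMeasurePreserving_eval i).ae h3, coeFn_tens i (p (k i) none)
      (tensorN n fun l => p (k (i.succAbove l)) none), coeFn_tens i (p (k i) (some none))
      (tensorN n fun l => p (k (i.succAbove l)) none)] with y hy hy2 hy3
    change tens i (p (k i) (some none)) _ y = _
    rw [hy2, hy3, hy, mul_assoc]

variable {ε : ℕ → ℝ}

theorem inner_freeVec
    (heig : ∀ j, ∀ h ∈ formSubmodule κ (fun _ : Unit => (1 : ℝ)) B V,
      inner ℂ h (p j) = ((ε j + B + 1 : ℝ) : ℂ) * inner ℂ (h none) (p j none))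
    {ψ : L2 (Fin (n + 1) → ℝ)}
    {x : PiLp 2 fun _ : Fin (n + 1) ⊕ Fin (n + 1) => L2 (Fin (n + 1) → ℝ)}
    (hx : IsFreeVec κ B V ψ x) (k : Fin (n + 1) → ℕ) :
    inner ℂ x (freeVec p k) =
      ((∑ i, (ε (k i) + B) : ℝ) : ℂ) * inner ℂ ψ (tensorBasis (fun j => p j none) k) := by
  rw [PiLp.inner_apply, Fintype.sum_sum_type, ← Finset.sum_add_distrib, Complex.ofReal_sum,
    Finset.sum_mul]
  refine Finset.sum_congr rfl fun i _ => ?_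
  obtain ⟨h1, h2, h3⟩ := hx i
  set g := tensorN n fun l => p (k (i.succAbove l)) none with hg
  have hmem := contrR_mem_formSubmodule h1 h2 h3 g
  have h := heig (k i) _ hmem
  rw [PiLp.inner_apply, Fintype.sum_option, Fintype.sum_option, Fintype.sum_unique] at h
  have hflip : ∀ (f : L2 ℝ) (χ : L2 (Fin (n + 1) → ℝ)),
      inner ℂ (contrR i g χ) f = inner ℂ χ (tens i f g) := fun f χ => by
    rw [← inner_conj_symm, inner_contrR, inner_conj_symm]
  have hten : tensorBasis (fun j => p j none) k = tens i (p (k i) none) g := tensorN_eq_tens i _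
  simp only [hflip] at h
  rw [hten]
  change inner ℂ (x (Sum.inl i)) (tens i (p (k i) (some (some ()))) g) +
    inner ℂ (x (Sum.inr i)) (tens i (p (k i) (some none)) g) = _
  push_cast at h ⊢
  linear_combination h

/-- Bessel's inequality for the form of independent particles. -/
theorem sum_tensorBasis_le_free (hp : ∀ j, p j ∈ formSubmodule κ (fun _ : Unit => (1 : ℝ)) B V)
    (heig : ∀ j, ∀ h ∈ formSubmodule κ (fun _ : Unit => (1 : ℝ)) B V,
      inner ℂ h (p j) = ((ε j + B + 1 : ℝ) : ℂ) * inner ℂ (h none) (p j none))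
    (horth : Orthonormal ℂ fun j => p j none)
    {ψ : L2 (Fin (n + 1) → ℝ)}
    {x : PiLp 2 fun _ : Fin (n + 1) ⊕ Fin (n + 1) => L2 (Fin (n + 1) → ℝ)}
    (hx : IsFreeVec κ B V ψ x) (s : Finset (Fin (n + 1) → ℕ)) :
    ∑ k ∈ s, (∑ i, (ε (k i) + B)) * ‖inner ℂ (tensorBasis (fun j => p j none) k) ψ‖ ^ 2 ≤
      ‖x‖ ^ 2 := by
  refine sum_weighted_bessel (w := freeVec p) (fun k l => ?_) (fun k => ?_) s
  · rw [inner_freeVec heig (isFreeVec_freeVec hp k),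
      orthonormal_iff_ite.mp (orthonormal_tensorBasis horth _)]
    by_cases hkl : k = l
    · subst hkl
      simp
    · simp [hkl]
  · rw [← inner_conj_symm, inner_freeVec heig hx, map_mul, Complex.conj_ofReal, inner_conj_symm]

theorem norm_freeVec_sq (hp : ∀ j, p j ∈ formSubmodule κ (fun _ : Unit => (1 : ℝ)) B V)
    (heig : ∀ j, ∀ h ∈ formSubmodule κ (fun _ : Unit => (1 : ℝ)) B V,
      inner ℂ h (p j) = ((ε j + B + 1 : ℝ) : ℂ) * inner ℂ (h none) (p j none))
    (horth : Orthonormal ℂ fun j => p j none) (k : Fin (n + 1) → ℕ) :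
    ‖freeVec p k‖ ^ 2 = ∑ i, (ε (k i) + B) := by
  have h1 := inner_freeVec heig (isFreeVec_freeVec hp k) k
  rw [inner_self_eq_norm_sq_to_K, inner_self_eq_norm_sq_to_K,
    (orthonormal_tensorBasis horth _).1] at h1
  exact Complex.ofReal_injective (by simpa using h1)

/-- A function in the form domain lies in the span of the products of one-particle
eigenfunctions. -/
theorem mem_closure_span_of_isFreeVec
    (hcomp : ∀ h ∈ formSubmodule κ (fun _ : Unit => (1 : ℝ)) B V,
      h none ∈ (Submodule.span ℂ (Set.range fun j => p j none)).topologicalClosure)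
    {ψ : L2 (Fin (n + 1) → ℝ)}
    {x : PiLp 2 fun _ : Fin (n + 1) ⊕ Fin (n + 1) => L2 (Fin (n + 1) → ℝ)}
    (hx : IsFreeVec κ B V ψ x) :
    ψ ∈ (Submodule.span ℂ (Set.range
      (tensorBasis (fun j => p j none) (N := n + 1)))).topologicalClosure := by
  refine mem_closure_span_tensorBasis fun i f hf => ?_
  refine ext_inner_left ℂ fun g => ?_
  obtain ⟨h1, h2, h3⟩ := hx i
  rw [inner_contrL, ← inner_contrR, inner_zero_right]
  exact inner_eq_zero_of_mem_closure_span (hcomp _ (contrR_mem_formSubmodule h1 h2 h3 g)) hf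

end Bessel

/-! ### The form domain of the bosons -/

section Boson

theorem measurePreserving_comp_perm {N : ℕ} (τ : Equiv.Perm (Fin N)) :
    MeasurePreserving fun x : Fin N → ℝ => x ∘ τ := by
  have h := volume_measurePreserving_piCongrLeft (fun _ : Fin N => ℝ) τ.symm
  have he : (MeasurableEquiv.piCongrLeft (fun _ : Fin N => ℝ) τ.symm : (Fin N → ℝ) → Fin N → ℝ) =
      fun x => x ∘ τ := by
    funext x i
    rw [MeasurableEquiv.coe_piCongrLeft, Equiv.piCongrLeft_apply_eq_cast]
    simp
  rwa [he] at h

/-- Permutation of the variables. -/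
noncomputable def permL2 {N : ℕ} (τ : Equiv.Perm (Fin N)) :
    L2 (Fin N → ℝ) →ₗᵢ[ℂ] L2 (Fin N → ℝ) :=
  Lp.compMeasurePreservingₗᵢ ℂ (fun x => x ∘ τ) (measurePreserving_comp_perm τ)

theorem coeFn_permL2 {N : ℕ} (τ : Equiv.Perm (Fin N)) (ψ : L2 (Fin N → ℝ)) :
    permL2 τ ψ =ᵐ[volume] fun x => ψ (x ∘ τ) :=
  Lp.coeFn_compMeasurePreserving ψ (measurePreserving_comp_perm τ)

theorem mem_symmetricFunctions_iff {N : ℕ} {ψ : L2 (Fin N → ℝ)} :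
    ψ ∈ symmetricFunctions N ↔ ∀ τ, permL2 τ ψ = ψ :=
  forall_congr' fun τ => by
    rw [Lp.ext_iff]
    exact ⟨fun h => (coeFn_permL2 τ ψ).trans h, fun h => (coeFn_permL2 τ ψ).symm.trans h⟩

/-- The closed subspace of symmetric functions. -/
def symSubmodule (N : ℕ) : Submodule ℂ (L2 (Fin N → ℝ)) where
  carrier := symmetricFunctions N
  zero_mem' := mem_symmetricFunctions_iff.mpr fun τ => map_zero _
  add_mem' := fun {f g} hf hg => by
    rw [mem_symmetricFunctions_iff] at *
    intro τ
    rw [map_add, hf, hg]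
  smul_mem' := fun c f hf => by
    rw [mem_symmetricFunctions_iff] at *
    intro τ
    rw [map_smul, hf]

theorem isClosed_symSubmodule (N : ℕ) : IsClosed (symSubmodule N : Set (L2 (Fin N → ℝ))) := by
  have : (symSubmodule N : Set (L2 (Fin N → ℝ))) = ⋂ τ, {ψ | permL2 τ ψ = ψ} := by
    ext ψ
    rw [Set.mem_iInter]
    exact mem_symmetricFunctions_iff
  rw [this]
  exact isClosed_iInter fun τ => isClosed_eq (permL2 τ).continuous continuous_id

theorem tensorBasis_const_mem_sym (φ : ℕ → L2 ℝ) (N j : ℕ) :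
    tensorBasis φ (fun _ : Fin N => j) ∈ symmetricFunctions N := by
  intro τ
  have h := coeFn_tensorN N fun _ => φ j
  filter_upwards [h, (measurePreserving_comp_perm τ).quasiMeasurePreserving.ae h] with x h1 h2
  rw [tensorBasis, h1, h2]
  exact Equiv.prod_comp τ fun i => φ j (x i)

/-- The form domain of `N` bosons as a Hilbert space, where `V ≥ -B` and `u ≥ -b`. -/
noncomputable def bosonSubmodule (κ B b : ℝ) (V : ℝ → EReal) (u : ℝ → ℝ) (N : ℕ) :
    Submodule ℂ (FormVec (Fin N) (Fin N → ℝ)) :=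
  formSubmodule κ (coordDir N) (N * B + (N : ℝ) ^ 2 * b) (totalPotential N V u) ⊓
    (symSubmodule N).comap
      (PiLp.projₗ 2 (fun _ : Option (Option (Fin N)) => L2 (Fin N → ℝ)) none)

variable {κ B b : ℝ} {V : ℝ → EReal} {u : ℝ → ℝ}

theorem isClosed_bosonSubmodule (N : ℕ) :
    IsClosed (bosonSubmodule κ B b V u N : Set (FormVec (Fin N) (Fin N → ℝ))) :=
  (isClosed_formSubmodule _ _ _ _).inter ((isClosed_symSubmodule N).preimage
    (PiLp.continuous_apply 2 (fun _ : Option (Option (Fin N)) => L2 (Fin N → ℝ)) none))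

theorem mem_bosonDomain_iff (hκ : 0 < κ) (hB : 0 ≤ B) (hVm : Measurable V)
    (hV : ∀ x, ((-B : ℝ) : EReal) ≤ V x) (hum : AEMeasurable u) (hb : 0 ≤ b) (hu : ∀ x, -b ≤ u x)
    {N : ℕ} {f : L2 (Fin N → ℝ)} :
    f ∈ formDomain (coordDir N) (totalPotential N V u) ∩ symmetricFunctions N ↔
      ∃ h ∈ bosonSubmodule κ B b V u N, h none = f := by
  rw [Set.mem_inter_iff, mem_formDomain_iff hκ _ (by positivity)
    (aemeasurable_totalPotential hVm hum N) (neg_le_totalPotential hV hb hu N)]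
  constructor
  · rintro ⟨⟨h, hh, rfl⟩, hs⟩
    exact ⟨h, ⟨hh, hs⟩, rfl⟩
  · rintro ⟨h, ⟨hh, hs⟩, rfl⟩
    exact ⟨⟨h, hh, rfl⟩, hs⟩

/-- The interaction energy of a pair in a product state with a bounded factor. -/
theorem lintegral_pair_le {N : ℕ} (hum : AEMeasurable u) {f : Fin N → L2 ℝ} (hf : ∀ i, ‖f i‖ = 1)
    {M : ℝ} {i j : Fin N} (hij : i ≠ j) (hM : ∀ᵐ x, ‖f i x‖ ≤ M) :
    ∫⁻ x : Fin N → ℝ, ‖u (x i - x j)‖ₑ * ‖tensorN N f x‖ₑ ^ 2 ≤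
      ENNReal.ofReal M ^ 2 * ∫⁻ t, ‖u t‖ₑ := by
  cases N with
  | zero => exact i.elim0
  | succ n =>
    obtain ⟨k, rfl⟩ := Fin.exists_succAbove_eq hij.symm
    set g := tensorN n fun l => f (i.succAbove l) with hg
    have hg1 : ‖g‖ = 1 := norm_tensorN_eq_one fun l => hf _
    have hm : AEMeasurable (fun x : Fin (n + 1) → ℝ =>
        ‖u (x i - x (i.succAbove k))‖ₑ * ‖g (i.removeNth x)‖ₑ ^ 2) :=
      (aemeasurable_pair hum hij).enorm.mul (((Lp.aestronglyMeasurable g).comp_quasiMeasurePreserving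
        (quasiMeasurePreserving_removeNth i)).enorm.pow_const 2)
    have hm2 : AEMeasurable (fun p : ℝ × (Fin n → ℝ) => ‖u (p.1 - p.2 k)‖ₑ * ‖g p.2‖ₑ ^ 2) := by
      have := hm.comp_quasiMeasurePreserving (measurePreserving_insertNth i).quasiMeasurePreserving
      simpa [Function.comp_def] using this
    calc ∫⁻ x : Fin (n + 1) → ℝ, ‖u (x i - x (i.succAbove k))‖ₑ * ‖tensorN (n + 1) f x‖ₑ ^ 2
        ≤ ∫⁻ x : Fin (n + 1) → ℝ, ENNReal.ofReal M ^ 2 *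
            (‖u (x i - x (i.succAbove k))‖ₑ * ‖g (i.removeNth x)‖ₑ ^ 2) := by
          refine lintegral_mono_ae ?_
          rw [tensorN_eq_tens i]
          filter_upwards [coeFn_tens i (f i) g, (quasiMeasurePreserving_eval i).ae hM] with x h1 h2
          rw [h1, enorm_mul, mul_pow, mul_left_comm]
          gcongr
          rw [← ofReal_norm]
          exact ENNReal.ofReal_le_ofReal h2
      _ = ENNReal.ofReal M ^ 2 * ∫⁻ x : Fin (n + 1) → ℝ,
            ‖u (x i - x (i.succAbove k))‖ₑ * ‖g (i.removeNth x)‖ₑ ^ 2 :=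
          lintegral_const_mul' _ _ (by finiteness)
      _ = ENNReal.ofReal M ^ 2 * ∫⁻ t, ‖u t‖ₑ := by
          congr 1
          rw [lintegral_insertNth i]
          simp only [Fin.insertNth_apply_same, Fin.insertNth_apply_succAbove,
            Fin.removeNth_insertNth]
          rw [Measure.volume_eq_prod, lintegral_prod_symm _ hm2]
          have hin : ∀ y : Fin n → ℝ, ∫⁻ t, ‖u (t - y k)‖ₑ * ‖g y‖ₑ ^ 2 =
              (∫⁻ t, ‖u t‖ₑ) * ‖g y‖ₑ ^ 2 := fun y => by
            rw [lintegral_mul_const' _ _ (by finiteness),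
              lintegral_sub_right_eq_self (fun t => ‖u t‖ₑ) (y k)]
          simp_rw [hin]
          rw [lintegral_const_mul'' _ ((Lp.aestronglyMeasurable g).enorm.pow_const 2),
            ← L2_norm_sq_eq_lintegral, hg1]
          simp

variable {p : ℕ → FormVec Unit ℝ} {ε : ℕ → ℝ}

/-- The potential energy of the condensate `φⱼ ⊗ ⋯ ⊗ φⱼ`, apart from that of the trap, is at most
quadratic in the number of particles. -/
theorem lintegral_potRoot_condensate_le (hB : 0 ≤ B)
    (hV : ∀ x, ((-B : ℝ) : EReal) ≤ V x) (hui : Integrable u) (hb : 0 ≤ b) (hu : ∀ x, -b ≤ u x)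
    {f : L2 ℝ} (hf : ‖f‖ = 1) {M : ℝ} (hM0 : 0 ≤ M) (hM : ∀ᵐ x, ‖f x‖ ≤ M) {N : ℕ}
    {Φ : L2 (Fin N → ℝ)} (hΦ : Φ = tensorN N fun _ => f) (x : Fin N → L2 (Fin N → ℝ))
    (hfin : ∀ᵐ y : Fin N → ℝ, Φ y ≠ 0 → ∀ i, V (y i) ≠ ⊤)
    (hx : ∀ i, ∀ᵐ y : Fin N → ℝ, x i y = (potRoot B V (y i) : ℂ) * Φ y) :
    ∫⁻ y, ‖(potRoot (N * B + (N : ℝ) ^ 2 * b) (totalPotential N V u) y : ℂ) * Φ y‖ₑ ^ 2 ≤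
      ENNReal.ofReal ((∑ i, ‖x i‖ ^ 2) + (N : ℝ) ^ 2 * (M ^ 2 * (∫ t, ‖u t‖) + b)) := by
  have hum := hui.aestronglyMeasurable.aemeasurable
  have hΦ1 : ‖Φ‖ = 1 := hΦ ▸ norm_tensorN_eq_one fun _ => hf
  set W := totalPotential N V u
  set C : ℝ := N * B + (N : ℝ) ^ 2 * b
  set U := M ^ 2 * ∫ t, ‖u t‖ with hU
  have hU0 : 0 ≤ U := by positivity
  have hUe : ENNReal.ofReal M ^ 2 * ∫⁻ t, ‖u t‖ₑ = ENNReal.ofReal U := by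
    rw [hU, ENNReal.ofReal_mul (by positivity), ENNReal.ofReal_pow hM0,
      ofReal_integral_norm_eq_lintegral_enorm hui]
  have hpair : ∀ i : Fin N, ∀ l ∈ Finset.Ioi i, AEMeasurable fun y : Fin N → ℝ =>
      ‖u (y i - y l)‖ₑ * ‖Φ y‖ₑ ^ 2 := fun i l hl =>
    (aemeasurable_pair hum (Finset.mem_Ioi.mp hl).ne).enorm.mul
      ((Lp.aestronglyMeasurable Φ).enorm.pow_const 2)
  calc ∫⁻ y, ‖(potRoot C W y : ℂ) * Φ y‖ₑ ^ 2
      ≤ ∫⁻ y, ((∑ i, ‖x i y‖ₑ ^ 2) + ((∑ i : Fin N, ∑ l ∈ Finset.Ioi i,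
          ‖u (y i - y l)‖ₑ * ‖Φ y‖ₑ ^ 2) + ENNReal.ofReal ((N : ℝ) ^ 2 * b) * ‖Φ y‖ₑ ^ 2)) := by
        refine lintegral_mono_ae ?_
        filter_upwards [hfin, ae_all_iff.mpr hx] with y hy1 hy2
        by_cases h0 : Φ y = 0
        · simp [h0]
        have hsq : ∀ r : ℝ, ‖(r : ℂ) * Φ y‖ₑ ^ 2 = ENNReal.ofReal (r ^ 2) * ‖Φ y‖ₑ ^ 2 := by
          intro r
          rw [enorm_mul, mul_pow]
          congr 1
          rw [← ofReal_norm, Complex.norm_real, Real.norm_eq_abs,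
            ← ENNReal.ofReal_pow (abs_nonneg _), sq_abs]
        simp_rw [hy2, hsq, ← Finset.sum_mul, ← add_mul]
        gcongr
        rw [potRoot_totalPotential_sq hB hV hb hu (hy1 h0)]
        refine ENNReal.ofReal_add_le.trans (add_le_add ?_ (ENNReal.ofReal_add_le.trans
          (add_le_add ?_ le_rfl)))
        · rw [ENNReal.ofReal_sum_of_nonneg fun _ _ => by positivity]
        · have habs : pairEnergy N u y ≤ ∑ i : Fin N, ∑ l ∈ Finset.Ioi i, ‖u (y i - y l)‖ :=
            Finset.sum_le_sum fun i _ => Finset.sum_le_sum fun l _ => Real.le_norm_self _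
          refine (ENNReal.ofReal_le_ofReal habs).trans_eq ?_
          rw [ENNReal.ofReal_sum_of_nonneg fun _ _ => Finset.sum_nonneg fun _ _ => norm_nonneg _]
          refine Finset.sum_congr rfl fun i _ => ?_
          rw [ENNReal.ofReal_sum_of_nonneg fun _ _ => norm_nonneg _]
          simp_rw [ofReal_norm]
    _ = (∑ i, ENNReal.ofReal (‖x i‖ ^ 2)) + ((∑ i : Fin N, ∑ l ∈ Finset.Ioi i,
          ∫⁻ y : Fin N → ℝ, ‖u (y i - y l)‖ₑ * ‖Φ y‖ₑ ^ 2) + ENNReal.ofReal ((N : ℝ) ^ 2 * b)) := by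
        have hm1 : AEMeasurable fun y => ∑ i, ‖x i y‖ₑ ^ 2 :=
          Finset.aemeasurable_fun_sum _ fun i _ =>
            (Lp.aestronglyMeasurable (x i)).enorm.pow_const 2
        have hm2 : AEMeasurable fun y : Fin N → ℝ => ∑ i : Fin N, ∑ l ∈ Finset.Ioi i,
            ‖u (y i - y l)‖ₑ * ‖Φ y‖ₑ ^ 2 :=
          Finset.aemeasurable_fun_sum _ fun i _ => Finset.aemeasurable_fun_sum _ (hpair i)
        rw [lintegral_add_left' hm1, lintegral_add_left' hm2,
          lintegral_finsetSum' _ fun i _ =>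
            (Lp.aestronglyMeasurable (x i)).enorm.pow_const 2,
          lintegral_finsetSum' _ fun i _ => Finset.aemeasurable_fun_sum _ (hpair i),
          lintegral_const_mul' _ _ ENNReal.ofReal_ne_top, ← L2_norm_sq_eq_lintegral, hΦ1]
        simp_rw [L2_norm_sq_eq_lintegral]
        rw [Finset.sum_congr rfl fun i _ => lintegral_finsetSum' _ (hpair i)]
        simp
    _ ≤ (∑ i, ENNReal.ofReal (‖x i‖ ^ 2)) + ((∑ i : Fin N, ∑ l ∈ Finset.Ioi i,
          ENNReal.ofReal U) + ENNReal.ofReal ((N : ℝ) ^ 2 * b)) := by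
        refine add_le_add le_rfl (add_le_add (Finset.sum_le_sum fun i _ =>
          Finset.sum_le_sum fun l hl => ?_) le_rfl)
        rw [← hUe]
        rw [hΦ]
        exact lintegral_pair_le hum (fun _ => hf) (Finset.mem_Ioi.mp hl).ne hM
    _ = ENNReal.ofReal ((∑ i, ‖x i‖ ^ 2) + ((∑ i : Fin N, ∑ l ∈ Finset.Ioi i, U) +
          (N : ℝ) ^ 2 * b)) := by
        have h1 : 0 ≤ ∑ i : Fin N, ∑ l ∈ Finset.Ioi i, U :=
          Finset.sum_nonneg fun _ _ => Finset.sum_nonneg fun _ _ => hU0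
        rw [ENNReal.ofReal_add (Finset.sum_nonneg fun _ _ => by positivity) (by positivity),
          ENNReal.ofReal_add h1 (by positivity),
          ENNReal.ofReal_sum_of_nonneg fun _ _ => by positivity,
          ENNReal.ofReal_sum_of_nonneg fun _ _ => Finset.sum_nonneg fun _ _ => hU0]
        simp_rw [ENNReal.ofReal_sum_of_nonneg fun _ _ => hU0]
    _ ≤ _ := by
        refine ENNReal.ofReal_le_ofReal ?_
        have := sum_sum_Ioi_le (N := N) (c := fun _ _ => U) hU0 fun _ _ _ => le_rfl
        rw [mul_add]
        linarith

theorem exists_mem_bosonSubmodule {N : ℕ} {f w : L2 (Fin N → ℝ)} {d : Fin N → L2 (Fin N → ℝ)}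
    (hf : f ∈ symmetricFunctions N)
    (hd : ∀ i, IsWeakDeriv (coordDir N i) ((√κ : ℂ) • f) (d i))
    (hW : ∀ᵐ x, totalPotential N V u x = ⊤ → f x = 0)
    (hw : w =ᵐ[volume] fun x =>
      (potRoot (N * B + (N : ℝ) ^ 2 * b) (totalPotential N V u) x : ℂ) * f x) :
    ∃ h ∈ bosonSubmodule κ B b V u N, h none = f ∧
      ‖h‖ ^ 2 = ‖f‖ ^ 2 + (‖w‖ ^ 2 + ∑ i, ‖d i‖ ^ 2) := by
  refine ⟨WithLp.toLp 2 fun o => o.elim f fun o => o.elim w d, ⟨⟨hd, hW, hw⟩, hf⟩, rfl, ?_⟩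
  rw [PiLp.norm_sq_eq_of_L2, Fintype.sum_option, Fintype.sum_option]
  rfl

/-- The condensate `φⱼ ⊗ ⋯ ⊗ φⱼ` lies in the form domain of the bosons, and its interaction energy
is at most quadratic in the number of particles. -/
theorem exists_condensate (hB : 0 ≤ B) (hVm : Measurable V)
    (hV : ∀ x, ((-B : ℝ) : EReal) ≤ V x) (hui : Integrable u) (hb : 0 ≤ b) (hu : ∀ x, -b ≤ u x)
    (hp : ∀ j, p j ∈ formSubmodule κ (fun _ : Unit => (1 : ℝ)) B V)
    (heig : ∀ j, ∀ h ∈ formSubmodule κ (fun _ : Unit => (1 : ℝ)) B V,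
      inner ℂ h (p j) = ((ε j + B + 1 : ℝ) : ℂ) * inner ℂ (h none) (p j none))
    (horth : Orthonormal ℂ fun j => p j none) {j : ℕ} {M : ℝ} (hM0 : 0 ≤ M)
    (hM : ∀ᵐ x, ‖p j none x‖ ≤ M) (n : ℕ) :
    ∃ h ∈ bosonSubmodule κ B b V u (n + 1),
      h none = tensorBasis (fun j => p j none) (fun _ => j) ∧
      ‖h‖ ^ 2 ≤ 1 + (n + 1 : ℕ) * (ε j + B) + ((n + 1 : ℕ) : ℝ) ^ 2 * (M ^ 2 * (∫ t, ‖u t‖) + b) := by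
  set N := n + 1 with hN
  set Φ : L2 (Fin N → ℝ) := tensorBasis (fun j => p j none) (fun _ => j) with hΦ
  set x := freeVec p (fun _ : Fin N => j) with hx
  have hfree := isFreeVec_freeVec hp (fun _ : Fin N => j)
  have hΦ1 : ‖Φ‖ = 1 := (orthonormal_tensorBasis horth N).1 _
  have hnx : ‖x‖ ^ 2 = N * (ε j + B) := by
    rw [hx, norm_freeVec_sq hp heig horth, Finset.sum_const, Finset.card_univ, Fintype.card_fin,
      nsmul_eq_mul]
  have hnx' : ‖x‖ ^ 2 = (∑ i, ‖x (Sum.inl i)‖ ^ 2) + ∑ i, ‖x (Sum.inr i)‖ ^ 2 := by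
    rw [PiLp.norm_sq_eq_of_L2, Fintype.sum_sum_type]
  have hfin : ∀ᵐ y : Fin N → ℝ, Φ y ≠ 0 → ∀ i, V (y i) ≠ ⊤ := by
    filter_upwards [ae_all_iff.mpr fun i => (hfree i).2.1] with y hy h0 i hi
    exact h0 (hy i hi)
  have hum := hui.aestronglyMeasurable.aemeasurable
  set W := totalPotential N V u
  set C : ℝ := N * B + (N : ℝ) ^ 2 * b
  have hmeas : AEStronglyMeasurable fun y => (potRoot C W y : ℂ) * Φ y :=
    ((Complex.measurable_ofReal.comp_aemeasurable (aemeasurable_potRoot C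
      (aemeasurable_totalPotential hVm hum N))).aestronglyMeasurable).mul
      (Lp.aestronglyMeasurable _)
  set U := M ^ 2 * ∫ t, ‖u t‖ with hU
  have hU0 : 0 ≤ U := by positivity
  have hbound := lintegral_potRoot_condensate_le hB hV hui hb hu (horth.1 j) hM0 hM hΦ
    (fun i => x (Sum.inr i)) hfin fun i => (hfree i).2.2
  have hmem : MemLp (fun y => (potRoot C W y : ℂ) * Φ y) 2 :=
    (memLp_two_iff_lintegral hmeas).mpr (hbound.trans_lt ENNReal.ofReal_lt_top)
  have hnorm : ‖hmem.toLp‖ ^ 2 ≤ (∑ i, ‖x (Sum.inr i)‖ ^ 2) + (N : ℝ) ^ 2 * (U + b) := by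
    have hpos : 0 ≤ (∑ i, ‖x (Sum.inr i)‖ ^ 2) + (N : ℝ) ^ 2 * (U + b) :=
      add_nonneg (Finset.sum_nonneg fun _ _ => by positivity) (by positivity)
    rw [← ENNReal.ofReal_le_ofReal_iff hpos, L2_norm_sq_eq_lintegral]
    refine le_trans (le_of_eq ?_) hbound
    refine lintegral_congr_ae ?_
    filter_upwards [hmem.coeFn_toLp] with y hy
    rw [hy]
  have hW : ∀ᵐ y, W y = ⊤ → Φ y = 0 := by
    filter_upwards [hfin] with y hy hW
    by_contra h0
    obtain ⟨i, hi⟩ := (totalPotential_eq_top_iff hV).mp hW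
    exact hy h0 i hi
  obtain ⟨h, hh, hhΦ, hhn⟩ := exists_mem_bosonSubmodule (tensorBasis_const_mem_sym _ _ _)
    (fun i => (hfree i).1) hW hmem.coeFn_toLp
  refine ⟨h, hh, hhΦ, ?_⟩
  rw [hhn, hΦ1]
  linarith

end Boson

/-! ### Eigenbases in the form domains -/

section FormEigenbasis

variable {X ι : Type*} [MeasureSpace X] [Fintype ι]

/-- The `g k` are eigenvectors, in the Hilbert space `Q` of the form, of a self-adjoint operator
with eigenvalues `E k`; their components `g k none` form a complete orthonormal system. The inner
product of `Q` is the form shifted by `c`. -/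
structure IsFormEigenbasis (Q : Submodule ℂ (FormVec ι X)) (c : ℝ) (E : ℕ → ℝ)
    (g : ℕ → FormVec ι X) : Prop where
  mem : ∀ k, g k ∈ Q
  eigen : ∀ k, ∀ h ∈ Q, inner ℂ h (g k) = ((E k + c : ℝ) : ℂ) * inner ℂ (h none) (g k none)
  orthonormal : Orthonormal ℂ fun k => g k none
  complete : ∀ h ∈ Q, h none ∈ (Submodule.span ℂ (Set.range fun k => g k none)).topologicalClosure

theorem IsEigenbasis.exists_isFormEigenbasis {D : Set (L2 X)} {q : L2 X → L2 X → ℂ} {E : ℕ → ℝ}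
    {e : ℕ → L2 X} (he : IsEigenbasis D q E e) {Q : Submodule ℂ (FormVec ι X)}
    (hD : ∀ f, f ∈ D ↔ ∃ h ∈ Q, h none = f) {c : ℝ}
    (hq : ∀ h ∈ Q, ∀ h' ∈ Q,
      q (h none) (h' none) + (c : ℂ) * inner ℂ (h none) (h' none) = inner ℂ h h') :
    ∃ g, IsFormEigenbasis Q c E g ∧ ∀ k, g k none = e k := by
  choose g hg hge using fun k => (hD _).mp (he.mem k)
  have hfun : (fun k => g k none) = e := funext hge
  refine ⟨g, ⟨hg, fun k h hh => ?_, hfun ▸ he.orthonormal, fun h hh => ?_⟩, hge⟩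
  · rw [← hq h hh _ (hg k), hge, he.eigen k _ ((hD _).mpr ⟨h, hh, rfl⟩)]
    push_cast
    ring
  · rw [hfun]
    exact he.complete _ ((hD _).mpr ⟨h, hh, rfl⟩)

theorem norm_none_le (h : FormVec ι X) : ‖h none‖ ≤ ‖h‖ := PiLp.norm_apply_le h none

namespace IsFormEigenbasis

variable {Q : Submodule ℂ (FormVec ι X)} {c : ℝ} {E : ℕ → ℝ} {g : ℕ → FormVec ι X}

theorem norm_sq (hg : IsFormEigenbasis Q c E g) (k : ℕ) : ‖g k‖ ^ 2 = E k + c := by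
  have h := hg.eigen k _ (hg.mem k)
  rw [inner_self_eq_norm_sq_to_K, inner_self_eq_norm_sq_to_K, hg.orthonormal.1] at h
  simp only [Complex.coe_algebraMap] at h
  rw [Complex.ofReal_one, one_pow, mul_one] at h
  exact_mod_cast h

theorem one_le (hg : IsFormEigenbasis Q c E g) (k : ℕ) : 1 ≤ E k + c := by
  rw [← hg.norm_sq]
  have h := norm_none_le (g k)
  rw [hg.orthonormal.1] at h
  exact one_le_pow₀ h

theorem sum_le (hg : IsFormEigenbasis Q c E g) {h : FormVec ι X} (hh : h ∈ Q) (s : Finset ℕ) :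
    ∑ k ∈ s, (E k + c) * ‖inner ℂ (g k none) (h none)‖ ^ 2 ≤ ‖h‖ ^ 2 := by
  refine sum_weighted_bessel (w := g) (fun i j => ?_) (fun k => ?_) s
  · rw [hg.eigen j _ (hg.mem i), orthonormal_iff_ite.mp hg.orthonormal]
    split_ifs with hij
    · rw [hij, mul_one]
    · rw [mul_zero]
  · rw [← inner_conj_symm, hg.eigen k h hh, map_mul, Complex.conj_ofReal, inner_conj_symm]

end IsFormEigenbasis

end FormEigenbasis

/-! ### Gibbs weights -/

section Gibbs

/-- Jensen's inequality for the exponential function. -/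
theorem exp_neg_le_tsum {ι : Type*} {p x : ι → ℝ} (hp : ∀ n, 0 ≤ p n) (hp1 : HasSum p 1)
    (hx : ∀ n, 0 ≤ x n) {X β : ℝ} (hβ : 0 ≤ β) (hX : ∀ s : Finset ι, ∑ n ∈ s, x n * p n ≤ X) :
    Summable (fun n => p n * Real.exp (-β * x n)) ∧
      Real.exp (-β * X) ≤ ∑' n, p n * Real.exp (-β * x n) := by
  have hle : ∀ n, p n * Real.exp (-β * x n) ≤ p n := fun n =>
    mul_le_of_le_one_right (hp n) (Real.exp_le_one_iff.mpr (by nlinarith [hx n]))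
  have hs : Summable fun n => p n * Real.exp (-β * x n) :=
    hp1.summable.of_nonneg_of_le (fun n => mul_nonneg (hp n) (Real.exp_pos _).le) hle
  refine ⟨hs, ?_⟩
  set e := Real.exp (-β * X)
  have he : 0 < e := Real.exp_pos _
  have hX0 : 0 ≤ X := by simpa using hX ∅
  have hlow : ∀ s : Finset ι,
      e * ((1 + β * X) * ∑ n ∈ s, p n - β * X) ≤ ∑' n, p n * Real.exp (-β * x n) := by
    intro s
    refine le_trans ?_ (hs.sum_le_tsum s fun n _ => mul_nonneg (hp n) (Real.exp_pos _).le)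
    -- the tangent of the exponential function at the mean
    have htan : ∀ n, e * (1 + β * X - β * x n) * p n ≤ p n * Real.exp (-β * x n) := fun n => by
      have h1 := Real.add_one_le_exp (β * X - β * x n)
      have h2 : Real.exp (-β * x n) = e * Real.exp (β * X - β * x n) := by
        rw [← Real.exp_add]
        ring_nf
      rw [mul_comm, h2]
      exact mul_le_mul_of_nonneg_left (mul_le_mul_of_nonneg_left (by linarith) he.le) (hp n)
    calc e * ((1 + β * X) * ∑ n ∈ s, p n - β * X)
        ≤ e * ((1 + β * X) * ∑ n ∈ s, p n - β * ∑ n ∈ s, x n * p n) := by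
          gcongr
          exact hX s
      _ = ∑ n ∈ s, e * (1 + β * X - β * x n) * p n := by
          rw [Finset.mul_sum, Finset.mul_sum, ← Finset.sum_sub_distrib, Finset.mul_sum]
          exact Finset.sum_congr rfl fun n _ => by ring
      _ ≤ _ := Finset.sum_le_sum fun n _ => htan n
  have hlim : Tendsto (fun s : Finset ι => e * ((1 + β * X) * ∑ n ∈ s, p n - β * X)) atTop
      (𝓝 (e * ((1 + β * X) * 1 - β * X))) :=
    ((Tendsto.const_mul _ hp1).sub_const _).const_mul _
  have := le_of_tendsto' hlim hlow
  simpa using this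

/-- The Peierls inequality: partition functions of diagonal matrix elements are smaller. -/
theorem sum_exp_neg_le {F : Type*} [NormedAddCommGroup F] [InnerProductSpace ℂ F] [CompleteSpace F]
    {ι κ : Type*} {v : ι → F} (hv : Orthonormal ℂ v) {w : κ → F} (hw : Orthonormal ℂ w)
    (hwv : ∀ k, w k ∈ (Submodule.span ℂ (Set.range v)).topologicalClosure)
    {x : ι → ℝ} {X : κ → ℝ} (hx : ∀ n, 0 ≤ x n) {β : ℝ} (hβ : 0 ≤ β)
    (hX : ∀ k, ∀ s : Finset ι, ∑ n ∈ s, x n * ‖inner ℂ (v n) (w k)‖ ^ 2 ≤ X k)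
    (hs : Summable fun n => Real.exp (-β * x n)) (t : Finset κ) :
    ∑ k ∈ t, Real.exp (-β * X k) ≤ ∑' n, Real.exp (-β * x n) := by
  have hJ := fun k => exp_neg_le_tsum (p := fun n => ‖inner ℂ (v n) (w k)‖ ^ 2)
    (fun n => by positivity)
    (by simpa [hw.1 k] using hv.hasSum_sq_norm_inner (hwv k)) hx hβ (hX k)
  calc ∑ k ∈ t, Real.exp (-β * X k)
      ≤ ∑ k ∈ t, ∑' n, ‖inner ℂ (v n) (w k)‖ ^ 2 * Real.exp (-β * x n) :=
        Finset.sum_le_sum fun k _ => (hJ k).2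
    _ = ∑' n, ∑ k ∈ t, ‖inner ℂ (v n) (w k)‖ ^ 2 * Real.exp (-β * x n) :=
        (Summable.tsum_finsetSum fun k _ => (hJ k).1).symm
    _ ≤ ∑' n, Real.exp (-β * x n) := by
        refine Summable.tsum_le_tsum (fun n => ?_) (summable_sum fun k _ => (hJ k).1) hs
        rw [← Finset.sum_mul]
        refine mul_le_of_le_one_left (Real.exp_pos _).le ?_
        have := hw.sum_inner_products_le (v n) (s := t)
        simp_rw [norm_inner_symm (v n)]
        simpa [hv.1 n] using this

theorem hasSum_prod_fin {f : ℕ → ℝ} (hf : ∀ j, 0 ≤ f j) (hs : Summable f) (N : ℕ) :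
    HasSum (fun k : Fin N → ℕ => ∏ i, f (k i)) ((∑' j, f j) ^ N) := by
  induction N with
  | zero =>
    simp
  | succ n ih =>
    rw [pow_succ', ← (Fin.consEquiv fun _ : Fin (n + 1) => ℕ).hasSum_iff]
    have h0 : (0 : (Fin n → ℕ) → ℝ) ≤ fun k => ∏ i, f (k i) :=
      fun k => Finset.prod_nonneg fun i _ => hf _
    have h1 : Summable fun x : ℕ × (Fin n → ℕ) => f x.1 * ∏ i, f (x.2 i) :=
      Summable.mul_of_nonneg (f := f) (g := fun k : Fin n → ℕ => ∏ i, f (k i)) hs ih.summable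
        (fun j => hf j) h0
    have h := hs.hasSum.mul ih h1
    simpa [Function.comp_def, Fin.consEquiv, Fin.prod_univ_succ] using h

end Gibbs

/-! ### Bosons -/

section BosonEigenbasis

variable {κ B b : ℝ} {V : ℝ → EReal} {u : ℝ → ℝ} {ε : ℕ → ℝ} {p : ℕ → FormVec Unit ℝ}

/-- The eigenbasis of one particle in a trap `V ≥ -B`. The interaction is bounded from below by
`-b`, and `B` is so large that the shifted one-particle energies are at least `1`. -/
structure IsTrap (κ B b : ℝ) (V : ℝ → EReal) (u : ℝ → ℝ) (ε : ℕ → ℝ) (p : ℕ → FormVec Unit ℝ) :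
    Prop where
  κ_pos : 0 < κ
  B_nonneg : 0 ≤ B
  b_nonneg : 0 ≤ b
  measurable : Measurable V
  bound : ∀ x, ((-B : ℝ) : EReal) ≤ V x
  integrable : Integrable u
  pair_bound : ∀ x, -b ≤ u x
  basis : IsFormEigenbasis (formSubmodule κ (fun _ : Unit => (1 : ℝ)) B V) (B + 1) ε p
  one_le : ∀ j, 1 ≤ ε j + B
  summable : ∀ β : ℝ, 0 < β → Summable fun j => Real.exp (-β * (ε j + B))

/-- The inner product of the form domain of `N` bosons is the form of `H_N` shifted by this
constant. -/
def bosonShift (B b : ℝ) (N : ℕ) : ℝ := N * B + (N : ℝ) ^ 2 * b + 1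

namespace IsTrap

theorem eigen (h : IsTrap κ B b V u ε p) (j : ℕ) :
    ∀ f ∈ formSubmodule κ (fun _ : Unit => (1 : ℝ)) B V,
      inner ℂ f (p j) = ((ε j + B + 1 : ℝ) : ℂ) * inner ℂ (f none) (p j none) := fun f hf => by
  rw [h.basis.eigen j f hf, add_assoc]

theorem aemeasurable_pair (h : IsTrap κ B b V u ε p) : AEMeasurable u :=
  h.integrable.aestronglyMeasurable.aemeasurable

theorem freeEnergy_nonneg (h : IsTrap κ B b V u ε p) {N : ℕ} (k : Fin N → ℕ) :
    0 ≤ ∑ i, (ε (k i) + B) :=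
  Finset.sum_nonneg fun _ _ => zero_le_one.trans (h.one_le _)

variable {n : ℕ}

theorem sum_tensorBasis_le (h : IsTrap κ B b V u ε p)
    {f : FormVec (Fin (n + 1)) (Fin (n + 1) → ℝ)} (hf : f ∈ bosonSubmodule κ B b V u (n + 1))
    (s : Finset (Fin (n + 1) → ℕ)) :
    ∑ k ∈ s, (∑ i, (ε (k i) + B)) *
      ‖inner ℂ (tensorBasis (fun j => p j none) k) (f none)‖ ^ 2 ≤ ‖f‖ ^ 2 := by
  obtain ⟨x, hx, hxf⟩ := exists_isFreeVec h.measurable h.B_nonneg h.bound h.b_nonneg h.pair_bound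
    hf.1
  exact (sum_tensorBasis_le_free h.basis.mem h.eigen h.basis.orthonormal hx s).trans hxf

theorem mem_closure_span (h : IsTrap κ B b V u ε p)
    {f : FormVec (Fin (n + 1)) (Fin (n + 1) → ℝ)} (hf : f ∈ bosonSubmodule κ B b V u (n + 1)) :
    f none ∈ (Submodule.span ℂ (Set.range
      (tensorBasis (N := n + 1) fun j => p j none))).topologicalClosure := by
  obtain ⟨x, hx, hxf⟩ := exists_isFreeVec h.measurable h.B_nonneg h.bound h.b_nonneg h.pair_bound
    hf.1
  exact mem_closure_span_of_isFreeVec h.basis.complete hx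

theorem hasSum_exp_freeEnergy (h : IsTrap κ B b V u ε p) {β : ℝ} (hβ : 0 < β) (N : ℕ) :
    HasSum (fun k : Fin N → ℕ => Real.exp (-β * ∑ i, (ε (k i) + B)))
      ((∑' j, Real.exp (-β * (ε j + B))) ^ N) := by
  simp_rw [Finset.mul_sum, Real.exp_sum]
  exact hasSum_prod_fin (fun j => (Real.exp_pos _).le) (h.summable β hβ) N

theorem finite_freeEnergy_le (h : IsTrap κ B b V u ε p) (N : ℕ) (r : ℝ) :
    {k : Fin N → ℕ | ∑ i, (ε (k i) + B) < r}.Finite := by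
  have h1 := (h.hasSum_exp_freeEnergy zero_lt_one N).summable.tendsto_cofinite_zero
  have h2 := h1.eventually (gt_mem_nhds (Real.exp_pos (-1 * r)))
  refine Set.Finite.subset h2 fun k hk => ?_
  have hk' : ∑ i, (ε (k i) + B) < r := hk
  exact fun hlt => absurd (Real.exp_lt_exp.mp hlt) (by linarith)

theorem form_add (h : IsTrap κ B b V u ε p) {N : ℕ} {f f' : FormVec (Fin N) (Fin N → ℝ)}
    (hf : f ∈ bosonSubmodule κ B b V u N) (hf' : f' ∈ bosonSubmodule κ B b V u N) :
    schrodingerForm κ (coordDir N) (totalPotential N V u) (f none) (f' none) +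
      (bosonShift B b N : ℂ) * inner ℂ (f none) (f' none) = inner ℂ f f' :=
  have := h.B_nonneg
  have := h.b_nonneg
  schrodingerForm_add h.κ_pos (by positivity)
    (neg_le_totalPotential h.bound h.b_nonneg h.pair_bound N) hf.1 hf'.1

theorem mem_bosonDomain_iff (h : IsTrap κ B b V u ε p) {N : ℕ} (f : L2 (Fin N → ℝ)) :
    f ∈ formDomain (coordDir N) (totalPotential N V u) ∩ symmetricFunctions N ↔
      ∃ g ∈ bosonSubmodule κ B b V u N, g none = f :=
  _root_.mem_bosonDomain_iff h.κ_pos h.B_nonneg h.measurable h.bound h.aemeasurable_pair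
    h.b_nonneg h.pair_bound

theorem ae_bounded (h : IsTrap κ B b V u ε p) (j : ℕ) :
    ∃ M : ℝ, 0 ≤ M ∧ ∀ᵐ x, ‖p j none x‖ ≤ M := by
  have h1 := (mem_formDomain_iff h.κ_pos _ h.B_nonneg h.measurable.aemeasurable h.bound
    (p j none)).mpr ⟨p j, h.basis.mem j, rfl⟩
  obtain ⟨g, hg⟩ := h1.1 ()
  obtain ⟨M, hM⟩ := hg.exists_ae_bound
  exact ⟨max M 0, le_max_right _ _, hM.mono fun x hx => hx.trans (le_max_left _ _)⟩

theorem exists_condensate (h : IsTrap κ B b V u ε p) (j n : ℕ) :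
    ∃ f ∈ bosonSubmodule κ B b V u (n + 1), f none = tensorBasis (fun j => p j none) fun _ => j := by
  obtain ⟨M, hM0, hM⟩ := h.ae_bounded j
  obtain ⟨f, hf, hfj, -⟩ := _root_.exists_condensate h.B_nonneg h.measurable h.bound h.integrable
    h.b_nonneg h.pair_bound h.basis.mem h.eigen h.basis.orthonormal hM0 hM n
  exact ⟨f, hf, hfj⟩

theorem exists_eigenbasis (h : IsTrap κ B b V u ε p) (n : ℕ) :
    ∃ (E : ℕ → ℝ) (Ψ : ℕ → L2 (Fin (n + 1) → ℝ)),
      IsEigenbasis (formDomain (coordDir (n + 1)) (totalPotential (n + 1) V u) ∩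
          symmetricFunctions (n + 1))
        (schrodingerForm κ (coordDir (n + 1)) (totalPotential (n + 1) V u)) E Ψ := by
  set Q := bosonSubmodule κ B b V u (n + 1) with hQ
  have hcl : IsClosed (Q : Set (FormVec (Fin (n + 1)) (Fin (n + 1) → ℝ))) :=
    isClosed_bosonSubmodule (n + 1)
  have : CompleteSpace Q := hcl.completeSpace_coe
  let J : Q →L[ℂ] L2 (Fin (n + 1) → ℝ) :=
    (PiLp.proj 2 (fun _ : Option (Option (Fin (n + 1))) => L2 (Fin (n + 1) → ℝ)) none).comp Q.subtypeL
  refine exists_isEigenbasis (c := bosonShift B b (n + 1)) ?_ J ?_ ?_ ?_ ?_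
  -- the condensates in the different levels are orthogonal
  · intro hfin
    choose f hf hfj using fun j => h.exists_condensate j n
    have hli : LinearIndependent ℂ fun j => (⟨f j, hf j⟩ : Q) := by
      refine LinearIndependent.of_comp J.toLinearMap ?_
      have horth : Orthonormal ℂ fun j : ℕ =>
          tensorBasis (N := n + 1) (fun j => p j none) fun _ => j :=
        (orthonormal_tensorBasis h.basis.orthonormal (n + 1)).comp (fun j _ => j)
          fun i j hij => congrFun hij 0
      have he : (J.toLinearMap ∘ fun j => (⟨f j, hf j⟩ : Q)) = fun j : ℕ =>
          tensorBasis (N := n + 1) (fun j => p j none) fun _ => j := funext hfj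
      rw [he]
      exact horth.linearIndependent
    exact not_finite_iff_infinite.mpr (inferInstanceAs (Infinite ℕ)) hli.finite
  · refine isCompactOperator_of_tail J (orthonormal_tensorBasis h.basis.orthonormal (n + 1))
      (fun f => h.mem_closure_span f.2) fun δ hδ => ?_
    -- only finitely many product states have an energy below `δ⁻¹`
    refine ⟨(h.finite_freeEnergy_le (n + 1) δ⁻¹).toFinset, fun f t ht => ?_⟩
    have h1 := h.sum_tensorBasis_le f.2 t
    rw [← inv_mul_le_iff₀ hδ, Finset.mul_sum]
    refine le_trans (Finset.sum_le_sum fun k hk => ?_) h1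
    refine mul_le_mul_of_nonneg_right ?_ (by positivity)
    by_contra hlt
    exact Finset.disjoint_right.mp ht hk (by simpa using hlt)
  -- the form of `f`, and hence its norm in `Q`, depends only on the first component
  · rw [injective_iff_map_eq_zero]
    intro f hf
    have h1 := h.form_add f.2 f.2
    have h0 := h.form_add Q.zero_mem Q.zero_mem
    have hf0 : (f : FormVec (Fin (n + 1)) (Fin (n + 1) → ℝ)) none =
      (0 : FormVec (Fin (n + 1)) (Fin (n + 1) → ℝ)) none := hf
    rw [hf0, h0, inner_zero_left] at h1
    exact Subtype.ext (inner_self_eq_zero.mp h1.symm)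
  · ext f
    rw [h.mem_bosonDomain_iff]
    exact ⟨fun ⟨g, hg, hgf⟩ => ⟨⟨g, hg⟩, hgf⟩, fun ⟨g, hgf⟩ => ⟨g, g.2, hgf⟩⟩
  · exact fun v w => h.form_add v.2 w.2

end IsTrap

end BosonEigenbasis

/-! ### Superharmonic spectra -/

section Superharmonic

variable {ε : ℕ → ℝ}

theorem eventually_le_mul (hε : Monotone ε) (h : (fun n : ℕ => (n : ℝ)) =o[atTop] ε) {δ : ℝ}
    (hδ : 0 < δ) : ∀ᶠ n : ℕ in atTop, (n : ℝ) ≤ δ * ε n := by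
  obtain ⟨m, hm⟩ := exists_nat_gt |ε 0|
  filter_upwards [h.bound hδ, h.bound one_pos, eventually_ge_atTop m] with n h1 h2 h3
  rw [Real.norm_natCast, Real.norm_eq_abs] at h1 h2
  suffices h0 : 0 ≤ ε n by rwa [abs_of_nonneg h0] at h1
  by_contra! h0
  have h4 : (m : ℝ) ≤ n := by exact_mod_cast h3
  have h5 := hε (Nat.zero_le n)
  rw [abs_of_neg h0] at h2
  rw [abs_of_neg (h5.trans_lt h0)] at hm
  linarith

theorem summable_exp_of_isLittleO (hε : Monotone ε) (h : (fun n : ℕ => (n : ℝ)) =o[atTop] ε)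
    (B : ℝ) {β : ℝ} (hβ : 0 < β) : Summable fun j => Real.exp (-β * (ε j + B)) := by
  refine Summable.of_norm_bounded_eventually_nat
    (g := fun j : ℕ => Real.exp (-β * B) * Real.exp (-j)) (Real.summable_exp_neg_nat.mul_left _) ?_
  filter_upwards [eventually_le_mul hε h hβ] with j hj
  rw [Real.norm_eq_abs, abs_of_pos (Real.exp_pos _), ← Real.exp_add]
  exact Real.exp_le_exp.mpr (by linarith)

/-- For a superharmonic spectrum there is room for levels `J(N)` between `J(N) = o(N)` and
`N = o(ε_{J(N)})`. -/
theorem exists_levels (hε : Monotone ε) (h : (fun n : ℕ => (n : ℝ)) =o[atTop] ε) :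
    ∃ J : ℕ → ℕ, (fun N => (J N : ℝ)) =o[atTop] (fun N : ℕ => (N : ℝ)) ∧
      (fun N : ℕ => (N : ℝ)) =o[atTop] (fun N => ε (J N)) := by
  have hex : ∀ N : ℕ, ∃ j : ℕ, (N : ℝ) ^ 2 ≤ j * ε j := fun N => by
    obtain ⟨j, hj, hjN⟩ := ((eventually_le_mul hε h one_pos).and (eventually_ge_atTop N)).exists
    refine ⟨j, ?_⟩
    have h1 : (N : ℝ) ≤ j := by exact_mod_cast hjN
    have h0 : (0 : ℝ) ≤ N := N.cast_nonneg
    rw [sq]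
    exact mul_le_mul h1 (by linarith) h0 (by linarith)
  classical
  -- the first level at which `j εⱼ` reaches `N²` lies between the two scales
  let J : ℕ → ℕ := fun N => Nat.find (hex N)
  have hJ : ∀ N : ℕ, (N : ℝ) ^ 2 ≤ J N * ε (J N) := fun N => Nat.find_spec (hex N)
  have hJlt : ∀ N j : ℕ, j < J N → (j : ℝ) * ε j < (N : ℝ) ^ 2 := fun N j hj =>
    not_le.mp (Nat.find_min (hex N) hj)
  have hsq : Tendsto (fun N : ℕ => (N : ℝ) ^ 2) atTop atTop :=
    (tendsto_pow_atTop two_ne_zero).comp tendsto_natCast_atTop_atTop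
  have hJtop : Tendsto J atTop atTop := by
    refine tendsto_atTop.mpr fun m => ?_
    have : ∀ᶠ N : ℕ in atTop, ∀ j ∈ Finset.range m, (j : ℝ) * ε j < (N : ℝ) ^ 2 :=
      (Finset.eventually_all _).mpr fun j _ => hsq.eventually_gt_atTop _
    filter_upwards [this] with N hN
    by_contra! hlt
    exact absurd (hJ N) (not_le.mpr (hN _ (Finset.mem_range.mpr hlt)))
  refine ⟨J, IsLittleO.of_bound fun δ hδ => ?_, IsLittleO.of_bound fun δ hδ => ?_⟩
  · have hδ2 : 0 < δ / 2 := by positivity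
    have hpred : Tendsto (fun N => J N - 1) atTop atTop :=
      (tendsto_sub_atTop_nat 1).comp hJtop
    filter_upwards [hpred.eventually (eventually_le_mul hε h (pow_pos hδ2 2)),
      hJtop.eventually_ge_atTop 1,
      (tendsto_natCast_atTop_atTop (R := ℝ)).eventually_ge_atTop (2 / δ)] with N h1 h2 h3
    obtain ⟨k, hk⟩ := Nat.exists_eq_add_of_le h2
    have hlt := hJlt N k (by omega)
    have hk1 : J N - 1 = k := by omega
    rw [hk1] at h1
    rw [Real.norm_natCast, Real.norm_natCast, hk]
    have hk0 : (0 : ℝ) ≤ k := k.cast_nonneg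
    have h4 : (k : ℝ) ≤ δ / 2 * N := by
      refine le_of_sq_le_sq ?_ (by positivity)
      calc (k : ℝ) ^ 2 ≤ k * ((δ / 2) ^ 2 * ε k) := by
            rw [sq]
            exact mul_le_mul_of_nonneg_left h1 hk0
        _ = (δ / 2) ^ 2 * (k * ε k) := by ring
        _ ≤ (δ / 2) ^ 2 * (N : ℝ) ^ 2 := by gcongr
        _ = _ := by ring
    have h5 : 1 ≤ δ / 2 * N := by
      rw [div_le_iff₀ hδ] at h3
      linarith
    push_cast
    linarith
  · filter_upwards [hJtop.eventually (eventually_le_mul hε h (pow_pos hδ 2)),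
      hJtop.eventually_ge_atTop 1] with N h1 h2
    have hJ1 : (1 : ℝ) ≤ J N := by exact_mod_cast h2
    have h0 : 0 < ε (J N) := by
      by_contra! hle
      nlinarith [pow_pos hδ 2]
    rw [Real.norm_natCast, Real.norm_eq_abs, abs_of_pos h0]
    refine le_of_sq_le_sq ?_ (by positivity)
    calc (N : ℝ) ^ 2 ≤ J N * ε (J N) := hJ N
      _ ≤ δ ^ 2 * ε (J N) * ε (J N) := by gcongr
      _ = _ := by ring

theorem exists_isTrap {κ : ℝ} (hκ : 0 < κ) {V : ℝ → EReal} (hV : Measurable V)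
    (hVb : ∃ B : ℝ, ∀ x, (B : EReal) ≤ V x) {u : ℝ → ℝ} (hu : Integrable u)
    (hub : ∃ B : ℝ, ∀ x, B ≤ u x) (hε : Monotone ε) (h : (fun n : ℕ => (n : ℝ)) =o[atTop] ε)
    {φ : ℕ → L2 ℝ} (hφ : IsEigenbasis (formDomain (fun _ : Unit => (1 : ℝ)) V)
      (schrodingerForm κ (fun _ : Unit => (1 : ℝ)) V) ε φ) :
    ∃ B b p, IsTrap κ B b V u ε p ∧ ∀ j, p j none = φ j := by
  obtain ⟨B', hB'⟩ := hVb
  obtain ⟨b', hb'⟩ := hub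
  set B := |B'| + |ε 0| + 1
  have hB : 0 ≤ B := by positivity
  have hVB : ∀ x, ((-B : ℝ) : EReal) ≤ V x := fun x =>
    (EReal.coe_le_coe_iff.mpr (by
      have := neg_abs_le B'
      have := abs_nonneg (ε 0)
      linarith)).trans (hB' x)
  obtain ⟨p, hp, hpφ⟩ := hφ.exists_isFormEigenbasis
    (Q := formSubmodule κ (fun _ : Unit => (1 : ℝ)) B V) (c := B + 1)
    (mem_formDomain_iff hκ _ hB hV.aemeasurable hVB)
    fun h hh h' hh' => schrodingerForm_add hκ hB hVB hh hh'
  refine ⟨B, |b'|, p, ⟨hκ, hB, abs_nonneg _, hV, hVB, hu,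
    fun x => (neg_abs_le b').trans (hb' x), hp, fun j => ?_,
    fun β hβ => summable_exp_of_isLittleO hε h B hβ⟩, hpφ⟩
  have := hε (Nat.zero_le j)
  have := neg_abs_le (ε 0)
  have := abs_nonneg B'
  linarith

end Superharmonic

/-! ### Positive operators of finite trace -/

section Trace

variable {F : Type*} [NormedAddCommGroup F] [InnerProductSpace ℂ F]

/-- The Cauchy–Schwarz inequality for the form of a positive operator. -/
theorem ContinuousLinearMap.IsPositive.norm_inner_sq_le {T : F →L[ℂ] F} (hT : T.IsPositive)
    (x y : F) : ‖inner ℂ x (T y)‖ ^ 2 ≤ (inner ℂ x (T x)).re * (inner ℂ y (T y)).re := by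
  have hsym : ∀ x y, inner ℂ x (T y) = starRingEnd ℂ (inner ℂ y (T x)) := fun x y => by
    rw [inner_conj_symm]
    exact (hT.isSymmetric x y).symm
  let c : PreInnerProductSpace.Core ℂ F :=
    { inner := fun x y => inner ℂ x (T y)
      conj_inner_symm := fun x y => (hsym x y).symm
      re_inner_nonneg := fun x => hT.re_inner_nonneg_right x
      add_left := fun x y z => inner_add_left _ _ _
      smul_left := fun x y r => inner_smul_left _ _ _ }
  have h := @InnerProductSpace.Core.inner_mul_inner_self_le ℂ F _ _ _ c x y
  have h2 : ‖inner ℂ y (T x)‖ = ‖inner ℂ x (T y)‖ := by rw [hsym x y, RCLike.norm_conj]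
  have h3 : ‖inner ℂ x (T y)‖ * ‖inner ℂ y (T x)‖ ≤
    (inner ℂ x (T x)).re * (inner ℂ y (T y)).re := h
  rwa [h2, ← sq] at h3

/-- A positive operator of finite trace is compact. -/
theorem isCompactOperator_of_sum_le [CompleteSpace F] {T : F →L[ℂ] F} (hT : T.IsPositive) {C : ℝ}
    (hC : ∀ (w : Set F) (v : w → F), Orthonormal ℂ v → ∀ s : Finset w,
      ∑ i ∈ s, (inner ℂ (v i) (T (v i))).re ≤ C) : IsCompactOperator T := by
  obtain ⟨w, b, hb⟩ := exists_hilbertBasis ℂ F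
  have hv := b.orthonormal
  have hnn : ∀ x, 0 ≤ (inner ℂ x (T x)).re := fun x => hT.re_inner_nonneg_right x
  have hs : Summable fun i => (inner ℂ (b i) (T (b i))).re :=
    summable_of_sum_le (fun i => hnn _) (hC _ _ hv)
  refine isCompactOperator_of_tail T hv (fun h => by rw [b.dense_span]; trivial) fun δ hδ => ?_
  obtain ⟨s, hsδ⟩ := summable_iff_vanishing_norm.mp hs (δ / (‖T‖ + 1)) (by positivity)
  refine ⟨s, fun h t ht => ?_⟩
  have h1 := hsδ t ht.symm
  rw [Real.norm_eq_abs, abs_of_nonneg (Finset.sum_nonneg fun i _ => hnn _)] at h1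
  have h2 : (inner ℂ h (T h)).re ≤ (‖T‖ + 1) * ‖h‖ ^ 2 := by
    refine (Complex.re_le_norm _).trans ((norm_inner_le_norm _ _).trans ?_)
    have := T.le_opNorm h
    nlinarith [norm_nonneg h, sq_nonneg ‖h‖]
  calc ∑ i ∈ t, ‖inner ℂ (b i) (T h)‖ ^ 2
      ≤ ∑ i ∈ t, (inner ℂ (b i) (T (b i))).re * (inner ℂ h (T h)).re :=
        Finset.sum_le_sum fun i _ => hT.norm_inner_sq_le _ _
    _ = (∑ i ∈ t, (inner ℂ (b i) (T (b i))).re) * (inner ℂ h (T h)).re :=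
        (Finset.sum_mul _ _ _).symm
    _ ≤ δ / (‖T‖ + 1) * ((‖T‖ + 1) * ‖h‖ ^ 2) :=
        mul_le_mul h1.le h2 (hnn h) (by positivity)
    _ = δ * ‖h‖ ^ 2 := by field_simp

end Trace

/-! ### Thermal averages -/

section Thermal

variable {β : ℝ} {E : ℕ → ℝ}

/-- The weight of the `k`-th eigenstate in the thermal equilibrium state. -/
noncomputable def gibbsWeight (β : ℝ) (E : ℕ → ℝ) (k : ℕ) : ℝ :=
  Real.exp (-β * E k) / ∑' j, Real.exp (-β * E j)

theorem gibbsMean_eq (a : ℕ → ℂ) : gibbsMean β E a = ∑' k, (gibbsWeight β E k : ℂ) * a k := by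
  rw [gibbsMean, ← tsum_div_const]
  refine tsum_congr fun k => ?_
  rw [gibbsWeight, Complex.ofReal_div]
  ring

theorem gibbsWeight_add_const (c : ℝ) : gibbsWeight β (fun k => E k + c) = gibbsWeight β E := by
  funext k
  have h : ∀ j, Real.exp (-β * (E j + c)) = Real.exp (-β * c) * Real.exp (-β * E j) := fun j => by
    rw [← Real.exp_add]
    ring_nf
  simp_rw [gibbsWeight, h]
  rw [tsum_mul_left, mul_div_mul_left _ _ (Real.exp_pos _).ne']

theorem summable_exp_add_const {c : ℝ} (h : Summable fun k => Real.exp (-β * (E k + c))) :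
    Summable fun k => Real.exp (-β * E k) := by
  refine (h.mul_left (Real.exp (β * c))).congr fun k => ?_
  rw [← Real.exp_add]
  ring_nf

theorem gibbsWeight_nonneg (k : ℕ) : 0 ≤ gibbsWeight β E k :=
  div_nonneg (Real.exp_pos _).le (tsum_nonneg fun _ => (Real.exp_pos _).le)

theorem tsum_exp_pos (hs : Summable fun k => Real.exp (-β * E k)) :
    0 < ∑' k, Real.exp (-β * E k) :=
  hs.tsum_pos (fun _ => (Real.exp_pos _).le) 0 (Real.exp_pos _)

theorem hasSum_gibbsWeight (hs : Summable fun k => Real.exp (-β * E k)) :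
    HasSum (gibbsWeight β E) 1 := by
  have h := hs.hasSum.div_const (∑' k, Real.exp (-β * E k))
  rwa [div_self (tsum_exp_pos hs).ne'] at h

/-- The mean energy at the inverse temperature `β` is controlled by the quotient of the partition
functions at `β / 2` and at `β`. -/
theorem gibbs_energy_le (hβ : 0 < β) {a : ℕ → ℝ} (ha : ∀ k, 0 ≤ a k)
    (hs : Summable fun k => Real.exp (-β * a k))
    (hs2 : Summable fun k => Real.exp (-(β / 2) * a k)) {L : ℝ}
    (hL : ∑' k, Real.exp (-(β / 2) * a k) ≤ Real.exp L * ∑' k, Real.exp (-β * a k)) :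
    Summable (fun k => gibbsWeight β a k * a k) ∧
      ∑' k, gibbsWeight β a k * a k ≤ 2 / β * L := by
  set Z := ∑' k, Real.exp (-β * a k) with hZ
  have hZ0 : 0 < Z := tsum_exp_pos hs
  -- the tangent of the exponential function at `L`
  have hpt : ∀ k, gibbsWeight β a k * a k ≤ 2 / β *
      ((L - 1) * gibbsWeight β a k + Real.exp (-L) / Z * Real.exp (-(β / 2) * a k)) := by
    intro k
    have h1 := Real.add_one_le_exp (β / 2 * a k - L)
    have h2 : Real.exp (-β * a k) * Real.exp (β / 2 * a k - L) =
        Real.exp (-L) * Real.exp (-(β / 2) * a k) := by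
      rw [← Real.exp_add, ← Real.exp_add]
      ring_nf
    have h3 : a k ≤ 2 / β * (L - 1 + Real.exp (β / 2 * a k - L)) := by
      rw [div_mul_eq_mul_div, le_div_iff₀ hβ]
      linarith
    calc gibbsWeight β a k * a k
        ≤ gibbsWeight β a k * (2 / β * (L - 1 + Real.exp (β / 2 * a k - L))) :=
          mul_le_mul_of_nonneg_left h3 (gibbsWeight_nonneg k)
      _ = 2 / β * ((L - 1) * gibbsWeight β a k +
            Real.exp (-β * a k) * Real.exp (β / 2 * a k - L) / Z) := by
          rw [gibbsWeight]
          ring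
      _ = _ := by
          rw [h2]
          ring
  have hbd : HasSum (fun k => 2 / β *
      ((L - 1) * gibbsWeight β a k + Real.exp (-L) / Z * Real.exp (-(β / 2) * a k)))
      (2 / β * ((L - 1) * 1 + Real.exp (-L) / Z * ∑' k, Real.exp (-(β / 2) * a k))) :=
    (((hasSum_gibbsWeight hs).mul_left _).add (hs2.hasSum.mul_left _)).mul_left _
  have hsum : Summable fun k => gibbsWeight β a k * a k :=
    hbd.summable.of_nonneg_of_le (fun k => mul_nonneg (gibbsWeight_nonneg k) (ha k)) hpt
  refine ⟨hsum, (hsum.tsum_le_tsum hpt hbd.summable).trans ?_⟩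
  rw [hbd.tsum_eq]
  refine mul_le_mul_of_nonneg_left ?_ (by positivity)
  have : Real.exp (-L) / Z * ∑' k, Real.exp (-(β / 2) * a k) ≤ 1 := by
    rw [div_mul_eq_mul_div, div_le_one hZ0, Real.exp_neg, inv_mul_le_iff₀ (Real.exp_pos _)]
    exact hL
  linarith

end Thermal

/-! ### Occupation numbers -/

section Occupation

variable {n : ℕ}

/-- The mean number of particles in the one-particle state `f` if the particles are in the
state `ψ`. -/
noncomputable def occupation (ψ : L2 (Fin (n + 1) → ℝ)) (f : L2 ℝ) : ℝ := ∑ i, ‖contrL i f ψ‖ ^ 2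

theorem rankOneMean_self (ψ : L2 (Fin (n + 1) → ℝ)) (f : L2 ℝ) :
    rankOneMean ψ f f = (occupation ψ f : ℂ) := by
  rw [rankOneMean_eq, occupation, Complex.ofReal_sum]
  refine Finset.sum_congr rfl fun i _ => ?_
  rw [inner_self_eq_norm_sq_to_K]
  norm_cast

theorem occupation_nonneg (ψ : L2 (Fin (n + 1) → ℝ)) (f : L2 ℝ) : 0 ≤ occupation ψ f :=
  Finset.sum_nonneg fun _ _ => by positivity

theorem sum_occupation_le {ψ : L2 (Fin (n + 1) → ℝ)} (hψ : ‖ψ‖ = 1) {ι : Type*} {f : ι → L2 ℝ}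
    (hf : Orthonormal ℂ f) (s : Finset ι) :
    ∑ j ∈ s, occupation ψ (f j) ≤ (n + 1 : ℕ) := by
  simp_rw [occupation]
  rw [Finset.sum_comm]
  refine (Finset.sum_le_sum fun i _ => sum_norm_contrL_sq_le i hf s ψ).trans ?_
  simp [hψ]

/-- The part of `ψ` in the products with `k i < J` is bounded by the occupation of the first `J`
levels in the `i`-th variable: Bessel's inequality in the other variables. -/
theorem sum_filter_tensorBasis_le {φ : ℕ → L2 ℝ} (hφ : Orthonormal ℂ φ)
    (ψ : L2 (Fin (n + 1) → ℝ)) (i : Fin (n + 1)) (J : ℕ) (s : Finset (Fin (n + 1) → ℕ)) :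
    ∑ k ∈ s with k i < J, ‖inner ℂ (tensorBasis φ k) ψ‖ ^ 2 ≤
      ∑ j ∈ Finset.range J, ‖contrL i (φ j) ψ‖ ^ 2 := by
  have hmaps : ∀ k ∈ {k ∈ s | k i < J}, k i ∈ Finset.range J := fun k hk =>
    Finset.mem_range.mpr (Finset.mem_filter.mp hk).2
  rw [← Finset.sum_fiberwise_of_maps_to hmaps]
  refine Finset.sum_le_sum fun j _ => ?_
  set t := {k ∈ {k ∈ s | k i < J} | k i = j}
  have ht : ∀ k ∈ t, k i = j := fun k hk => (Finset.mem_filter.mp hk).2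
  have hinj : Set.InjOn (fun k : Fin (n + 1) → ℕ => i.removeNth k) t := by
    intro k hk k' hk' h
    have h' : i.removeNth k = i.removeNth k' := h
    rw [← Fin.insertNth_self_removeNth i k, ← Fin.insertNth_self_removeNth i k', h', ht k hk,
      ht k' hk']
  calc ∑ k ∈ t, ‖inner ℂ (tensorBasis φ k) ψ‖ ^ 2
      = ∑ k ∈ t, ‖inner ℂ (tensorBasis φ (i.removeNth k)) (contrL i (φ j) ψ)‖ ^ 2 := by
        refine Finset.sum_congr rfl fun k hk => ?_
        rw [inner_contrL, tensorBasis, tensorN_eq_tens i, ht k hk]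
        rfl
    _ = ∑ k ∈ t.image fun k => i.removeNth k,
          ‖inner ℂ (tensorBasis φ k) (contrL i (φ j) ψ)‖ ^ 2 :=
        (Finset.sum_image (f := fun k => ‖inner ℂ (tensorBasis φ k) (contrL i (φ j) ψ)‖ ^ 2)
          hinj).symm
    _ ≤ ‖contrL i (φ j) ψ‖ ^ 2 := (orthonormal_tensorBasis hφ n).sum_inner_products_le _

variable {κ B b : ℝ} {V : ℝ → EReal} {u : ℝ → ℝ} {ε : ℕ → ℝ} {p : ℕ → FormVec Unit ℝ}

/-- A state of low energy has few particles above the level `J`. -/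
theorem IsTrap.le_sum_occupation (h : IsTrap κ B b V u ε p) (hε : Monotone ε)
    {f : FormVec (Fin (n + 1)) (Fin (n + 1) → ℝ)} (hf : f ∈ bosonSubmodule κ B b V u (n + 1))
    (hf1 : ‖f none‖ = 1) (J : ℕ) :
    ((n + 1 : ℕ) : ℝ) ≤ (∑ j ∈ Finset.range (J + 1), occupation (f none) (p j none)) +
      ‖f‖ ^ 2 / (ε J + B) := by
  have hJ : 0 < ε J + B := zero_lt_one.trans_le (h.one_le J)
  set a : (Fin (n + 1) → ℕ) → ℝ :=
    fun k => ‖inner ℂ (tensorBasis (fun j => p j none) k) (f none)‖ ^ 2 with ha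
  have ha0 : ∀ k, 0 ≤ a k := fun k => by positivity
  have hsum : HasSum a 1 := by
    have := (orthonormal_tensorBasis h.basis.orthonormal (n + 1)).hasSum_sq_norm_inner
      (h.mem_closure_span hf)
    rwa [hf1, one_pow] at this
  have hlow : ∀ s : Finset (Fin (n + 1) → ℕ), ((n + 1 : ℕ) : ℝ) * ∑ k ∈ s, a k ≤
      (∑ j ∈ Finset.range (J + 1), occupation (f none) (p j none)) + ‖f‖ ^ 2 / (ε J + B) := by
    intro s
    have h1 : ∑ i, ∑ k ∈ s with k i < J + 1, a k ≤
        ∑ j ∈ Finset.range (J + 1), occupation (f none) (p j none) := by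
      simp_rw [occupation]
      rw [Finset.sum_comm (s := Finset.range (J + 1))]
      exact Finset.sum_le_sum fun i _ =>
        sum_filter_tensorBasis_le h.basis.orthonormal (f none) i (J + 1) s
    have h2 : ∑ i, ∑ k ∈ s with ¬ k i < J + 1, a k ≤ ‖f‖ ^ 2 / (ε J + B) := by
      rw [le_div_iff₀ hJ]
      refine le_trans ?_ (h.sum_tensorBasis_le hf s)
      simp_rw [Finset.sum_mul]
      rw [Finset.sum_comm (s := s)]
      refine Finset.sum_le_sum fun i _ => ?_
      refine le_trans (Finset.sum_le_sum (g := fun k => (ε (k i) + B) * a k) fun k hk => ?_)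
        (Finset.sum_le_sum_of_subset_of_nonneg (Finset.filter_subset _ _) fun k _ _ =>
          mul_nonneg (zero_le_one.trans (h.one_le _)) (ha0 k))
      rw [mul_comm]
      have hk' : J ≤ k i := by
        have := (Finset.mem_filter.mp hk).2
        omega
      exact mul_le_mul_of_nonneg_right (by linarith [hε hk']) (ha0 k)
    have h3 : ((n + 1 : ℕ) : ℝ) * ∑ k ∈ s, a k =
        ∑ i : Fin (n + 1), (∑ k ∈ s with k i < J + 1, a k + ∑ k ∈ s with ¬ k i < J + 1, a k) := by
      simp_rw [Finset.sum_filter_add_sum_filter_not]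
      rw [Finset.sum_const, Finset.card_univ, Fintype.card_fin, nsmul_eq_mul]
    rw [h3, Finset.sum_add_distrib]
    exact add_le_add h1 h2
  have hlim : Tendsto (fun s : Finset (Fin (n + 1) → ℕ) => ((n + 1 : ℕ) : ℝ) * ∑ k ∈ s, a k) atTop
      (𝓝 (((n + 1 : ℕ) : ℝ) * 1)) := Tendsto.const_mul _ hsum
  rw [mul_one] at hlim
  exact le_of_tendsto' hlim hlow

end Occupation

/-! ### The reduced density matrix -/

section Density

variable {n : ℕ}

theorem norm_contrR_le (i : Fin (n + 1)) (g : L2 (Fin n → ℝ)) (ψ : L2 (Fin (n + 1) → ℝ)) :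
    ‖contrR i g ψ‖ ≤ ‖g‖ * ‖ψ‖ := by
  refine (ContinuousLinearMap.le_opNorm _ _).trans ?_
  rw [contrR, LinearIsometryEquiv.norm_map]
  refine mul_le_mul_of_nonneg_right ?_ (norm_nonneg _)
  exact ContinuousLinearMap.opNorm_le_bound _ (norm_nonneg _) fun f =>
    (norm_tens i f g).le.trans_eq (mul_comm _ _)

/-- The unnormalized reduced density matrix of the state `ψ`. -/
noncomputable def densityMatrix (ψ : L2 (Fin (n + 1) → ℝ)) : L2 ℝ →L[ℂ] L2 ℝ :=
  LinearMap.mkContinuous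
    { toFun := fun g => ∑ i, contrR i (contrL i g ψ) ψ
      map_add' := fun g g' => by
        simp only [contrL, contrR, map_add, add_apply, Finset.sum_add_distrib]
      map_smul' := fun c g => by
        rw [RingHom.id_apply, Finset.smul_sum]
        refine Finset.sum_congr rfl fun i _ => ?_
        simp only [contrL, contrR, map_smul, LinearIsometryEquiv.map_smulₛₗ, smul_apply,
          starRingEnd_self_apply] }
    ((n + 1 : ℕ) * ‖ψ‖ ^ 2) fun g => by
      refine (norm_sum_le_of_le _ (f := fun i => contrR i (contrL i g ψ) ψ)
        (n := fun _ => ‖g‖ * ‖ψ‖ * ‖ψ‖) fun i _ =>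
          (norm_contrR_le _ _ _).trans (mul_le_mul_of_nonneg_right (norm_contrL_le i g ψ)
            (norm_nonneg _))).trans_eq ?_
      rw [Finset.sum_const, Finset.card_univ, Fintype.card_fin, nsmul_eq_mul]
      ring

theorem norm_densityMatrix_le (ψ : L2 (Fin (n + 1) → ℝ)) :
    ‖densityMatrix ψ‖ ≤ (n + 1 : ℕ) * ‖ψ‖ ^ 2 :=
  LinearMap.mkContinuous_norm_le _ (by positivity) _

theorem inner_densityMatrix (ψ : L2 (Fin (n + 1) → ℝ)) (f g : L2 ℝ) :
    inner ℂ f (densityMatrix ψ g) = rankOneMean ψ g f := by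
  have h : densityMatrix ψ g = ∑ i, contrR i (contrL i g ψ) ψ := rfl
  rw [h, inner_sum, rankOneMean_eq]
  refine Finset.sum_congr rfl fun i _ => ?_
  rw [inner_contrR, inner_contrL]

theorem hasSum_meanOccupation {β : ℝ} {E : ℕ → ℝ} (hs : Summable fun k => Real.exp (-β * E k))
    {Ψ : ℕ → L2 (Fin (n + 1) → ℝ)} (hΨ : ∀ k, ‖Ψ k‖ = 1) (f : L2 ℝ) :
    HasSum (fun k => gibbsWeight β E k * occupation (Ψ k) f) (meanOccupation β E Ψ f) := by
  have hb : ∀ k, occupation (Ψ k) f ≤ (n + 1 : ℕ) * ‖f‖ ^ 2 := fun k => by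
    refine (Finset.sum_le_sum (g := fun _ => ‖f‖ ^ 2) fun i _ => ?_).trans_eq ?_
    · have := norm_contrL_le i f (Ψ k)
      rw [hΨ, mul_one] at this
      gcongr
    · simp
  have hsum : Summable fun k => gibbsWeight β E k * occupation (Ψ k) f :=
    ((hasSum_gibbsWeight hs).summable.mul_right ((n + 1 : ℕ) * ‖f‖ ^ 2)).of_nonneg_of_le
      (fun k => mul_nonneg (gibbsWeight_nonneg k) (occupation_nonneg _ _))
      fun k => mul_le_mul_of_nonneg_left (hb k) (gibbsWeight_nonneg k)
  have he : meanOccupation β E Ψ f = ∑' k, gibbsWeight β E k * occupation (Ψ k) f := by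
    simp_rw [meanOccupation, gibbsMean_eq, rankOneMean_self, ← Complex.ofReal_mul]
    rw [← Complex.ofReal_tsum, Complex.ofReal_re]
  rw [he]
  exact hsum.hasSum

theorem sum_meanOccupation_le {β : ℝ} {E : ℕ → ℝ} (hs : Summable fun k => Real.exp (-β * E k))
    {Ψ : ℕ → L2 (Fin (n + 1) → ℝ)} (hΨ : ∀ k, ‖Ψ k‖ = 1) {ι : Type*} {f : ι → L2 ℝ}
    (hf : Orthonormal ℂ f) (s : Finset ι) :
    ∑ j ∈ s, meanOccupation β E Ψ (f j) ≤ (n + 1 : ℕ) := by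
  have h1 := hasSum_sum fun j (_ : j ∈ s) => hasSum_meanOccupation hs hΨ (f j)
  have h2 := (hasSum_gibbsWeight hs).mul_right ((n + 1 : ℕ) : ℝ)
  rw [one_mul] at h2
  refine hasSum_le (fun k => ?_) h1 h2
  rw [← Finset.mul_sum]
  exact mul_le_mul_of_nonneg_left (sum_occupation_le (hΨ k) hf s) (gibbsWeight_nonneg k)

theorem exists_isReducedDensityMatrix {β : ℝ} {E : ℕ → ℝ}
    (hs : Summable fun k => Real.exp (-β * E k))
    {Ψ : ℕ → L2 (Fin (n + 1) → ℝ)} (hΨ : ∀ k, ‖Ψ k‖ = 1) :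
    ∃ S, IsReducedDensityMatrix β E Ψ S := by
  have hsum : Summable fun k => (gibbsWeight β E k : ℂ) • densityMatrix (Ψ k) := by
    refine Summable.of_norm_bounded (g := fun k => gibbsWeight β E k * (n + 1 : ℕ))
      ((hasSum_gibbsWeight hs).summable.mul_right _) fun k => ?_
    rw [norm_smul, Complex.norm_real, Real.norm_of_nonneg (gibbsWeight_nonneg k)]
    refine mul_le_mul_of_nonneg_left ?_ (gibbsWeight_nonneg k)
    simpa [hΨ k] using norm_densityMatrix_le (Ψ k)
  refine ⟨∑' k, (gibbsWeight β E k : ℂ) • densityMatrix (Ψ k), fun f g => ?_⟩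
  have h1 := hsum.hasSum.mapL (ContinuousLinearMap.apply ℂ (L2 ℝ) g)
  have h2 := h1.mapL (innerSL ℂ f)
  rw [gibbsMean_eq]
  refine Eq.trans h2.tsum_eq.symm (tsum_congr fun k => ?_)
  simp [inner_densityMatrix]

theorem IsReducedDensityMatrix.re_inner {β : ℝ} {E : ℕ → ℝ} {Ψ : ℕ → L2 (Fin (n + 1) → ℝ)}
    {S : L2 ℝ →L[ℂ] L2 ℝ} (hS : IsReducedDensityMatrix β E Ψ S) (f : L2 ℝ) :
    (inner ℂ f (S f)).re = meanOccupation β E Ψ f := by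
  rw [hS f f]
  rfl

theorem IsReducedDensityMatrix.isPositive {β : ℝ} {E : ℕ → ℝ}
    (hs : Summable fun k => Real.exp (-β * E k))
    {Ψ : ℕ → L2 (Fin (n + 1) → ℝ)} (hΨ : ∀ k, ‖Ψ k‖ = 1) {S : L2 ℝ →L[ℂ] L2 ℝ}
    (hS : IsReducedDensityMatrix β E Ψ S) : S.IsPositive := by
  refine ⟨fun f g => ?_, fun f => ?_⟩
  · have h : inner ℂ (S f) g = inner ℂ f (S g) := by
      rw [← inner_conj_symm, hS, hS, gibbsMean_eq, gibbsMean_eq, Complex.conj_tsum]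
      refine tsum_congr fun k => ?_
      rw [map_mul, Complex.conj_ofReal, rankOneMean_eq, rankOneMean_eq, map_sum]
      simp_rw [inner_conj_symm]
    exact h
  · rw [ContinuousLinearMap.reApplyInnerSelf_apply, inner_re_symm]
    refine le_of_le_of_eq ?_ (hS.re_inner f).symm
    exact (hasSum_meanOccupation hs hΨ f).nonneg fun k =>
      mul_nonneg (gibbsWeight_nonneg k) (occupation_nonneg _ _)

theorem IsReducedDensityMatrix.exists_isDecreasingEigenvalues {β : ℝ} {E : ℕ → ℝ}
    (hs : Summable fun k => Real.exp (-β * E k))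
    {Ψ : ℕ → L2 (Fin (n + 1) → ℝ)} (hΨ : ∀ k, ‖Ψ k‖ = 1) {S : L2 ℝ →L[ℂ] L2 ℝ}
    (hS : IsReducedDensityMatrix β E Ψ S) (hinf : ¬ FiniteDimensional ℂ (L2 ℝ)) :
    ∃ lam, IsDecreasingEigenvalues S lam := by
  have hpos := hS.isPositive hs hΨ
  refine _root_.exists_isDecreasingEigenvalues hinf
    (isCompactOperator_of_sum_le hpos (C := (n + 1 : ℕ)) fun w v hv s => ?_) hpos
  simp_rw [hS.re_inner]
  exact sum_meanOccupation_le hs hΨ hv s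

end Density

/-! ### The thermal state of the bosons -/

section BosonThermal

variable {κ B b : ℝ} {V : ℝ → EReal} {u : ℝ → ℝ} {ε : ℕ → ℝ} {p : ℕ → FormVec Unit ℝ}

namespace IsTrap

variable {n : ℕ} {E : ℕ → ℝ} {g : ℕ → FormVec (Fin (n + 1)) (Fin (n + 1) → ℝ)}

theorem exists_isFormEigenbasis (h : IsTrap κ B b V u ε p)
    {Ψ : ℕ → L2 (Fin (n + 1) → ℝ)}
    (hΨ : IsEigenbasis (formDomain (coordDir (n + 1)) (totalPotential (n + 1) V u) ∩
          symmetricFunctions (n + 1))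
        (schrodingerForm κ (coordDir (n + 1)) (totalPotential (n + 1) V u)) E Ψ) :
    ∃ g, IsFormEigenbasis (bosonSubmodule κ B b V u (n + 1)) (bosonShift B b (n + 1)) E g ∧
      ∀ k, g k none = Ψ k :=
  hΨ.exists_isFormEigenbasis h.mem_bosonDomain_iff fun _ hf _ hf' => h.form_add hf hf'

/-- The partition function of the bosons is at most that of distinguishable independent particles. -/
theorem summable_exp_shifted (h : IsTrap κ B b V u ε p)
    (hg : IsFormEigenbasis (bosonSubmodule κ B b V u (n + 1)) (bosonShift B b (n + 1)) E g)
    {β : ℝ} (hβ : 0 < β) :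
    Summable (fun k => Real.exp (-β * (E k + bosonShift B b (n + 1)))) ∧
      ∑' k, Real.exp (-β * (E k + bosonShift B b (n + 1))) ≤
        (∑' j, Real.exp (-β * (ε j + B))) ^ (n + 1) := by
  have hX : ∀ k, ∀ s : Finset (Fin (n + 1) → ℕ), ∑ m ∈ s, (∑ i, (ε (m i) + B)) *
      ‖inner ℂ (tensorBasis (fun j => p j none) m) (g k none)‖ ^ 2 ≤
        E k + bosonShift B b (n + 1) := fun k s => by
    rw [← hg.norm_sq]
    exact h.sum_tensorBasis_le (hg.mem k) s
  have hZ := h.hasSum_exp_freeEnergy hβ (n + 1)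
  have hle := sum_exp_neg_le (orthonormal_tensorBasis h.basis.orthonormal (n + 1)) hg.orthonormal
    (fun k => h.mem_closure_span (hg.mem k)) h.freeEnergy_nonneg hβ.le hX hZ.summable
  have hs := summable_of_sum_le (fun _ => (Real.exp_pos _).le) hle
  refine ⟨hs, ?_⟩
  rw [← hZ.tsum_eq]
  exact hs.tsum_le_of_sum_le hle

/-- A single trial state bounds the partition function from below. -/
theorem le_tsum_exp_shifted (h : IsTrap κ B b V u ε p)
    (hg : IsFormEigenbasis (bosonSubmodule κ B b V u (n + 1)) (bosonShift B b (n + 1)) E g)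
    {β : ℝ} (hβ : 0 < β) {f : FormVec (Fin (n + 1)) (Fin (n + 1) → ℝ)}
    (hf : f ∈ bosonSubmodule κ B b V u (n + 1)) (hf1 : ‖f none‖ = 1) :
    Real.exp (-β * ‖f‖ ^ 2) ≤ ∑' k, Real.exp (-β * (E k + bosonShift B b (n + 1))) := by
  have hw : Orthonormal ℂ fun _ : Unit => f none := by
    refine ⟨fun _ => hf1, fun i j hij => (hij (Subsingleton.elim i j)).elim⟩
  have := sum_exp_neg_le hg.orthonormal hw (fun _ => hg.complete f hf)
    (X := fun _ => ‖f‖ ^ 2) (fun k => zero_le_one.trans (hg.one_le k)) hβ.le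
    (fun _ s => hg.sum_le hf s) (h.summable_exp_shifted hg hβ).1 Finset.univ
  simpa using this

/-- The mean energy is at most quadratic in the number of particles. -/
theorem exists_energy_bound (h : IsTrap κ B b V u ε p) {β : ℝ} (hβ : 0 < β) :
    ∃ K : ℝ, ∀ (n : ℕ) (E : ℕ → ℝ) (g : ℕ → FormVec (Fin (n + 1)) (Fin (n + 1) → ℝ)),
      IsFormEigenbasis (bosonSubmodule κ B b V u (n + 1)) (bosonShift B b (n + 1)) E g →
      Summable (fun k => gibbsWeight β E k * (E k + bosonShift B b (n + 1))) ∧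
      ∑' k, gibbsWeight β E k * (E k + bosonShift B b (n + 1)) ≤ K * ((n + 1 : ℕ) : ℝ) ^ 2 := by
  obtain ⟨M, hM0, hM⟩ := h.ae_bounded 0
  set z := ∑' j, Real.exp (-(β / 2) * (ε j + B)) with hz
  have hz0 : 0 ≤ z := tsum_nonneg fun _ => (Real.exp_pos _).le
  set U := M ^ 2 * (∫ t, ‖u t‖) + b
  refine ⟨2 / β * (z + β * (1 + (ε 0 + B) + U)), fun n E g hg => ?_⟩
  obtain ⟨f, hf, hfΦ, hfn⟩ := _root_.exists_condensate h.B_nonneg h.measurable h.bound h.integrable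
    h.b_nonneg h.pair_bound h.basis.mem h.eigen h.basis.orthonormal hM0 hM n
  have hf1 : ‖f none‖ = 1 := by
    rw [hfΦ]
    exact (orthonormal_tensorBasis h.basis.orthonormal (n + 1)).1 _
  obtain ⟨hs, -⟩ := h.summable_exp_shifted hg hβ
  obtain ⟨hs2, hZ2⟩ := h.summable_exp_shifted hg (half_pos hβ)
  have hlow := h.le_tsum_exp_shifted hg hβ hf hf1
  set N : ℝ := ((n + 1 : ℕ) : ℝ)
  have hN : 1 ≤ N := Nat.one_le_cast.mpr (by omega)
  have hL : ∑' k, Real.exp (-(β / 2) * (E k + bosonShift B b (n + 1))) ≤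
      Real.exp (N * z + β * ‖f‖ ^ 2) *
        ∑' k, Real.exp (-β * (E k + bosonShift B b (n + 1))) := by
    calc ∑' k, Real.exp (-(β / 2) * (E k + bosonShift B b (n + 1)))
        ≤ z ^ (n + 1) := hZ2
      _ ≤ Real.exp z ^ (n + 1) := by
          gcongr
          linarith [Real.add_one_le_exp z]
      _ = Real.exp (N * z + β * ‖f‖ ^ 2) * Real.exp (-β * ‖f‖ ^ 2) := by
          rw [← Real.exp_nat_mul, ← Real.exp_add]
          congr 1
          ring
      _ ≤ _ := by gcongr
  obtain ⟨h1, h2⟩ := gibbs_energy_le hβ (fun k => zero_le_one.trans (hg.one_le k)) hs hs2 hL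
  rw [gibbsWeight_add_const] at h1 h2
  refine ⟨h1, h2.trans ?_⟩
  rw [mul_assoc]
  refine mul_le_mul_of_nonneg_left ?_ (by positivity)
  have h3 := h.one_le 0
  have hNN : N ≤ N ^ 2 := by nlinarith
  have h4 : ‖f‖ ^ 2 ≤ (1 + (ε 0 + B) + U) * N ^ 2 := by
    refine hfn.trans ?_
    have h5 : N * (ε 0 + B) ≤ N ^ 2 * (ε 0 + B) :=
      mul_le_mul_of_nonneg_right hNN (by linarith)
    linarith
  have h6 : N * z ≤ N ^ 2 * z := mul_le_mul_of_nonneg_right hNN hz0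
  have h7 := mul_le_mul_of_nonneg_left h4 hβ.le
  linarith

theorem summable_exp (h : IsTrap κ B b V u ε p)
    (hg : IsFormEigenbasis (bosonSubmodule κ B b V u (n + 1)) (bosonShift B b (n + 1)) E g)
    {β : ℝ} (hβ : 0 < β) : Summable fun k => Real.exp (-β * E k) :=
  summable_exp_add_const (h.summable_exp_shifted hg hβ).1

/-- All but few of the particles occupy the levels up to `J`. -/
theorem le_sum_meanOccupation (h : IsTrap κ B b V u ε p) (hε : Monotone ε)
    (hg : IsFormEigenbasis (bosonSubmodule κ B b V u (n + 1)) (bosonShift B b (n + 1)) E g)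
    {β : ℝ} (hβ : 0 < β)
    (hs : Summable fun k => gibbsWeight β E k * (E k + bosonShift B b (n + 1))) (J : ℕ) :
    ((n + 1 : ℕ) : ℝ) ≤ (∑ j ∈ Finset.range (J + 1),
        meanOccupation β E (fun k => g k none) (p j none)) +
      (∑' k, gibbsWeight β E k * (E k + bosonShift B b (n + 1))) / (ε J + B) := by
  have hsum := h.summable_exp hg hβ
  have h1 := hasSum_sum fun j (_ : j ∈ Finset.range (J + 1)) =>
    hasSum_meanOccupation hsum hg.orthonormal.1 (p j none)
  have h2 := (hasSum_gibbsWeight hsum).mul_right ((n + 1 : ℕ) : ℝ)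
  rw [one_mul] at h2
  refine hasSum_le (fun k => ?_) h2 (h1.add (hs.hasSum.div_const (ε J + B)))
  rw [← Finset.mul_sum, mul_div_assoc, ← mul_add]
  refine mul_le_mul_of_nonneg_left ?_ (gibbsWeight_nonneg k)
  rw [← hg.norm_sq]
  exact h.le_sum_occupation hε (hg.mem k) (hg.orthonormal.1 k) J

end IsTrap

end BosonThermal

theorem theorem2
    (hbar m : ℝ) (hhbar : 0 < hbar) (hm : 0 < m)
    -- the trap; `V = +∞` is allowed, so that boxes are included
    (V : ℝ → EReal) (hV : Measurable V) (hVbelow : ∃ B : ℝ, ∀ x, (B : EReal) ≤ V x)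
    -- the discrete spectrum of the one-particle Hamiltonian, in increasing order
    (ε : ℕ → ℝ) (φ : ℕ → L2 ℝ) (hε : Monotone ε) (hφ : IsOneParticleEigenbasis hbar m V ε φ)
    -- the trap is superharmonic: `n / ε n → 0`
    (hsuper : (fun n : ℕ => (n : ℝ)) =o[atTop] ε)
    -- the pair interaction, independent of the number of particles
    (u : ℝ → ℝ) (hu : Integrable u) (hubelow : ∃ B : ℝ, ∀ x, B ≤ u x)
    (β : ℝ) (hβ : 0 < β) :
    -- the thermal equilibrium state and its reduced density matrix are well defined
    (∀ N : ℕ, 0 < N → ∃ (E : ℕ → ℝ) (Ψ : ℕ → L2 (Fin N → ℝ)) (S : L2 ℝ →L[ℂ] L2 ℝ) (lam : ℕ → ℝ),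
      IsBosonEigenbasis hbar m V u N E Ψ ∧ Summable (fun k => Real.exp (-β * E k)) ∧
      IsReducedDensityMatrix β E Ψ S ∧ IsDecreasingEigenvalues S lam) ∧
    -- there are `J(N)` with `J / N → 0` and `N / ε_J → 0`
    (∃ J : ℕ → ℕ, (fun N => (J N : ℝ)) =o[atTop] (fun N : ℕ => (N : ℝ)) ∧
      (fun N : ℕ => (N : ℝ)) =o[atTop] (fun N => ε (J N))) ∧
    -- for each such choice, asymptotically all particles are in `J + 1` states
    ∀ J : ℕ → ℕ, (fun N => (J N : ℝ)) =o[atTop] (fun N : ℕ => (N : ℝ)) →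
      (fun N : ℕ => (N : ℝ)) =o[atTop] (fun N => ε (J N)) →
      ∀ (E : ℕ → ℕ → ℝ) (Ψ : ∀ N : ℕ, ℕ → L2 (Fin N → ℝ)) (S : ℕ → L2 ℝ →L[ℂ] L2 ℝ)
        (lam : ℕ → ℕ → ℝ),
        (∀ N : ℕ, 0 < N → IsBosonEigenbasis hbar m V u N (E N) (Ψ N) ∧
          IsReducedDensityMatrix β (E N) (Ψ N) (S N) ∧ IsDecreasingEigenvalues (S N) (lam N)) →
        Tendsto (fun N : ℕ => (∑ j ∈ Finset.range (J N + 1), lam N j) / (N : ℝ)) atTop (𝓝 1) ∧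
        Tendsto (fun N : ℕ => (∑ j ∈ Finset.range (J N + 1),
          meanOccupation β (E N) (Ψ N) (φ j)) / (N : ℝ)) atTop (𝓝 1) := by
  have hκ : 0 < hbar ^ 2 / (2 * m) := by positivity
  obtain ⟨B, b, p, h, hpφ⟩ := exists_isTrap hκ hV hVbelow hu hubelow hε hsuper hφ
  refine ⟨fun N hN => ?_, exists_levels hε hsuper, fun J hJ hJε E Ψ S lam hall => ?_⟩
  · obtain ⟨n, rfl⟩ := Nat.exists_eq_add_of_le' hN
    obtain ⟨E, Ψ, hΨ⟩ := h.exists_eigenbasis n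
    obtain ⟨g, hg, hgΨ⟩ := h.exists_isFormEigenbasis hΨ
    have hs := h.summable_exp hg hβ
    obtain ⟨S, hS⟩ := exists_isReducedDensityMatrix hs hΨ.orthonormal.1
    have hinf : ¬ FiniteDimensional ℂ (L2 ℝ) := fun hfin =>
      not_finite_iff_infinite.mpr (inferInstanceAs (Infinite ℕ))
        hφ.orthonormal.linearIndependent.finite
    obtain ⟨lam, hlam⟩ := hS.exists_isDecreasingEigenvalues hs hΨ.orthonormal.1 hinf
    exact ⟨E, Ψ, S, lam, hΨ, hs, hS, hlam⟩
  · obtain ⟨K, hK⟩ := h.exists_energy_bound hβ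
    have key : ∀ N : ℕ, 0 < N →
        N ≤ (∑ j ∈ Finset.range (J N + 1), meanOccupation β (E N) (Ψ N) (φ j)) +
          K * (N : ℝ) ^ 2 / (ε (J N) + B) ∧
        ∑ j ∈ Finset.range (J N + 1), meanOccupation β (E N) (Ψ N) (φ j) ≤
          ∑ j ∈ Finset.range (J N + 1), lam N j ∧
        ∑ j ∈ Finset.range (J N + 1), lam N j ≤ N := by
      intro N hN
      obtain ⟨hΨ, hS, hlam⟩ := hall N hN
      obtain ⟨n, rfl⟩ := Nat.exists_eq_add_of_le' hN
      obtain ⟨g, hg, hgΨ⟩ := h.exists_isFormEigenbasis hΨ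
      have hgΨ' : (fun k => g k none) = Ψ (n + 1) := funext hgΨ
      have hs := h.summable_exp hg hβ
      obtain ⟨hK1, hK2⟩ := hK n _ g hg
      refine ⟨?_, ?_, ?_⟩
      · refine (h.le_sum_meanOccupation hε hg hβ hK1 (J (n + 1))).trans ?_
        simp_rw [hgΨ', hpφ]
        have := h.one_le (J (n + 1))
        gcongr
      · simp_rw [← hS.re_inner]
        exact hlam.sum_le hφ.orthonormal _
      · obtain ⟨-, -, χ, hχ, hSχ, -⟩ := hlam
        refine le_of_eq_of_le (Finset.sum_congr rfl fun j _ => ?_)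
          (sum_meanOccupation_le hs hΨ.orthonormal.1 hχ (Finset.range (J (n + 1) + 1)))
        rw [← hS.re_inner, hSχ, inner_smul_right, inner_self_eq_norm_sq_to_K, hχ.1]
        simp
    have hBJ : (fun N : ℕ => (N : ℝ)) =o[atTop] fun N => ε (J N) + B := by
      have hB : (fun _ : ℕ => B) =o[atTop] fun N => ε (J N) :=
        (isLittleO_const_left.mpr (Or.inr
          (tendsto_norm_atTop_atTop.comp tendsto_natCast_atTop_atTop))).trans hJε
      refine hJε.trans_isBigO ?_
      simpa [add_comm] using hB.right_isBigO_add
    have hlim : Tendsto (fun N : ℕ => 1 - K * ((N : ℝ) / (ε (J N) + B))) atTop (𝓝 1) := by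
      simpa using (hBJ.tendsto_div_nhds_zero.const_mul K).const_sub 1
    have hlow : ∀ N : ℕ, 0 < N → 1 - K * ((N : ℝ) / (ε (J N) + B)) ≤
        (∑ j ∈ Finset.range (J N + 1), meanOccupation β (E N) (Ψ N) (φ j)) / (N : ℝ) := by
      intro N hN
      have hN' : (0 : ℝ) < N := by exact_mod_cast hN
      rw [le_div_iff₀ hN']
      have h1 := (key N hN).1
      have h2 : (1 - K * ((N : ℝ) / (ε (J N) + B))) * N = N - K * (N : ℝ) ^ 2 / (ε (J N) + B) := by
        ring
      linarith
    have hpos : ∀ᶠ N : ℕ in atTop, 0 < N := eventually_gt_atTop 0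
    constructor
    · refine tendsto_of_tendsto_of_tendsto_of_le_of_le' hlim tendsto_const_nhds
        (hpos.mono fun N hN => (hlow N hN).trans ?_) (hpos.mono fun N hN => ?_)
      · exact div_le_div_of_nonneg_right (key N hN).2.1 N.cast_nonneg
      · exact div_le_one_of_le₀ (key N hN).2.2 N.cast_nonneg
    · refine tendsto_of_tendsto_of_tendsto_of_le_of_le' hlim tendsto_const_nhds
        (hpos.mono fun N hN => hlow N hN) (hpos.mono fun N hN => ?_)
      exact div_le_one_of_le₀ ((key N hN).2.1.trans (key N hN).2.2) N.cast_nonneg
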